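/- Let $R_0>0$ and $S^1=\mathbb{R}/2\pi\mathbb{Z}$. Let $U,A\in C([R_0,\infty);H^1(S^1))\cap C^1([R_0,\infty);L^2(S^1))$ and $\eta\in C([R_0,\infty);W^{1,1}(S^1))\cap C^1([R_0,\infty);L^1(S^1))$ be the coefficients of a weakly regular Gowdy spacetime in areal coordinates, that is, in the sense of distributions on $(R_0,\infty)\times S^1$, $$(RU_R)_R-(RU_\theta)_\theta=\frac{e^{4U}}{2R}\,(A_R^2-A_\theta^2),\qquad (R^{-1}A_R)_R-(R^{-1}A_\theta)_\theta=\frac4R\,(-U_RA_R+U_\theta A_\theta),$$ $$\eta_{RR}-\eta_{\theta\theta}=-U_R^2+U_\theta^2+\frac{e^{4U}}{4R^2}(A_R^2-A_\theta^2),\tag{1}$$ and moreover the constraints $$\eta_R=R\Big(U_R^2+U_\theta^2+\frac{e^{4U}}{4R^2}(A_R^2+A_\theta^2)\Big),\qquad \eta_\theta=R\Big(2U_RU_\theta+\frac{e^{4U}}{2R^2}A_RA_\theta\Big)$$ hold. Let $g=e^{2(\eta-U)}(-dR^2+d\theta^2)+e^{2U}(dx+A\,dy)^2+e^{-2U}R^2dy^2$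 on $\mathcal M=[R_0,\infty)\times T^3$. Let $s_0<s_1$ and let $\xi:[s_0,s_1]\to\mathcal M$ be a $W^{1,\infty}$ (i.e. Lipschitz) curve that is uniformly timelike, i.e. $g(\dot\xi,\dot\xi)<-C$ a.e. for some constant $C>0$, and time-oriented, i.e. either $\dot\xi^R>0$ a.e. (future-directed) or $\dot\xi^R<0$ a.e. (past-directed). Then: 1. $\eta\circ\xi\in W^{1,1}(s_0,s_1)$. 2. $U\circ\xi,\ A\circ\xi\in H^1(s_0,s_1)$. 3. Let $(T,Z,X,Y)$ be any adapted frame, i.e. a smooth frame on $\mathcal M$ with $X=\partial_x$, $Y=\partial_y$ and with $T,Z$ invariant under the flows of $X$ and $Y$ (for instance $(\partial_R,\partial_\theta,\partial_x,\partial_y)$), and let $\Gamma^\gamma_{\alpha\beta}$ denote Christoffel symbols in this frame. Then there exist functions $\Gamma^\gamma_{\alpha\beta|\xi}\in L^1(s_0,s_1)$ such that (a) if $U,A,\eta$ are smooth, then $\Gamma^\gamma_{\alpha\beta|\xi}=\Gamma^\gamma_{\alpha\beta}\circ\xi$ a.e.; (b) for every sequence of smooth solutions $(U_n,A_n,\eta_n)$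 of the three wave equations (1) on $[R_0,\infty)\times S^1$ with $U_n\to U$, $A_n\to A$ in $C([R_0,\infty);H^1(S^1))\cap C^1([R_0,\infty);L^2(S^1))$ and $\eta_n\to\eta$ in $C([R_0,\infty);W^{1,1}(S^1))\cap C^1([R_0,\infty);L^1(S^1))$ (uniformly on compact intervals of $R$), the Christoffel symbols ${}^n\Gamma^\gamma_{\alpha\beta}$ of the corresponding metrics satisfy $\|{}^n\Gamma^\gamma_{\alpha\beta}\circ\xi-\Gamma^\gamma_{\alpha\beta|\xi}\|_{L^1(s_0,s_1)}\to0$. 4. Moreover these traces satisfy $\Gamma^\alpha_{ab|\xi}\in L^2(s_0,s_1)$ whenever $a,b\in\{X,Y\}$ and $\alpha\in\{T,Z\}$ (that is, $\alpha\in\{R,\theta\}$ for the coordinate frame). -/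

import Mathlib

open MeasureTheory Filter Topology Set
open scoped ContDiff

noncomputable section

namespace Gowdy

/-! ### Sobolev spaces on an interval -/

/-- Lebesgue measure on the open interval `(a, b)`. -/
def intervalMeasure (a b : ℝ) : Measure ℝ := volume.restrict (Ioo a b)

/-- `g` is the weak derivative of `f` on `(a, b)`. -/
def HasWeakDeriv (a b : ℝ) (f g : ℝ → ℝ) : Prop :=
  ∀ φ : ℝ → ℝ, ContDiff ℝ ∞ φ → HasCompactSupport φ → tsupport φ ⊆ Ioo a b →
    ∫ s, f s * deriv φ s ∂(intervalMeasure a b) = -∫ s, g s * φ s ∂(intervalMeasure a b)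

/-- `f ∈ W^{1,p}(a, b)`. For `p = 2` this is `H^1(a, b)`. -/
def MemW1 (p : ENNReal) (a b : ℝ) (f : ℝ → ℝ) : Prop :=
  MemLp f p (intervalMeasure a b) ∧
    ∃ g : ℝ → ℝ, MemLp g p (intervalMeasure a b) ∧ HasWeakDeriv a b f g

/-! ### Functions of `(R, θ)` on `[R₀, ∞) × S¹`

`S¹` is `[0, 2π]` with periodic boundary conditions: functions on it are `2π`-periodic functions
of `θ ∈ ℝ`. -/

/-- Lebesgue measure on the circle, seen as the interval `(0, 2π)`. -/
def circleMeasure : Measure ℝ := intervalMeasure 0 (2 * Real.pi)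

/-- A pair of functions standing for the first derivatives `∂_R f` and `∂_θ f` of a function `f`
of `(R, θ)`. -/
structure Partials where
  R : ℝ → ℝ → ℝ
  θ : ℝ → ℝ → ℝ

/-- `f ∈ C([R₀, ∞); W^{1,p}(S¹)) ∩ C¹([R₀, ∞); L^p(S¹))` with first derivatives `f'`, where `f` is
given by its continuous representative on every slice (recall `W^{1,p}(S¹) ⊆ C(S¹)`) and the
derivatives by jointly measurable periodic representatives. The continuity of `R ↦ f(R, ·)` in
`L^p(S¹)` is implied by its differentiability. -/
structure IsEnergyField (p : ENNReal) (R₀ : ℝ) (f : ℝ → ℝ → ℝ) (f' : Partials) : Prop where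
  periodic : ∀ R, R₀ ≤ R → Function.Periodic (f R) (2 * Real.pi)
  continuous : ∀ R, R₀ ≤ R → Continuous (f R)
  measurable_R : Measurable (Function.uncurry f'.R)
  measurable_θ : Measurable (Function.uncurry f'.θ)
  periodic_R : ∀ R, R₀ ≤ R → Function.Periodic (f'.R R) (2 * Real.pi)
  periodic_θ : ∀ R, R₀ ≤ R → Function.Periodic (f'.θ R) (2 * Real.pi)
  memLp_R : ∀ R, R₀ ≤ R → MemLp (f'.R R) p circleMeasure
  memLp_θ : ∀ R, R₀ ≤ R → MemLp (f'.θ R) p circleMeasure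
  /-- `f'.θ R` is the weak derivative of `f R` on the circle. -/
  weakDeriv_θ : ∀ R, R₀ ≤ R → ∀ φ : ℝ → ℝ, ContDiff ℝ ∞ φ → Function.Periodic φ (2 * Real.pi) →
    ∫ θ, f R θ * deriv φ θ ∂circleMeasure = -∫ θ, f'.θ R θ * φ θ ∂circleMeasure
  /-- `f'.R` is the derivative of the `L^p(S¹)`-valued function `R ↦ f(R, ·)` on `[R₀, ∞)`. -/
  deriv_R : ∀ R, R₀ ≤ R →
    Tendsto (fun r => eLpNorm (fun θ => (r - R)⁻¹ * (f r θ - f R θ) - f'.R R θ) p circleMeasure)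
      (𝓝[Ici R₀ \ {R}] R) (𝓝 0)
  continuous_R : ∀ R, R₀ ≤ R →
    Tendsto (fun r => eLpNorm (fun θ => f'.R r θ - f'.R R θ) p circleMeasure)
      (𝓝[Ici R₀] R) (𝓝 0)
  continuous_θ : ∀ R, R₀ ≤ R →
    Tendsto (fun r => eLpNorm (fun θ => f'.θ r θ - f'.θ R θ) p circleMeasure)
      (𝓝[Ici R₀] R) (𝓝 0)

/-- `f` is smooth on `[R₀, ∞) × S¹` (up to the boundary `R = R₀`). -/
def IsSmoothField (R₀ : ℝ) (f : ℝ → ℝ → ℝ) : Prop :=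
  ContDiffOn ℝ ∞ (Function.uncurry f) (Ici R₀ ×ˢ univ) ∧
    ∀ R, R₀ ≤ R → Function.Periodic (f R) (2 * Real.pi)

/-- The classical first derivatives of a smooth function on `[R₀, ∞) × S¹`. -/
def classicalPartials (R₀ : ℝ) (f : ℝ → ℝ → ℝ) : Partials where
  R r θ := derivWithin (fun r' => f r' θ) (Ici R₀) r
  θ r θ := deriv (f r) θ

/-- The smooth functions `f n` converge to `f` in
`C([R₀, ∞); W^{1,p}(S¹)) ∩ C¹([R₀, ∞); L^p(S¹))`, that is, in the corresponding norms uniformly on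
every compact interval `[R₀, R₁]`. -/
def TendstoEnergy (p : ENNReal) (R₀ : ℝ) (f : ℕ → ℝ → ℝ → ℝ) (g : ℝ → ℝ → ℝ) : Prop :=
  ∃ g' : Partials, IsEnergyField p R₀ g g' ∧ ∀ R₁, R₀ ≤ R₁ →
    Tendsto (fun n => ⨆ R ∈ Icc R₀ R₁,
      (eLpNorm (fun θ => f n R θ - g R θ) p circleMeasure
        + eLpNorm (fun θ => (classicalPartials R₀ (f n)).R R θ - g'.R R θ) p circleMeasure
        + eLpNorm (fun θ => (classicalPartials R₀ (f n)).θ R θ - g'.θ R θ) p circleMeasure))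
      atTop (𝓝 0)

/-! ### The reduced Einstein equations in areal coordinates -/

/-- Test functions on `(R₀, ∞) × S¹`. -/
structure IsTestFunction (R₀ : ℝ) (φ : ℝ → ℝ → ℝ) : Prop where
  smooth : ContDiff ℝ ∞ (Function.uncurry φ)
  periodic : ∀ R, Function.Periodic (φ R) (2 * Real.pi)
  support : ∃ a b : ℝ, R₀ < a ∧ ∀ R θ, φ R θ ≠ 0 → R ∈ Icc a b

/-- The weighted wave operator tested against `φ`: for a weight `w(R)` and a function with first
derivatives `f'`, the pairing of the distribution `(w f_R)_R - (w f_θ)_θ` with `φ`. -/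
def waveOp (R₀ : ℝ) (w : ℝ → ℝ) (f' : Partials) (φ : ℝ → ℝ → ℝ) : ℝ :=
  ∫ r in Ioi R₀, ∫ θ, (-(w r * f'.R r θ) * deriv (fun r' => φ r' θ) r
    + (w r * f'.θ r θ) * deriv (φ r) θ) ∂circleMeasure

/-- The pairing of a function on `(R₀, ∞) × S¹` with `φ`. -/
def pairing (R₀ : ℝ) (h φ : ℝ → ℝ → ℝ) : ℝ :=
  ∫ r in Ioi R₀, ∫ θ, h r θ * φ r θ ∂circleMeasure

/-- `Ω^U`. -/
def OmegaU (U : ℝ → ℝ → ℝ) (A' : Partials) (r θ : ℝ) : ℝ :=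
  Real.exp (4 * U r θ) / (4 * r ^ 2) * (A'.R r θ ^ 2 - A'.θ r θ ^ 2)

/-- `Ω^A`. -/
def OmegaA (U : ℝ → ℝ → ℝ) (U' A' : Partials) (r θ : ℝ) : ℝ :=
  4 * Real.exp (2 * U r θ) / r * (-(U'.R r θ * A'.R r θ) + U'.θ r θ * A'.θ r θ)

/-- `Ω^η`. -/
def OmegaEta (U : ℝ → ℝ → ℝ) (U' A' : Partials) (r θ : ℝ) : ℝ :=
  (-(U'.R r θ ^ 2) + U'.θ r θ ^ 2)
    + Real.exp (4 * U r θ) / (4 * r ^ 2) * (A'.R r θ ^ 2 - A'.θ r θ ^ 2)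

/-- The energy density `E`. -/
def energyE (U : ℝ → ℝ → ℝ) (U' A' : Partials) (r θ : ℝ) : ℝ :=
  (U'.R r θ ^ 2 + U'.θ r θ ^ 2)
    + Real.exp (4 * U r θ) / (4 * r ^ 2) * (A'.R r θ ^ 2 + A'.θ r θ ^ 2)

/-- The energy flux `F`. -/
def energyF (U : ℝ → ℝ → ℝ) (U' A' : Partials) (r θ : ℝ) : ℝ :=
  2 * U'.R r θ * U'.θ r θ + Real.exp (4 * U r θ) / (2 * r ^ 2) * A'.R r θ * A'.θ r θ

/-- The three wave equations for `U, A, η`, in the sense of distributions on `(R₀, ∞) × S¹`: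
`(R U_R)_R - (R U_θ)_θ = 2 R Ω^U`, `(R⁻¹ A_R)_R - (R⁻¹ A_θ)_θ = e^{-2U} Ω^A` and
`η_RR - η_θθ = Ω^η`. -/
structure SatisfiesWaveEquations (R₀ : ℝ) (U : ℝ → ℝ → ℝ) (U' A' η' : Partials) : Prop where
  eq_U : ∀ φ, IsTestFunction R₀ φ →
    waveOp R₀ (fun r => r) U' φ = pairing R₀ (fun r θ => 2 * r * OmegaU U A' r θ) φ
  eq_A : ∀ φ, IsTestFunction R₀ φ →
    waveOp R₀ (fun r => r⁻¹) A' φ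
      = pairing R₀ (fun r θ => Real.exp (-2 * U r θ) * OmegaA U U' A' r θ) φ
  eq_η : ∀ φ, IsTestFunction R₀ φ →
    waveOp R₀ (fun _ => 1) η' φ = pairing R₀ (OmegaEta U U' A') φ

/-- `(U, A, η)` are the coefficients of a weakly regular Gowdy spacetime in areal coordinates:
they have the stated regularity, solve the three wave equations in the sense of distributions, and
satisfy the constraints `η_R = R E`, `η_θ = R F`. The derivatives, being determined up to null
sets, may be existentially quantified. -/
def IsWeakSolution (R₀ : ℝ) (U A η : ℝ → ℝ → ℝ) : Prop :=
  ∃ U' A' η' : Partials,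
    IsEnergyField 2 R₀ U U' ∧ IsEnergyField 2 R₀ A A' ∧ IsEnergyField 1 R₀ η η' ∧
    SatisfiesWaveEquations R₀ U U' A' η' ∧
    (∀ R, R₀ ≤ R → ∀ᵐ θ ∂circleMeasure, η'.R R θ = R * energyE U U' A' R θ) ∧
    (∀ R, R₀ ≤ R → ∀ᵐ θ ∂circleMeasure, η'.θ R θ = R * energyF U U' A' R θ)

/-- `(U, A, η)` is a smooth solution of the three wave equations on `[R₀, ∞) × S¹`. -/
def IsSmoothSolution (R₀ : ℝ) (U A η : ℝ → ℝ → ℝ) : Prop :=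
  IsSmoothField R₀ U ∧ IsSmoothField R₀ A ∧ IsSmoothField R₀ η ∧
    SatisfiesWaveEquations R₀ U (classicalPartials R₀ U) (classicalPartials R₀ A)
      (classicalPartials R₀ η)

/-! ### The metric, its connection, and adapted frames

Points of `[R₀, ∞) × T³` are described by their coordinates `p = (R, θ, x, y)`, with `θ, x, y` in
the universal cover `ℝ` of the circle; the indices `0, 1, 2, 3` stand for `R, θ, x, y`. -/

/-- The coordinate domain `[R₀, ∞) × ℝ³`. -/
def domain (R₀ : ℝ) : Set (Fin 4 → ℝ) := {p | R₀ ≤ p 0}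

/-- The matrix, in the coordinates `(R, θ, x, y)`, of the metric
`e^{2(η-U)} (-dR² + dθ²) + e^{2U} (dx + A dy)² + e^{-2U} R² dy²`. -/
def metric (U A η : ℝ → ℝ → ℝ) (p : Fin 4 → ℝ) : Matrix (Fin 4) (Fin 4) ℝ :=
  let u := U (p 0) (p 1)
  let a := A (p 0) (p 1)
  let n := η (p 0) (p 1)
  !![-Real.exp (2 * (n - u)), 0, 0, 0;
     0, Real.exp (2 * (n - u)), 0, 0;
     0, 0, Real.exp (2 * u), Real.exp (2 * u) * a;
     0, 0, Real.exp (2 * u) * a, Real.exp (2 * u) * a ^ 2 + Real.exp (-2 * u) * (p 0) ^ 2]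

/-- The Christoffel symbols `Γ^a_{bc}` in coordinates of a metric `g` on the domain `S`
(which may have boundary points). -/
def coordChristoffel (g : (Fin 4 → ℝ) → Matrix (Fin 4) (Fin 4) ℝ) (S : Set (Fin 4 → ℝ))
    (a b c : Fin 4) (p : Fin 4 → ℝ) : ℝ :=
  let D (k i j : Fin 4) : ℝ := fderivWithin ℝ (fun q => g q i j) S p (Pi.single k 1)
  (1 / 2) * ∑ d, (g p)⁻¹ a d * (D b d c + D c d b - D d b c)

/-- The covariant derivative `∇_v w` of vector fields, for the Levi-Civita connection of `g`. -/
def covDeriv (g : (Fin 4 → ℝ) → Matrix (Fin 4) (Fin 4) ℝ) (S : Set (Fin 4 → ℝ))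
    (v w : (Fin 4 → ℝ) → (Fin 4 → ℝ)) (p : Fin 4 → ℝ) : Fin 4 → ℝ := fun a =>
  fderivWithin ℝ w S p (v p) a + ∑ b, ∑ c, coordChristoffel g S a b c p * v p b * w p c

/-- A smooth frame `(T, Z, X, Y)`, numbered `0, 1, 2, 3`, adapted to the symmetry: `X = ∂_x` and
`Y = ∂_y` are the Killing fields, and `T, Z` are invariant under the flows of `X` and `Y`, that is,
their components depend on `(R, θ)` only. The coordinate frame `(∂_R, ∂_θ, ∂_x, ∂_y)` is one. -/
structure AdaptedFrame (R₀ : ℝ) where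
  e : Fin 4 → (Fin 4 → ℝ) → (Fin 4 → ℝ)
  smooth : ∀ i, ContDiffOn ℝ ∞ (e i) (domain R₀)
  invariant : ∀ i p q, p 0 = q 0 → p 1 = q 1 → e i p = e i q
  periodic : ∀ i, Function.Periodic (e i) (Pi.single 1 (2 * Real.pi))
  X_eq : ∀ p, e 2 p = Pi.single 2 1
  Y_eq : ∀ p, e 3 p = Pi.single 3 1
  basis : ∀ p ∈ domain R₀, (Matrix.of fun i j => e j p i).det ≠ 0

/-- The Christoffel symbols `Γ^a_{bc}` of the Gowdy metric with smooth coefficients `U, A, η` in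
the frame `(e_0, …, e_3)`, defined by `∇_{e_b} e_c = ∑_a Γ^a_{bc} e_a`. -/
def christoffel {R₀ : ℝ} (𝓕 : AdaptedFrame R₀) (U A η : ℝ → ℝ → ℝ) (a b c : Fin 4)
    (p : Fin 4 → ℝ) : ℝ :=
  ((Matrix.of fun i j => 𝓕.e j p i)⁻¹).mulVec
    (covDeriv (metric U A η) (domain R₀) (𝓕.e b) (𝓕.e c) p) a

/-! ### Curves -/

/-- A curve `ξ : [s₀, s₁] → [R₀, ∞) × T³` of class `W^{1,∞}`, that is, Lipschitz continuous, given
through a lift to the universal cover. -/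
def IsW1InftyCurve (R₀ s₀ s₁ : ℝ) (ξ : ℝ → Fin 4 → ℝ) : Prop :=
  (∃ K, LipschitzOnWith K ξ (Icc s₀ s₁)) ∧ ∀ s ∈ Icc s₀ s₁, ξ s ∈ domain R₀

/-- `ξ` is uniformly timelike: `g(ξ', ξ') < -C` almost everywhere for some `C > 0`. -/
def IsUniformlyTimelike (U A η : ℝ → ℝ → ℝ) (s₀ s₁ : ℝ) (ξ : ℝ → Fin 4 → ℝ) : Prop :=
  ∃ C : ℝ, 0 < C ∧ ∀ᵐ s ∂(intervalMeasure s₀ s₁),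
    deriv ξ s ⬝ᵥ (metric U A η (ξ s)).mulVec (deriv ξ s) < -C

/-- `ξ` is time-oriented: either future-directed or past-directed. -/
def IsTimeOriented (s₀ s₁ : ℝ) (ξ : ℝ → Fin 4 → ℝ) : Prop :=
  (∀ᵐ s ∂(intervalMeasure s₀ s₁), 0 < deriv ξ s 0) ∨
    (∀ᵐ s ∂(intervalMeasure s₀ s₁), deriv ξ s 0 < 0)

end Gowdy

end

/-!
Every field `f` among `U`, `A`, `η` solves a linear wave equation `(w f_R)_R - (w f_θ)_θ = H` with
`w = R`, `R⁻¹`, `1` and a source `H ∈ L¹_loc`. Its null derivatives `f_R ∓ f_θ` therefore satisfy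
transport equations along the characteristics `θ ± R = const`. Testing the wave equation against
products of a cut-off in `R` and a function constant along characteristics, and applying the lemma
of du Bois-Reymond, shows that on every slice of constant `R` the null derivative agrees almost
everywhere with the representative `charRep`, obtained from the initial data by integrating the
source along a characteristic (`IsWaveField.ae_eq_charRep`).

A uniformly timelike, time-oriented curve crosses both families of characteristics at a speed
bounded from below (`exists_isTransversal`): the metric coefficients are bounded on the compact
range of the curve, so `|ξ^R'| - |ξ^θ'|` is bounded from below. Hence the change of variables from
the curve parameter to the label of a characteristic costs only a constant factor, and the `L¹` norm
along the curve of `charRep` is controlled by the `L¹` norms of the initial data and of the source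
(`IsTransversal.exists_trace_dist_le`). This defines the trace of a first derivative along the
curve, and gives its continuous dependence on the data as well as its continuity under
`θ`-translations (`IsTraceable`). The latter makes Steklov averages in `θ` converge along the curve,
which transfers the chain rule from the averages to `f` itself (`IsTransversal.sub_eq_integral_trace`,
`IsTransversal.memW1`).

The `L²` statements use the constraints: a null derivative of `η` is `R` times a positive
combination of squares of the corresponding null derivatives of `U` and `A` (`nullDeriv_eta`). The
inequality between the null derivatives holds almost everywhere in the half cylinder; it passes to
the traces by averaging over translates of the curve (`IsTraceable.trace_sq_le`), and since the
trace of `η` is in `L¹`, those of `U` and `A` are in `L²`.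

The sources are quadratic in the first derivatives, so convergence in the energy norms implies `L¹`
convergence of the sources and thus of the traces (`IsWaveField.tendstoL1_trace`). The Christoffel
symbols of a frame are linear in the first derivatives of `U`, `A`, `η`, with coefficients that are
continuous functions of the position and of `U`, `A`, `η`, so they converge in `L¹` along the curve
(`AdaptedFrame.tendstoL1_christoffel`). When both lower indices are `X` or `Y` and the upper one is
`T` or `Z`, the only derivatives which occur are those of `U` and `A`, whence the `L²` bound
(`JetTendsto.memLp_coordChristoffel`).
-/

noncomputable section

namespace Gowdy

/-! ### Weak derivatives on an interval -/

theorem exists_Icc_of_isCompact_subset_Ioo {a b : ℝ} (hab : a < b) {K : Set ℝ} (hK : IsCompact K)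
    (h : K ⊆ Ioo a b) : ∃ α β, a < α ∧ α < β ∧ β < b ∧ K ⊆ Icc α β := by
  rcases K.eq_empty_or_nonempty with rfl | hne
  · exact ⟨(2 * a + b) / 3, (a + 2 * b) / 3, by linarith, by linarith, by linarith, by simp⟩
  · have h1 := h (hK.sInf_mem hne)
    have h2 := h (hK.sSup_mem hne)
    refine ⟨(a + sInf K) / 2, (b + sSup K) / 2, by linarith [h1.1], ?_, by linarith [h2.2], ?_⟩
    · have := Real.sInf_le_sSup K hK.bddBelow hK.bddAbove
      linarith [h1.1, h2.2]
    · intro x hx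
      have e1 := csInf_le hK.bddBelow hx
      have e2 := le_csSup hK.bddAbove hx
      exact ⟨by linarith [h1.1], by linarith [h2.2]⟩

/-- A test function of vanishing integral is the derivative of a test function. -/
theorem exists_testFunction_deriv_eq {a b : ℝ} (hab : a < b) {g : ℝ → ℝ} (hg : ContDiff ℝ ∞ g)
    (hc : HasCompactSupport g) (hs : tsupport g ⊆ Ioo a b) (h0 : ∫ x in a..b, g x = 0) :
    ∃ χ : ℝ → ℝ, ContDiff ℝ ∞ χ ∧ HasCompactSupport χ ∧ tsupport χ ⊆ Ioo a b ∧ deriv χ = g := by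
  obtain ⟨α, β, ha, hαβ, hb, hK⟩ := exists_Icc_of_isCompact_subset_Ioo hab hc hs
  have hz : ∀ x, x ∉ Icc α β → g x = 0 := fun x hx => image_eq_zero_of_notMem_tsupport
    (fun h => hx (hK h))
  have hd : ∀ x, HasDerivAt (fun x => ∫ y in a..x, g y) (g x) x := fun x =>
    hg.continuous.integral_hasStrictDerivAt a x |>.hasDerivAt
  have hderiv : deriv (fun x => ∫ y in a..x, g y) = g := funext fun x => (hd x).deriv
  have hzero : ∀ x, x ∉ Icc α β → ∫ y in a..x, g y = 0 := by
    intro x hx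
    have hx' : x < α ∨ β < x := by
      by_contra! h
      exact hx h
    rcases hx' with hx' | hx'
    · rw [intervalIntegral.integral_congr (g := fun _ => (0 : ℝ))]
      · simp
      · intro y hy
        apply hz
        rintro ⟨h1, h2⟩
        have := hy.2
        rcases max_cases a x with h | h <;> linarith
    · rw [← intervalIntegral.integral_add_adjacent_intervals (b := b)
        (hg.continuous.intervalIntegrable _ _) (hg.continuous.intervalIntegrable _ _), h0,
        intervalIntegral.integral_congr (g := fun _ => (0 : ℝ))]
      · simp
      · intro y hy
        apply hz
        rintro ⟨h1, h2⟩
        have := hy.1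
        rcases min_cases b x with h | h <;> linarith
  have hsub : tsupport (fun x => ∫ y in a..x, g y) ⊆ Icc α β := by
    apply closure_minimal _ isClosed_Icc
    intro x hx
    by_contra h
    exact hx (hzero x h)
  refine ⟨fun x => ∫ y in a..x, g y, ?_, ?_, ?_, hderiv⟩
  · rw [contDiff_infty_iff_deriv, hderiv]
    exact ⟨fun x => (hd x).differentiableAt, hg⟩
  · exact isCompact_Icc.of_isClosed_subset (isClosed_tsupport _) hsub
  · exact hsub.trans fun x hx => ⟨by linarith [hx.1], by linarith [hx.2]⟩

/-- Integration by parts of a test function against a primitive of an integrable function. -/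
theorem integral_deriv_mul_primitive {a b : ℝ} {G : ℝ → ℝ}
    (hG : IntervalIntegrable G volume a b) {χ : ℝ → ℝ} (hχ : ContDiff ℝ ∞ χ)
    (ha : χ a = 0) (hb : χ b = 0) :
    ∫ x in a..b, deriv χ x * ∫ y in a..x, G y = -∫ x in a..b, χ x * G x := by
  have h1 : AbsolutelyContinuousOnInterval χ a b :=
    (hχ.contDiffOn.of_le (by exact_mod_cast le_top)).absolutelyContinuousOnInterval
  have h2 := hG.absolutelyContinuousOnInterval_intervalIntegral (c := a) left_mem_uIcc
  have h3 := h1.integral_mul_deriv_eq_deriv_mul h2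
  rw [ha, hb] at h3
  have h4 : ∫ x in a..b, χ x * deriv (fun x => ∫ y in a..x, G y) x = ∫ x in a..b, χ x * G x := by
    apply intervalIntegral.integral_congr_ae
    filter_upwards [hG.ae_hasDerivAt_integral] with x hx hxm
    rw [(hx (uIoc_subset_uIcc hxm) a left_mem_uIcc).deriv]
  rw [h4] at h3
  rw [h3]
  ring

/-- The fundamental lemma of du Bois-Reymond: a continuous function with an integrable weak
derivative is a primitive of that derivative. -/
theorem eq_add_integral_of_weakDeriv {a b : ℝ} (hab : a < b) {L G : ℝ → ℝ}
    (hL : ContinuousOn L (Icc a b)) (hG : IntervalIntegrable G volume a b)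
    (h : ∀ χ : ℝ → ℝ, ContDiff ℝ ∞ χ → HasCompactSupport χ → tsupport χ ⊆ Ioo a b →
      ∫ x in a..b, (deriv χ x * L x + χ x * G x) = 0) :
    ∀ x ∈ Icc a b, L x = L a + ∫ y in a..x, G y := by
  set Lt : ℝ → ℝ := fun x => L x - ∫ y in a..x, G y with hLt
  have hPc : ContinuousOn (fun x => ∫ y in a..x, G y) (Icc a b) := by
    have := (hG.absolutelyContinuousOnInterval_intervalIntegral (c := a) left_mem_uIcc).continuousOn
    rwa [uIcc_of_le hab.le] at this
  have hLtc : ContinuousOn Lt (Icc a b) := hL.sub hPc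
  have zero_of : ∀ χ : ℝ → ℝ, tsupport χ ⊆ Ioo a b → χ a = 0 ∧ χ b = 0 := fun χ hs =>
    ⟨image_eq_zero_of_notMem_tsupport fun h => lt_irrefl _ (hs h).1,
      image_eq_zero_of_notMem_tsupport fun h => lt_irrefl _ (hs h).2⟩
  have ii : ∀ (u v : ℝ → ℝ), Continuous u → ContinuousOn v (Icc a b) →
      IntervalIntegrable (fun x => u x * v x) volume a b := fun u v hu hv =>
    ContinuousOn.intervalIntegrable (by rw [uIcc_of_le hab.le]; exact hu.continuousOn.mul hv)
  have key : ∀ χ : ℝ → ℝ, ContDiff ℝ ∞ χ → HasCompactSupport χ → tsupport χ ⊆ Ioo a b →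
      ∫ x in a..b, deriv χ x * Lt x = 0 := by
    intro χ h1 h2 h3
    have hχ' : Continuous (deriv χ) := h1.continuous_deriv (by simp)
    have e := h χ h1 h2 h3
    have e2 := integral_deriv_mul_primitive hG h1 (zero_of χ h3).1 (zero_of χ h3).2
    rw [intervalIntegral.integral_add (ii _ _ hχ' hL)
      (hG.continuousOn_mul h1.continuous.continuousOn)] at e
    simp only [hLt, mul_sub]
    rw [intervalIntegral.integral_sub (ii _ _ hχ' hL) (ii _ _ hχ' hPc), e2]
    linarith
  -- a fixed test function of integral one
  let c := (a + b) / 2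
  let ρ : ContDiffBump c := ⟨(b - a) / 8, (b - a) / 4, by linarith, by linarith⟩
  set ρ0 : ℝ → ℝ := ρ.normed volume with hρ0
  have hρs : tsupport ρ0 ⊆ Ioo a b := by
    rw [hρ0, ρ.tsupport_normed_eq, Real.closedBall_eq_Icc]
    intro x hx
    simp only [c, ρ, mem_Icc] at hx
    exact ⟨by linarith [hx.1], by linarith [hx.2]⟩
  have hρ1 : ∫ x in a..b, ρ0 x = 1 := by
    rw [intervalIntegral.integral_of_le hab.le,
      setIntegral_eq_integral_of_forall_compl_eq_zero, hρ0, ρ.integral_normed]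
    intro x hx
    exact image_eq_zero_of_notMem_tsupport fun h => hx (Ioo_subset_Ioc_self (hρs h))
  have hρc : ContDiff ℝ ∞ ρ0 := ρ.contDiff_normed
  have hρcs : HasCompactSupport ρ0 := ρ.hasCompactSupport_normed
  set κ := ∫ x in a..b, ρ0 x * Lt x with hκ
  have hvan : ∀ᵐ x, x ∈ Ioo a b → Lt x - κ = 0 := by
    refine isOpen_Ioo.ae_eq_zero_of_integral_contDiff_smul_eq_zero ?_ ?_
    · exact ((hLtc.mono Ioo_subset_Icc_self).sub continuousOn_const).locallyIntegrableOn
        measurableSet_Ioo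
    · intro g hg1 hg2 hg3
      have hm : ∫ x in a..b, (g x - (∫ y in a..b, g y) * ρ0 x) = 0 := by
        rw [intervalIntegral.integral_sub (hg1.continuous.intervalIntegrable _ _)
          ((hρc.continuous.intervalIntegrable _ _).const_mul _),
          intervalIntegral.integral_const_mul, hρ1]
        ring
      have hts : tsupport (fun x => g x - (∫ y in a..b, g y) * ρ0 x) ⊆
          tsupport g ∪ tsupport ρ0 := by
        refine closure_minimal ?_ ((isClosed_tsupport _).union (isClosed_tsupport _))
        intro x hx
        by_contra hn
        simp only [mem_union, not_or] at hn
        apply hx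
        simp [image_eq_zero_of_notMem_tsupport hn.1, image_eq_zero_of_notMem_tsupport hn.2]
      obtain ⟨χ, h1, h2, h3, h4⟩ := exists_testFunction_deriv_eq hab
        (g := fun x => g x - (∫ y in a..b, g y) * ρ0 x)
        (hg1.sub (contDiff_const.mul hρc))
        ((hg2.isCompact.union hρcs.isCompact).of_isClosed_subset (isClosed_tsupport _) hts)
        (hts.trans (union_subset hg3 hρs)) hm
      have e := key χ h1 h2 h3
      rw [h4] at e
      have e' : ∫ x in a..b, g x * Lt x = (∫ y in a..b, g y) * κ := by
        have : ∀ x, (g x - (∫ y in a..b, g y) * ρ0 x) * Lt x =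
            g x * Lt x - (∫ y in a..b, g y) * (ρ0 x * Lt x) := fun x => by ring
        simp only [this] at e
        rw [intervalIntegral.integral_sub (ii _ _ hg1.continuous hLtc)
          ((ii _ _ hρc.continuous hLtc).const_mul _), intervalIntegral.integral_const_mul] at e
        linarith
      rw [← setIntegral_eq_integral_of_forall_compl_eq_zero (s := Ioc a b),
        ← intervalIntegral.integral_of_le hab.le]
      · simp only [smul_eq_mul, mul_sub]
        rw [intervalIntegral.integral_sub (ii _ _ hg1.continuous hLtc)
          ((hg1.continuous.intervalIntegrable _ _).mul_const _), e',
          intervalIntegral.integral_mul_const]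
        ring
      · intro x hx
        have : g x = 0 :=
          image_eq_zero_of_notMem_tsupport fun h => hx (Ioo_subset_Ioc_self (hg3 h))
        simp [this]
  have hconst : ∀ x ∈ Icc a b, Lt x = κ := by
    have h1 : EqOn Lt (fun _ => κ) (Ioo a b) := by
      refine Measure.eqOn_open_of_ae_eq (μ := volume) ?_ isOpen_Ioo
        (hLtc.mono Ioo_subset_Icc_self) continuousOn_const
      refine (ae_restrict_iff' measurableSet_Ioo).2 ?_
      filter_upwards [hvan] with x hx hxm
      linarith [hx hxm]
    have h2 := h1.of_subset_closure hLtc continuousOn_const Ioo_subset_Icc_self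
      (by rw [closure_Ioo hab.ne])
    exact h2
  intro x hx
  have h1 := hconst x hx
  have h2 := hconst a (left_mem_Icc.2 hab.le)
  simp only [hLt, intervalIntegral.integral_same] at h1 h2
  linarith

/-! ### Periodic functions -/

/-- A test function on `(0, T)` extends to a smooth periodic function on the line. -/
theorem exists_periodic_extension {T : ℝ} (hT : 0 < T) {φ : ℝ → ℝ} (hφ : ContDiff ℝ ∞ φ)
    (hc : HasCompactSupport φ) (hs : tsupport φ ⊆ Ioo 0 T) :
    ∃ g : ℝ → ℝ, ContDiff ℝ ∞ g ∧ Function.Periodic g T ∧ EqOn g φ (Ioo 0 T) := by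
  obtain ⟨α, β, ha, hαβ, hb, hK⟩ := exists_Icc_of_isCompact_subset_Ioo hT hc hs
  have hz : ∀ x, x ∉ Icc α β → φ x = 0 := fun x hx => image_eq_zero_of_notMem_tsupport
    (fun h => hx (hK h))
  let g : ℝ → ℝ := fun x => φ (toIcoMod hT 0 x)
  have hgp : Function.Periodic g T := fun x => by simp [g]
  have hg : EqOn g φ (Ico 0 T) := by
    intro x hx
    have : toIcoMod hT 0 x = x := (toIcoMod_eq_self hT).2 (by simpa using hx)
    simp [g, this]
  refine ⟨g, ?_, hgp, hg.mono Ioo_subset_Ico_self⟩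
  -- `g` agrees with `φ` on an open interval containing a full period
  have hloc : EqOn g φ (Ioo (β - T) T) := by
    intro x hx
    rcases lt_or_ge x 0 with h0 | h0
    · rw [hz x (fun h => by linarith [h.1]), ← hgp x, hg ⟨by linarith [hx.1], by linarith⟩,
        hz _ (fun h => by linarith [h.2, hx.1])]
    · exact hg ⟨h0, hx.2⟩
  have hd : ∀ x ∈ Ioo (β - T) T, ContDiffAt ℝ ∞ g x := fun x hx =>
    hφ.contDiffAt.congr_of_eventuallyEq (hloc.eventuallyEq_of_mem (isOpen_Ioo.mem_nhds hx))
  rw [contDiff_iff_contDiffAt]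
  intro x
  have hm := toIcoMod_mem_Ico hT 0 x
  rw [zero_add] at hm
  have h1 := hd (toIcoMod hT 0 x) ⟨by linarith [hm.1], hm.2⟩
  have h2 : g = g ∘ fun y => y - toIcoDiv hT 0 x • T := by
    ext y
    exact (hgp.sub_zsmul_eq _).symm
  rw [h2]
  apply ContDiffAt.comp
  · have : x - toIcoDiv hT 0 x • T = toIcoMod hT 0 x := rfl
    rw [this]
    exact h1
  · fun_prop

theorem lintegral_periodic_Ioc {T : ℝ} (hT : 0 < T) {g : ℝ → ENNReal}
    (hg : Function.Periodic g T) (a b : ℝ) :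
    ∫⁻ x in Ioc a (a + T), g x = ∫⁻ x in Ioc b (b + T), g x := by
  refine IsAddFundamentalDomain.setLIntegral_eq (isAddFundamentalDomain_Ioc hT a)
    (isAddFundamentalDomain_Ioc hT b) g ?_
  rintro ⟨c, hc⟩ x
  obtain ⟨n, rfl⟩ := AddSubgroup.mem_zmultiples_iff.1 hc
  change g (n • T + x) = g x
  rw [add_comm]
  exact hg.zsmul n x

theorem lintegral_periodic_le {T : ℝ} (hT : 0 < T) {g : ℝ → ENNReal}
    (hg : Function.Periodic g T) (a : ℝ) (n : ℕ) :
    ∫⁻ x in Ioc a (a + n * T), g x ≤ n * ∫⁻ x in Ioc 0 T, g x := by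
  induction n with
  | zero => simp
  | succ n ih =>
    have h1 : Ioc a (a + (n + 1 : ℕ) * T) ⊆
        Ioc a (a + n * T) ∪ Ioc (a + n * T) (a + n * T + T) := by
      rw [Ioc_union_Ioc_eq_Ioc (by nlinarith [(Nat.cast_nonneg n : (0 : ℝ) ≤ n)]) (by linarith)]
      apply Ioc_subset_Ioc_right
      push_cast
      linarith
    have h2 := lintegral_periodic_Ioc hT hg (a + n * T) 0
    rw [zero_add] at h2
    calc _ ≤ ∫⁻ x in Ioc a (a + n * T) ∪ Ioc (a + n * T) (a + n * T + T), g x :=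
          lintegral_mono_set h1
      _ ≤ _ := lintegral_union_le _ _ _
      _ ≤ n * (∫⁻ x in Ioc 0 T, g x) + ∫⁻ x in Ioc 0 T, g x := by rw [h2]; gcongr
      _ = _ := by push_cast; ring

/-! ### Continuity of translations in `L¹` -/

theorem tendsto_lintegral_translate_sub {E : Type*} [NormedAddCommGroup E] [NormedSpace ℝ E]
    [FiniteDimensional ℝ E] [MeasurableSpace E] [BorelSpace E] (μ : Measure E)
    [μ.IsAddHaarMeasure] {f : E → ℝ} (hf : Integrable f μ) :
    Tendsto (fun t => ∫⁻ x, ‖f (t + x) - f x‖ₑ ∂μ) (𝓝 0) (𝓝 0) := by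
  have hm : MemLp f 1 μ := memLp_one_iff_integrable.2 hf
  have : Fact ((1 : ENNReal) ≠ ⊤) := ⟨by simp⟩
  have h1 : Continuous fun t : E => (DomAddAct.mk t) +ᵥ (hm.toLp f) :=
    (continuous_id.vadd (M := Eᵈᵃᵃ) (continuous_const (y := hm.toLp f))).comp
      DomAddAct.continuous_mk
  have h2 : Tendsto (fun t : E => edist (DomAddAct.mk t +ᵥ hm.toLp f) (hm.toLp f)) (𝓝 0) (𝓝 0) := by
    have h3 := (h1.edist (continuous_const (y := hm.toLp f))).tendsto 0
    have h4 : (DomAddAct.mk (0 : E) +ᵥ hm.toLp f) = hm.toLp f := by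
      rw [DomAddAct.mk_zero]
      exact zero_vadd (Eᵈᵃᵃ) (hm.toLp f)
    rw [h4, edist_self] at h3
    exact h3
  refine h2.congr fun t => ?_
  rw [DomAddAct.mk_vadd_toLp t hm, Lp.edist_toLp_toLp, eLpNorm_one_eq_lintegral_enorm]
  rfl

/-! ### The circle measure -/

theorem two_pi_pos' : 0 < 2 * Real.pi := by positivity

theorem circleMeasure_eq : circleMeasure = volume.restrict (Ioc 0 (2 * Real.pi)) := by
  rw [circleMeasure, intervalMeasure]
  exact Measure.restrict_congr_set Ioo_ae_eq_Ioc

instance : IsFiniteMeasure circleMeasure := by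
  rw [circleMeasure_eq]
  infer_instance

theorem circleMeasure_univ : circleMeasure univ = ENNReal.ofReal (2 * Real.pi) := by
  rw [circleMeasure_eq]
  simp

theorem one_le_circleMeasure_univ : 1 ≤ circleMeasure univ := by
  rw [circleMeasure_univ, ← ENNReal.ofReal_one]
  exact ENNReal.ofReal_le_ofReal (by linarith [Real.pi_gt_three])

theorem integral_circle (f : ℝ → ℝ) :
    ∫ θ, f θ ∂circleMeasure = ∫ θ in (0)..(2 * Real.pi), f θ := by
  rw [circleMeasure_eq, intervalIntegral.integral_of_le two_pi_pos'.le]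

theorem integrable_circle_iff {f : ℝ → ℝ} :
    Integrable f circleMeasure ↔ IntervalIntegrable f volume 0 (2 * Real.pi) := by
  rw [circleMeasure_eq, intervalIntegrable_iff_integrableOn_Ioc_of_le two_pi_pos'.le]
  rfl

theorem integrable_circle_of_continuous {f : ℝ → ℝ} (hf : Continuous f) :
    Integrable f circleMeasure :=
  integrable_circle_iff.2 (hf.intervalIntegrable _ _)

theorem intervalIntegrable_of_circle {f : ℝ → ℝ} (hp : Function.Periodic f (2 * Real.pi))
    (hf : Integrable f circleMeasure) (a b : ℝ) : IntervalIntegrable f volume a b :=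
  hp.intervalIntegrable₀ two_pi_pos'.ne' (integrable_circle_iff.1 hf) a b

/-- Translation invariance of integrals over a period. -/
theorem integral_circle_translate {f : ℝ → ℝ} (hp : Function.Periodic f (2 * Real.pi)) (c : ℝ) :
    ∫ θ, f (θ + c) ∂circleMeasure = ∫ θ, f θ ∂circleMeasure := by
  rw [integral_circle, integral_circle, intervalIntegral.integral_comp_add_right]
  have := hp.intervalIntegral_add_eq c 0
  rw [zero_add] at this ⊢
  rw [← this, add_comm]

theorem lintegral_circle_translate {g : ℝ → ENNReal} (hp : Function.Periodic g (2 * Real.pi))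
    (c : ℝ) : ∫⁻ θ, g (θ + c) ∂circleMeasure = ∫⁻ θ, g θ ∂circleMeasure := by
  rw [circleMeasure_eq]
  have h := lintegral_periodic_Ioc two_pi_pos' hp c 0
  rw [zero_add] at h
  rw [← h, ← (measurePreserving_add_right volume c).setLIntegral_comp_preimage_emb
    (measurableEmbedding_addRight c) g (Ioc c (c + 2 * Real.pi))]
  congr 2
  ext x
  simp only [mem_Ioc, mem_preimage]
  constructor <;> rintro ⟨h1, h2⟩ <;> constructor <;> linarith

theorem ae_of_ae_circle {p : ℝ → Prop} (hp : ∀ x, p (x + 2 * Real.pi) ↔ p x)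
    (h : ∀ᵐ x ∂circleMeasure, p x) : ∀ᵐ x, p x := by
  rw [circleMeasure_eq, ae_restrict_iff' measurableSet_Ioc] at h
  have hd := isAddFundamentalDomain_Ioc two_pi_pos' 0
  have hper : Function.Periodic p (2 * Real.pi) := fun x => propext (hp x)
  refine hd.measure_zero_of_invariant {x | ¬ p x} ?_ ?_
  · rintro ⟨c, hc⟩
    obtain ⟨n, rfl⟩ := AddSubgroup.mem_zmultiples_iff.1 hc
    ext x
    rw [mem_vadd_set_iff_neg_vadd_mem]
    change ¬ p (-(n • (2 * Real.pi)) + x) ↔ ¬ p x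
    rw [neg_add_eq_sub, hper.sub_zsmul_eq]
  · rw [zero_add]
    refine measure_mono_null ?_ h
    rintro x ⟨h1, h2⟩ h3
    exact h1 (h3 h2)

theorem measurable_slice {g : ℝ → ℝ → ℝ} (hg : Measurable (Function.uncurry g)) (r : ℝ) :
    Measurable (g r) :=
  hg.comp measurable_prodMk_left

/-! ### Energy fields -/

namespace IsEnergyField

variable {p : ENNReal} {R₀ : ℝ} {f : ℝ → ℝ → ℝ} {f' : Partials}

theorem toOne (hp : 1 ≤ p) (h : IsEnergyField p R₀ f f') : IsEnergyField 1 R₀ f f' := by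
  have key : ∀ (l : Filter ℝ) (F : ℝ → ℝ → ℝ),
      (∀ᶠ r in l, AEStronglyMeasurable (F r) circleMeasure) →
      Tendsto (fun r => eLpNorm (F r) p circleMeasure) l (𝓝 0) →
      Tendsto (fun r => eLpNorm (F r) 1 circleMeasure) l (𝓝 0) := by
    intro l F hF ht
    have hb : circleMeasure univ ^ (1 / (1 : ENNReal).toReal - 1 / p.toReal) ≠ ⊤ := by
      apply ENNReal.rpow_ne_top_of_ne_zero
      · exact (zero_lt_one.trans_le one_le_circleMeasure_univ).ne'
      · exact measure_ne_top _ _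
    have h0 : Tendsto (fun r => eLpNorm (F r) p circleMeasure *
        circleMeasure univ ^ (1 / (1 : ENNReal).toReal - 1 / p.toReal)) l (𝓝 0) := by
      have := ENNReal.Tendsto.mul_const ht (Or.inr hb)
      simpa using this
    refine tendsto_of_tendsto_of_tendsto_of_le_of_le' tendsto_const_nhds h0
      (Eventually.of_forall fun _ => zero_le) ?_
    filter_upwards [hF] with r hr
    exact eLpNorm_le_eLpNorm_mul_rpow_measure_univ hp hr
  have hmR := fun r => measurable_slice h.measurable_R r
  have hmθ := fun r => measurable_slice h.measurable_θ r
  refine { h with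
    memLp_R := ?_, memLp_θ := ?_, deriv_R := ?_, continuous_R := ?_, continuous_θ := ?_ }
  · exact fun R hR => (h.memLp_R R hR).mono_exponent hp
  · exact fun R hR => (h.memLp_θ R hR).mono_exponent hp
  · intro R hR
    refine key _ _ ?_ (h.deriv_R R hR)
    filter_upwards [self_mem_nhdsWithin] with r hr
    exact ((continuous_const.mul ((h.continuous r hr.1).sub (h.continuous R hR))).measurable.sub
      (hmR R)).aestronglyMeasurable
  · exact fun R hR => key _ _ (Eventually.of_forall fun r =>
      ((hmR r).sub (hmR R)).aestronglyMeasurable) (h.continuous_R R hR)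
  · exact fun R hR => key _ _ (Eventually.of_forall fun r =>
      ((hmθ r).sub (hmθ R)).aestronglyMeasurable) (h.continuous_θ R hR)

theorem integrable_R (h : IsEnergyField 1 R₀ f f') {R : ℝ} (hR : R₀ ≤ R) :
    Integrable (f'.R R) circleMeasure := memLp_one_iff_integrable.1 (h.memLp_R R hR)

theorem integrable_θ (h : IsEnergyField 1 R₀ f f') {R : ℝ} (hR : R₀ ≤ R) :
    Integrable (f'.θ R) circleMeasure := memLp_one_iff_integrable.1 (h.memLp_θ R hR)

/-- On every slice, the field is a primitive of its weak derivative. -/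
theorem sub_eq_integral (h : IsEnergyField 1 R₀ f f') {R : ℝ} (hR : R₀ ≤ R) (a b : ℝ) :
    f R b - f R a = ∫ θ in a..b, f'.θ R θ := by
  have hi := intervalIntegrable_of_circle (h.periodic_θ R hR) (h.integrable_θ hR)
  have h1 : ∀ x ∈ Icc 0 (2 * Real.pi), f R x = f R 0 + ∫ y in (0)..x, f'.θ R y := by
    refine eq_add_integral_of_weakDeriv two_pi_pos' (h.continuous R hR).continuousOn (hi _ _) ?_
    intro χ c1 c2 c3
    obtain ⟨g, g1, g2, g3⟩ := exists_periodic_extension two_pi_pos' c1 c2 c3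
    have e := h.weakDeriv_θ R hR g g1 g2
    have hi1 : IntervalIntegrable (fun x => deriv χ x * f R x) volume 0 (2 * Real.pi) :=
      ((c1.continuous_deriv (by simp)).mul (h.continuous R hR)).intervalIntegrable _ _
    have hi2 : IntervalIntegrable (fun x => χ x * f'.θ R x) volume 0 (2 * Real.pi) :=
      (hi _ _).continuousOn_mul c1.continuous.continuousOn
    rw [intervalIntegral.integral_add hi1 hi2, ← integral_circle, ← integral_circle]
    have e1 : ∫ θ, deriv χ θ * f R θ ∂circleMeasure = ∫ θ, f R θ * deriv g θ ∂circleMeasure := by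
      refine setIntegral_congr_fun measurableSet_Ioo fun x hx => ?_
      have : deriv g x = deriv χ x := (g3.eventuallyEq_of_mem (isOpen_Ioo.mem_nhds hx)).deriv_eq
      simp only [this, mul_comm]
    have e2 : ∫ θ, χ θ * f'.θ R θ ∂circleMeasure = ∫ θ, f'.θ R θ * g θ ∂circleMeasure := by
      refine setIntegral_congr_fun measurableSet_Ioo fun x hx => ?_
      simp only [g3 hx, mul_comm]
    rw [e1, e2, e]
    ring
  have hz : ∫ y in (0)..(2 * Real.pi), f'.θ R y = 0 := by
    have e := h1 (2 * Real.pi) ⟨two_pi_pos'.le, le_rfl⟩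
    have e' := h.periodic R hR 0
    rw [zero_add] at e'
    linarith
  have hD : Function.Periodic (fun x => f R x - f R 0 - ∫ y in (0)..x, f'.θ R y)
      (2 * Real.pi) := by
    intro x
    have e := (h.periodic_θ R hR).intervalIntegral_add_eq x 0
    rw [zero_add] at e
    rw [hz] at e
    have e2 := intervalIntegral.integral_add_adjacent_intervals (hi 0 x) (hi x (x + 2 * Real.pi))
    simp only [h.periodic R hR x]
    linarith
  have h2 : ∀ x, f R x = f R 0 + ∫ y in (0)..x, f'.θ R y := by
    intro x
    obtain ⟨y, hy, e⟩ := hD.exists_mem_Ico₀ two_pi_pos' x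
    have := h1 y ⟨hy.1, hy.2.le⟩
    linarith
  rw [h2 a, h2 b, ← intervalIntegral.integral_add_adjacent_intervals (hi 0 a) (hi a b)]
  ring

end IsEnergyField

/-- The Sobolev inequality `W^{1,1}(S¹) ⊆ C(S¹)`. -/
theorem enorm_le_of_primitive {u v : ℝ → ℝ} (hu : Function.Periodic u (2 * Real.pi))
    (huv : ∀ a b, u b - u a = ∫ θ in a..b, v θ) (x : ℝ) :
    ‖u x‖ₑ ≤ eLpNorm u 1 circleMeasure + eLpNorm v 1 circleMeasure := by
  obtain ⟨y, hy, e⟩ := hu.exists_mem_Ico₀ two_pi_pos' x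
  rw [e]
  have h1 : ∀ᵐ t ∂circleMeasure, ‖u y‖ₑ ≤ ‖u t‖ₑ + eLpNorm v 1 circleMeasure := by
    rw [circleMeasure_eq, ae_restrict_iff' measurableSet_Ioc]
    refine Eventually.of_forall fun t ht => ?_
    have e1 : u y = u t + ∫ θ in t..y, v θ := by rw [← huv t y]; ring
    rw [e1]
    refine (enorm_add_le _ _).trans ?_
    gcongr
    rw [eLpNorm_one_eq_lintegral_enorm, intervalIntegral.intervalIntegral_eq_integral_uIoc,
      enorm_smul]
    have hs : ‖(if t ≤ y then (1 : ℝ) else -1)‖ₑ = 1 := by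
      split_ifs <;> simp
    rw [hs, one_mul]
    refine (enorm_integral_le_lintegral_enorm _).trans (lintegral_mono_set ?_)
    intro z hz
    rw [mem_uIoc] at hz
    rcases hz with hz | hz
    · exact ⟨ht.1.trans hz.1, hz.2.trans hy.2.le⟩
    · exact ⟨hy.1.trans_lt hz.1, hz.2.trans ht.2⟩
  have hum : eLpNorm u 1 circleMeasure = ∫⁻ t, ‖u t‖ₑ ∂circleMeasure :=
    eLpNorm_one_eq_lintegral_enorm
  have h2 : ‖u y‖ₑ * circleMeasure univ ≤
      (eLpNorm u 1 circleMeasure + eLpNorm v 1 circleMeasure) * circleMeasure univ := by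
    calc ‖u y‖ₑ * circleMeasure univ = ∫⁻ _, ‖u y‖ₑ ∂circleMeasure := by
          rw [lintegral_const]
      _ ≤ ∫⁻ t, (‖u t‖ₑ + eLpNorm v 1 circleMeasure) ∂circleMeasure := lintegral_mono_ae h1
      _ = eLpNorm u 1 circleMeasure + eLpNorm v 1 circleMeasure * circleMeasure univ := by
          rw [lintegral_add_right _ measurable_const, lintegral_const, hum]
      _ ≤ _ := by
          rw [add_mul]
          gcongr
          exact le_mul_of_one_le_right zero_le one_le_circleMeasure_univ
  have h3 : circleMeasure univ ≠ 0 := (zero_lt_one.trans_le one_le_circleMeasure_univ).ne'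
  exact (ENNReal.mul_le_mul_iff_left h3 (measure_ne_top _ _)).1 h2

namespace IsEnergyField

variable {R₀ : ℝ} {f : ℝ → ℝ → ℝ} {f' : Partials}

theorem enorm_sub_le {g : ℝ → ℝ → ℝ} {g' : Partials} (hf : IsEnergyField 1 R₀ f f')
    (hg : IsEnergyField 1 R₀ g g') {r R : ℝ} (hr : R₀ ≤ r) (hR : R₀ ≤ R) (θ : ℝ) :
    ‖f r θ - g R θ‖ₑ ≤ eLpNorm (fun θ => f r θ - g R θ) 1 circleMeasure +
      eLpNorm (fun θ => f'.θ r θ - g'.θ R θ) 1 circleMeasure := by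
  refine enorm_le_of_primitive (u := fun θ => f r θ - g R θ) (v := fun θ => f'.θ r θ - g'.θ R θ)
    ?_ ?_ θ
  · intro x
    simp only [hf.periodic r hr x, hg.periodic R hR x]
  · intro a b
    rw [intervalIntegral.integral_sub
      (intervalIntegrable_of_circle (hf.periodic_θ r hr) (hf.integrable_θ hr) a b)
      (intervalIntegrable_of_circle (hg.periodic_θ R hR) (hg.integrable_θ hR) a b),
      ← hf.sub_eq_integral hr, ← hg.sub_eq_integral hR]
    ring

theorem tendsto_eLpNorm_sub (h : IsEnergyField 1 R₀ f f') {R : ℝ} (hR : R₀ ≤ R) :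
    Tendsto (fun r => eLpNorm (fun θ => f r θ - f R θ) 1 circleMeasure) (𝓝[Ici R₀] R) (𝓝 0) := by
  have hs : 𝓝[Ici R₀] R = 𝓝[Ici R₀ \ {R}] R ⊔ pure R := by
    rw [sup_comm, ← nhdsWithin_insert, insert_sdiff_singleton, insert_eq_of_mem]
    exact hR
  rw [hs, tendsto_sup]
  constructor
  · have h1 := h.deriv_R R hR
    have h2 : Tendsto (fun r => ‖r - R‖ₑ) (𝓝[Ici R₀ \ {R}] R) (𝓝 0) := by
      have : Tendsto (fun r : ℝ => ‖r - R‖ₑ) (𝓝 R) (𝓝 ‖R - R‖ₑ) :=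
        ((continuous_id.sub continuous_const).enorm).tendsto R
      rw [sub_self, enorm_zero] at this
      exact this.mono_left nhdsWithin_le_nhds
    have hm : eLpNorm (f'.R R) 1 circleMeasure ≠ ⊤ := (h.memLp_R R hR).2.ne
    have h3 : Tendsto (fun r => ‖r - R‖ₑ *
        (eLpNorm (fun θ => (r - R)⁻¹ * (f r θ - f R θ) - f'.R R θ) 1 circleMeasure +
          eLpNorm (f'.R R) 1 circleMeasure)) (𝓝[Ici R₀ \ {R}] R) (𝓝 0) := by
      have := ENNReal.Tendsto.mul h2 (Or.inr (by simpa using hm))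
        (h1.add (tendsto_const_nhds (x := eLpNorm (f'.R R) 1 circleMeasure))) (Or.inr (by simp))
      simpa using this
    refine tendsto_of_tendsto_of_tendsto_of_le_of_le' tendsto_const_nhds h3
      (Eventually.of_forall fun _ => zero_le) ?_
    filter_upwards [self_mem_nhdsWithin] with r hr
    have hne : r - R ≠ 0 := sub_ne_zero.2 hr.2
    have e : (fun θ => f r θ - f R θ) = (r - R) • ((fun θ => (r - R)⁻¹ * (f r θ - f R θ) - f'.R R θ)
        + f'.R R) := by
      ext θ
      simp only [Pi.smul_apply, Pi.add_apply, smul_eq_mul]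
      field_simp
      ring
    rw [e, eLpNorm_const_smul]
    gcongr
    refine eLpNorm_add_le ?_ (h.memLp_R R hR).1 le_rfl
    exact ((continuous_const.mul ((h.continuous r hr.1).sub (h.continuous R hR))).measurable.sub
      (measurable_slice h.measurable_R R)).aestronglyMeasurable
  · rw [tendsto_pure_left]
    intro s hs
    simpa using mem_of_mem_nhds hs

theorem continuousOn (h : IsEnergyField 1 R₀ f f') :
    ContinuousOn (Function.uncurry f) (Ici R₀ ×ˢ univ) := by
  rintro ⟨R, θ⟩ ⟨hR, -⟩
  have hR' : R₀ ≤ R := hR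
  have h1 : Tendsto (fun r => eLpNorm (fun θ => f r θ - f R θ) 1 circleMeasure +
      eLpNorm (fun θ => f'.θ r θ - f'.θ R θ) 1 circleMeasure) (𝓝[Ici R₀] R) (𝓝 0) := by
    simpa using (h.tendsto_eLpNorm_sub hR').add (h.continuous_θ R hR')
  have hfst : Tendsto Prod.fst (𝓝[Ici R₀ ×ˢ univ] (R, θ)) (𝓝[Ici R₀] R) := by
    rw [nhdsWithin_prod_eq]
    exact tendsto_fst
  have h2 : Tendsto (fun q : ℝ × ℝ => edist (f q.1 q.2) (f R q.2)) (𝓝[Ici R₀ ×ˢ univ] (R, θ))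
      (𝓝 0) := by
    refine tendsto_of_tendsto_of_tendsto_of_le_of_le' tendsto_const_nhds (h1.comp hfst)
      (Eventually.of_forall fun _ => zero_le) ?_
    filter_upwards [self_mem_nhdsWithin] with q hq
    rw [edist_eq_enorm_sub]
    exact h.enorm_sub_le h hq.1 hR' q.2
  have h3 : Tendsto (fun q : ℝ × ℝ => edist (f R q.2) (f R θ)) (𝓝[Ici R₀ ×ˢ univ] (R, θ))
      (𝓝 0) := by
    have : Continuous fun q : ℝ × ℝ => edist (f R q.2) (f R θ) :=
      ((h.continuous R hR').comp continuous_snd).edist continuous_const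
    have h4 := this.tendsto (R, θ)
    simp only [edist_self] at h4
    exact h4.mono_left nhdsWithin_le_nhds
  refine (tendsto_iff_edist_tendsto_0 (f := Function.uncurry f)).2 ?_
  refine tendsto_of_tendsto_of_tendsto_of_le_of_le tendsto_const_nhds (by simpa using h2.add h3)
    (fun _ => zero_le) fun q => ?_
  exact edist_triangle _ _ _

theorem exists_bound (h : IsEnergyField 1 R₀ f f') (R₁ : ℝ) :
    ∃ B, ∀ R ∈ Icc R₀ R₁, ∀ θ, |f R θ| ≤ B := by
  obtain ⟨B, hB⟩ := (isCompact_Icc.prod isCompact_Icc).exists_bound_of_continuousOn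
    (s := Icc R₀ R₁ ×ˢ Icc 0 (2 * Real.pi))
    (h.continuousOn.mono fun z hz => ⟨hz.1.1, mem_univ _⟩)
  refine ⟨B, fun R hR θ => ?_⟩
  obtain ⟨θ', h1, h2⟩ := (h.periodic R hR.1).exists_mem_Ico₀ two_pi_pos' θ
  rw [h2]
  exact hB (R, θ') ⟨hR, Ico_subset_Icc_self h1⟩

/-- The partial derivatives of an energy field are determined up to null sets. -/
theorem partials_unique {f'' : Partials} (h1 : IsEnergyField 1 R₀ f f')
    (h2 : IsEnergyField 1 R₀ f f'') {R : ℝ} (hR : R₀ ≤ R) :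
    f'.R R =ᵐ[circleMeasure] f''.R R ∧ f'.θ R =ᵐ[circleMeasure] f''.θ R := by
  constructor
  · have hs : (𝓝[Ici R₀ \ {R}] R).NeBot := by
      refine NeBot.mono (f := 𝓝[Ioi R] R) inferInstance (nhdsWithin_mono _ ?_)
      intro r hr
      exact ⟨hR.trans (le_of_lt hr), (ne_of_gt hr)⟩
    have ht := (h1.deriv_R R hR).add (h2.deriv_R R hR)
    rw [add_zero] at ht
    have hm := fun r => (measurable_slice h1.measurable_R r)
    have hm' := fun r => (measurable_slice h2.measurable_R r)
    have h0 : eLpNorm (f'.R R - f''.R R) 1 circleMeasure ≤ 0 := by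
      refine ge_of_tendsto ht ?_
      filter_upwards [self_mem_nhdsWithin] with r hr
      have hq : Measurable fun θ => (r - R)⁻¹ * (f r θ - f R θ) :=
        (continuous_const.mul ((h1.continuous r hr.1).sub (h1.continuous R hR))).measurable
      have e : f'.R R - f''.R R = (fun θ => (r - R)⁻¹ * (f r θ - f R θ) - f''.R R θ) -
          (fun θ => (r - R)⁻¹ * (f r θ - f R θ) - f'.R R θ) := by
        ext θ; simp
      rw [e, add_comm]
      exact eLpNorm_sub_le (hq.sub (hm' R)).aestronglyMeasurable
        (hq.sub (hm R)).aestronglyMeasurable le_rfl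
    have h3 := (eLpNorm_eq_zero_iff ((hm R).sub (hm' R)).aestronglyMeasurable one_ne_zero).1
      (le_antisymm h0 zero_le)
    filter_upwards [h3] with θ hθ
    simpa [sub_eq_zero] using hθ
  · have hi1 := intervalIntegrable_of_circle (h1.periodic_θ R hR) (h1.integrable_θ hR)
    have hi2 := intervalIntegrable_of_circle (h2.periodic_θ R hR) (h2.integrable_θ hR)
    have e : ∀ x, ∫ θ in (0)..x, f'.θ R θ = ∫ θ in (0)..x, f''.θ R θ := fun x => by
      rw [← h1.sub_eq_integral hR, ← h2.sub_eq_integral hR]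
    rw [circleMeasure_eq]
    refine (ae_restrict_iff' measurableSet_Ioc).2 ?_
    filter_upwards [(hi1 0 (2 * Real.pi)).ae_hasDerivAt_integral,
      (hi2 0 (2 * Real.pi)).ae_hasDerivAt_integral] with x k1 k2 hx
    have hx' : x ∈ uIcc 0 (2 * Real.pi) := by
      rw [uIcc_of_le two_pi_pos'.le]; exact Ioc_subset_Icc_self hx
    have d1 := k1 hx' 0 left_mem_uIcc
    have d2 := k2 hx' 0 left_mem_uIcc
    rw [funext e] at d1
    exact d1.unique d2

end IsEnergyField

/-! ### Slabs `(R₀, R₁] × S¹` -/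

/-- Lebesgue measure on the slab `(R₀, R₁] × S¹`. -/
def slab (R₀ R₁ : ℝ) : Measure (ℝ × ℝ) := (volume.restrict (Ioc R₀ R₁)).prod circleMeasure

instance (R₀ R₁ : ℝ) : IsFiniteMeasure (slab R₀ R₁) := by
  unfold slab
  infer_instance

theorem lintegral_slab {R₀ R₁ : ℝ} {g : ℝ × ℝ → ENNReal} (hg : AEMeasurable g (slab R₀ R₁)) :
    ∫⁻ z, g z ∂slab R₀ R₁ = ∫⁻ r in Ioc R₀ R₁, ∫⁻ θ, g (r, θ) ∂circleMeasure :=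
  lintegral_prod _ hg

theorem ae_slab {R₀ R₁ : ℝ} : ∀ᵐ z ∂slab R₀ R₁, z.1 ∈ Ioc R₀ R₁ := by
  have h : ∀ᵐ r ∂(volume.restrict (Ioc R₀ R₁)), r ∈ Ioc R₀ R₁ := ae_restrict_mem measurableSet_Ioc
  exact Measure.quasiMeasurePreserving_fst.ae h

theorem eLpNorm_slab_le {p : ENNReal} (h0 : p ≠ 0) (ht : p ≠ ⊤) {R₀ R₁ : ℝ} {g : ℝ → ℝ → ℝ}
    (hg : Measurable (Function.uncurry g)) {M : ENNReal}
    (h : ∀ r ∈ Ioc R₀ R₁, eLpNorm (g r) p circleMeasure ≤ M) :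
    eLpNorm (Function.uncurry g) p (slab R₀ R₁) ≤
      ENNReal.ofReal (R₁ - R₀) ^ (1 / p.toReal) * M := by
  have hp : 0 < p.toReal := ENNReal.toReal_pos h0 ht
  have h1 : ∀ r ∈ Ioc R₀ R₁, ∫⁻ θ, ‖g r θ‖ₑ ^ p.toReal ∂circleMeasure ≤ M ^ p.toReal := by
    intro r hr
    have := ENNReal.rpow_le_rpow (h r hr) hp.le
    rwa [eLpNorm_eq_lintegral_rpow_enorm_toReal h0 ht, ← ENNReal.rpow_mul,
      one_div_mul_cancel hp.ne', ENNReal.rpow_one] at this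
  rw [eLpNorm_eq_lintegral_rpow_enorm_toReal h0 ht,
    lintegral_slab (hg.enorm.pow_const _).aemeasurable]
  calc _ ≤ (∫⁻ _ in Ioc R₀ R₁, M ^ p.toReal) ^ (1 / p.toReal) := by
        exact ENNReal.rpow_le_rpow (setLIntegral_mono measurable_const h1) (by positivity)
    _ = (M ^ p.toReal * ENNReal.ofReal (R₁ - R₀)) ^ (1 / p.toReal) := by
        rw [setLIntegral_const, Real.volume_Ioc]
    _ = _ := by
        rw [ENNReal.mul_rpow_of_nonneg _ _ (by positivity), ← ENNReal.rpow_mul,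
          mul_one_div_cancel hp.ne', ENNReal.rpow_one, mul_comm]

theorem exists_eLpNorm_bound {p : ENNReal} (hp : 1 ≤ p) {R₀ R₁ : ℝ} {g : ℝ → ℝ → ℝ}
    (hg : Measurable (Function.uncurry g)) (hL : ∀ R, R₀ ≤ R → MemLp (g R) p circleMeasure)
    (hc : ∀ R, R₀ ≤ R → Tendsto (fun r => eLpNorm (fun θ => g r θ - g R θ) p circleMeasure)
      (𝓝[Ici R₀] R) (𝓝 0)) :
    ∃ M : ENNReal, M ≠ ⊤ ∧ ∀ r ∈ Icc R₀ R₁, eLpNorm (g r) p circleMeasure ≤ M := by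
  have hm := fun r => (measurable_slice hg r).aestronglyMeasurable (μ := circleMeasure)
  refine isCompact_Icc.induction_on (p := fun s => ∃ M : ENNReal, M ≠ ⊤ ∧
    ∀ r ∈ s, eLpNorm (g r) p circleMeasure ≤ M) ⟨0, by simp, by simp⟩ ?_ ?_ ?_
  · rintro s t hst ⟨M, h1, h2⟩
    exact ⟨M, h1, fun r hr => h2 r (hst hr)⟩
  · rintro s t ⟨M, h1, h2⟩ ⟨M', h1', h2'⟩
    refine ⟨max M M', by simp [h1, h1'], ?_⟩
    rintro r (hr | hr)
    · exact (h2 r hr).trans (le_max_left _ _)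
    · exact (h2' r hr).trans (le_max_right _ _)
  · intro R hR
    have h1 := (hc R hR.1).eventually (gt_mem_nhds zero_lt_one)
    refine ⟨_, nhdsWithin_mono R Icc_subset_Ici_self h1, 1 + eLpNorm (g R) p circleMeasure,
      by simpa using (hL R hR.1).2.ne, ?_⟩
    intro r hr
    have e : g r = (fun θ => g r θ - g R θ) + g R := by ext θ; simp
    rw [e]
    exact (eLpNorm_add_le ((hm r).sub (hm R)) (hm R) hp).trans (by gcongr; exact le_of_lt hr)

theorem memLp_slab {p : ENNReal} (hp : 1 ≤ p) (ht : p ≠ ⊤) {R₀ : ℝ} (R₁ : ℝ) {g : ℝ → ℝ → ℝ}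
    (hg : Measurable (Function.uncurry g)) (hL : ∀ R, R₀ ≤ R → MemLp (g R) p circleMeasure)
    (hc : ∀ R, R₀ ≤ R → Tendsto (fun r => eLpNorm (fun θ => g r θ - g R θ) p circleMeasure)
      (𝓝[Ici R₀] R) (𝓝 0)) :
    MemLp (Function.uncurry g) p (slab R₀ R₁) := by
  obtain ⟨M, h1, h2⟩ := exists_eLpNorm_bound (R₁ := R₁) hp hg hL hc
  refine ⟨hg.aestronglyMeasurable, ?_⟩
  refine (eLpNorm_slab_le (zero_lt_one.trans_le hp).ne' ht hg
    fun r hr => h2 r (Ioc_subset_Icc_self hr)).trans_lt ?_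
  exact ENNReal.mul_lt_top (ENNReal.rpow_lt_top_of_nonneg (by positivity) ENNReal.ofReal_ne_top)
    h1.lt_top

namespace IsEnergyField

variable {p : ENNReal} {R₀ : ℝ} {f : ℝ → ℝ → ℝ} {f' : Partials}

theorem memLp_slab_R (h : IsEnergyField p R₀ f f') (hp : 1 ≤ p) (ht : p ≠ ⊤) (R₁ : ℝ) :
    MemLp (Function.uncurry f'.R) p (slab R₀ R₁) :=
  memLp_slab hp ht R₁ h.measurable_R h.memLp_R h.continuous_R

theorem memLp_slab_θ (h : IsEnergyField p R₀ f f') (hp : 1 ≤ p) (ht : p ≠ ⊤) (R₁ : ℝ) :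
    MemLp (Function.uncurry f'.θ) p (slab R₀ R₁) :=
  memLp_slab hp ht R₁ h.measurable_θ h.memLp_θ h.continuous_θ

end IsEnergyField

/-! ### Smooth fields -/

/-- The classical partial derivatives, set to zero for `R < R₀`, where the function is arbitrary. -/
def cutPartials (R₀ : ℝ) (f : ℝ → ℝ → ℝ) : Partials where
  R r θ := if R₀ ≤ r then (classicalPartials R₀ f).R r θ else 0
  θ r θ := if R₀ ≤ r then (classicalPartials R₀ f).θ r θ else 0

/-- The half cylinder `R ≥ R₀` in the `(R, θ)`-plane. -/
abbrev halfPlane (R₀ : ℝ) : Set (ℝ × ℝ) := Ici R₀ ×ˢ univ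

theorem measurableSet_halfPlane (R₀ : ℝ) : MeasurableSet (halfPlane R₀) :=
  measurableSet_Ici.prod MeasurableSet.univ

theorem uniqueDiffOn_halfPlane (R₀ : ℝ) : UniqueDiffOn ℝ (halfPlane R₀) :=
  (uniqueDiffOn_Ici R₀).prod uniqueDiffOn_univ

/-- A function which is continuous on `[R₀, ∞) × S¹` is continuous in `R` uniformly in `θ`. -/
theorem eventually_forall_abs_sub_le {R₀ : ℝ} {h : ℝ → ℝ → ℝ}
    (hc : ContinuousOn (Function.uncurry h) (halfPlane R₀)) {R : ℝ} (hR : R₀ ≤ R) {ε : ℝ}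
    (hε : 0 < ε) :
    ∀ᶠ r in 𝓝[Ici R₀] R, ∀ θ ∈ Icc 0 (2 * Real.pi), |h r θ - h R θ| < ε := by
  obtain ⟨v, hv, h1⟩ := isCompact_Icc.mem_uniformity_of_prod (k := Icc 0 (2 * Real.pi))
    (hc.mono (prod_mono_right (subset_univ _))) (show R ∈ Ici R₀ from hR)
        (Metric.dist_mem_uniformity hε)
  filter_upwards [hv] with r hr θ hθ
  exact h1 r hr θ hθ

namespace IsSmoothField

variable {R₀ : ℝ} {f : ℝ → ℝ → ℝ}

theorem hasFDerivWithinAt (h : IsSmoothField R₀ f) {r : ℝ} (hr : R₀ ≤ r) (θ : ℝ) :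
    HasFDerivWithinAt (Function.uncurry f)
      (fderivWithin ℝ (Function.uncurry f) (halfPlane R₀) (r, θ)) (halfPlane R₀) (r, θ) :=
  (h.1.differentiableOn (by simp) (r, θ) ⟨hr, mem_univ _⟩).hasFDerivWithinAt

theorem hasDerivWithinAt_R' (h : IsSmoothField R₀ f) {r : ℝ} (hr : R₀ ≤ r) (θ : ℝ) :
    HasDerivWithinAt (fun r' => f r' θ)
      (fderivWithin ℝ (Function.uncurry f) (halfPlane R₀) (r, θ) (1, 0)) (Ici R₀) r := by
  have h1 : HasDerivWithinAt (fun r' : ℝ => (r', θ)) (1, 0) (Ici R₀) r :=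
    (hasDerivWithinAt_id _ _).prodMk (hasDerivWithinAt_const _ _ _)
  have h2 : MapsTo (fun r' : ℝ => (r', θ)) (Ici R₀) (halfPlane R₀) :=
    fun r' hr' => ⟨hr', mem_univ _⟩
  exact (h.hasFDerivWithinAt hr θ).comp_hasDerivWithinAt r h1 h2

theorem hasDerivAt_θ' (h : IsSmoothField R₀ f) {r : ℝ} (hr : R₀ ≤ r) (θ : ℝ) :
    HasDerivAt (f r)
      (fderivWithin ℝ (Function.uncurry f) (halfPlane R₀) (r, θ) (0, 1)) θ := by
  have h1 : HasDerivWithinAt (fun t : ℝ => (r, t)) (0, 1) univ θ :=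
    (hasDerivWithinAt_const _ _ _).prodMk (hasDerivWithinAt_id _ _)
  have h2 : MapsTo (fun t : ℝ => (r, t)) univ (halfPlane R₀) := fun t _ => ⟨hr, mem_univ _⟩
  have := (h.hasFDerivWithinAt hr θ).comp_hasDerivWithinAt θ h1 h2
  exact hasDerivWithinAt_univ.1 this

theorem classical_R_eq (h : IsSmoothField R₀ f) {r : ℝ} (hr : R₀ ≤ r) (θ : ℝ) :
    (classicalPartials R₀ f).R r θ =
      fderivWithin ℝ (Function.uncurry f) (halfPlane R₀) (r, θ) (1, 0) :=
  (h.hasDerivWithinAt_R' hr θ).derivWithin (uniqueDiffOn_Ici R₀ r hr)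

theorem classical_θ_eq (h : IsSmoothField R₀ f) {r : ℝ} (hr : R₀ ≤ r) (θ : ℝ) :
    (classicalPartials R₀ f).θ r θ =
      fderivWithin ℝ (Function.uncurry f) (halfPlane R₀) (r, θ) (0, 1) :=
  (h.hasDerivAt_θ' hr θ).deriv

theorem hasDerivWithinAt_R (h : IsSmoothField R₀ f) {r : ℝ} (hr : R₀ ≤ r) (θ : ℝ) :
    HasDerivWithinAt (fun r' => f r' θ) ((classicalPartials R₀ f).R r θ) (Ici R₀) r := by
  rw [h.classical_R_eq hr]
  exact h.hasDerivWithinAt_R' hr θ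

theorem hasDerivAt_θ (h : IsSmoothField R₀ f) {r : ℝ} (hr : R₀ ≤ r) (θ : ℝ) :
    HasDerivAt (f r) ((classicalPartials R₀ f).θ r θ) θ := by
  rw [h.classical_θ_eq hr]
  exact h.hasDerivAt_θ' hr θ

theorem fderivWithin_apply (h : IsSmoothField R₀ f) {r : ℝ} (hr : R₀ ≤ r) (θ : ℝ) (v : ℝ × ℝ) :
    fderivWithin ℝ (Function.uncurry f) (halfPlane R₀) (r, θ) v =
      v.1 * (classicalPartials R₀ f).R r θ + v.2 * (classicalPartials R₀ f).θ r θ := by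
  have e : v = v.1 • ((1, 0) : ℝ × ℝ) + v.2 • ((0, 1) : ℝ × ℝ) := by ext <;> simp
  rw [h.classical_R_eq hr, h.classical_θ_eq hr]
  conv_lhs => rw [e]
  rw [map_add, map_smul, map_smul, smul_eq_mul, smul_eq_mul]

theorem continuousOn_fderivWithin (h : IsSmoothField R₀ f) (v : ℝ × ℝ) :
    ContinuousOn (fun z => fderivWithin ℝ (Function.uncurry f) (halfPlane R₀) z v)
      (halfPlane R₀) :=
  (h.1.continuousOn_fderivWithin (uniqueDiffOn_halfPlane R₀) (by simp)).clm_apply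
    continuousOn_const

theorem continuousOn_R (h : IsSmoothField R₀ f) :
    ContinuousOn (Function.uncurry (classicalPartials R₀ f).R) (halfPlane R₀) :=
  (h.continuousOn_fderivWithin (1, 0)).congr fun z hz => h.classical_R_eq hz.1 z.2

theorem continuousOn_θ (h : IsSmoothField R₀ f) :
    ContinuousOn (Function.uncurry (classicalPartials R₀ f).θ) (halfPlane R₀) :=
  (h.continuousOn_fderivWithin (0, 1)).congr fun z hz => h.classical_θ_eq hz.1 z.2

theorem continuous_slice {g : ℝ → ℝ → ℝ} (hg : ContinuousOn (Function.uncurry g) (halfPlane R₀))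
    {r : ℝ} (hr : R₀ ≤ r) : Continuous (g r) := by
  have h2 : Continuous fun θ : ℝ => (r, θ) := by fun_prop
  have h3 := hg.comp (s := univ) h2.continuousOn fun θ _ => ⟨hr, mem_univ _⟩
  exact continuousOn_univ.1 h3

theorem measurable_cut {g : ℝ → ℝ → ℝ} (hg : ContinuousOn (Function.uncurry g) (halfPlane R₀)) :
    Measurable (Function.uncurry fun r θ => if R₀ ≤ r then g r θ else 0) := by
  have h1 : (Function.uncurry fun r θ => if R₀ ≤ r then g r θ else 0) =
      (halfPlane R₀).piecewise (Function.uncurry g) (fun _ => 0) := by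
    ext ⟨r, θ⟩
    simp [Set.piecewise, Function.uncurry]
  rw [h1]
  refine hg.measurable_piecewise continuousOn_const (measurableSet_halfPlane R₀)

/-- Bounds which are uniform on the circle control the `L^p` norm. -/
theorem tendsto_eLpNorm_zero_of_forall {p : ENNReal} {l : Filter ℝ} {F : ℝ → ℝ → ℝ}
    (h : ∀ ε : ℝ, 0 < ε → ∀ᶠ r in l, ∀ θ ∈ Icc 0 (2 * Real.pi), |F r θ| ≤ ε) :
    Tendsto (fun r => eLpNorm (F r) p circleMeasure) l (𝓝 0) := by
  set D := circleMeasure univ ^ p.toReal⁻¹ with hD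
  have hDt : D ≠ ⊤ := ENNReal.rpow_ne_top_of_nonneg (by positivity) (measure_ne_top _ _)
  rw [ENNReal.tendsto_nhds_zero]
  intro ε hε
  obtain ⟨δ, hδ, hδε⟩ : ∃ δ : ℝ, 0 < δ ∧ D * ENNReal.ofReal δ ≤ ε := by
    have : Tendsto (fun δ : ℝ => D * ENNReal.ofReal δ) (𝓝[>] 0) (𝓝 0) := by
      have h1 := ENNReal.Tendsto.const_mul (a := D)
        ((ENNReal.tendsto_ofReal (tendsto_id (x := 𝓝 (0 : ℝ)))).mono_left
          (nhdsWithin_le_nhds (s := Ioi 0))) (Or.inr hDt)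
      simpa using h1
    obtain ⟨δ, h1, h2⟩ := ((this.eventually (gt_mem_nhds hε)).and self_mem_nhdsWithin).exists
    exact ⟨δ, h2, h1.le⟩
  filter_upwards [h δ hδ] with r hr
  refine (eLpNorm_le_of_ae_bound (C := δ) ?_).trans hδε
  rw [circleMeasure_eq, ae_restrict_iff' measurableSet_Ioc]
  exact Eventually.of_forall fun θ hθ => hr θ (Ioc_subset_Icc_self hθ)

theorem isEnergyField (p : ENNReal) (h : IsSmoothField R₀ f) :
    IsEnergyField p R₀ f (cutPartials R₀ f) := by
  have hcR : ∀ R, R₀ ≤ R → (cutPartials R₀ f).R R = (classicalPartials R₀ f).R R := by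
    intro R hR
    ext θ
    simp [cutPartials, hR]
  have hcθ : ∀ R, R₀ ≤ R → (cutPartials R₀ f).θ R = (classicalPartials R₀ f).θ R := by
    intro R hR
    ext θ
    simp [cutPartials, hR]
  have memLp_of : ∀ g : ℝ → ℝ, Continuous g → MemLp g p circleMeasure := by
    intro g hg
    obtain ⟨C, hC⟩ := isCompact_Icc.exists_bound_of_continuousOn
      (hg.continuousOn (s := Icc 0 (2 * Real.pi)))
    refine MemLp.of_bound hg.aestronglyMeasurable C ?_
    rw [circleMeasure_eq, ae_restrict_iff' measurableSet_Ioc]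
    exact Eventually.of_forall fun θ hθ => hC θ (Ioc_subset_Icc_self hθ)
  have hperR : ∀ R, R₀ ≤ R → Function.Periodic ((classicalPartials R₀ f).R R) (2 * Real.pi) := by
    intro R hR θ
    have e : EqOn (fun r' => f r' (θ + 2 * Real.pi)) (fun r' => f r' θ) (Ici R₀) :=
      fun r' hr' => h.2 r' hr' θ
    exact derivWithin_congr e (e hR)
  have hperθ : ∀ R, R₀ ≤ R → Function.Periodic ((classicalPartials R₀ f).θ R) (2 * Real.pi) := by
    intro R hR θ
    change deriv (f R) (θ + 2 * Real.pi) = deriv (f R) θ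
    rw [← deriv_comp_add_const, funext (h.2 R hR)]
  have hR1 : ∀ R, R₀ ≤ R → Continuous ((classicalPartials R₀ f).R R) := fun R hR =>
    continuous_slice h.continuousOn_R hR
  have hθ1 : ∀ R, R₀ ≤ R → Continuous ((classicalPartials R₀ f).θ R) := fun R hR =>
    continuous_slice h.continuousOn_θ hR
  refine ⟨h.2, fun R hR => continuous_slice h.1.continuousOn hR, measurable_cut h.continuousOn_R,
    measurable_cut h.continuousOn_θ, fun R hR => by rw [hcR R hR]; exact hperR R hR,
    fun R hR => by rw [hcθ R hR]; exact hperθ R hR,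
    fun R hR => by rw [hcR R hR]; exact memLp_of _ (hR1 R hR),
    fun R hR => by rw [hcθ R hR]; exact memLp_of _ (hθ1 R hR), ?_, ?_, ?_, ?_⟩
  · intro R hR φ hφ hper
    rw [hcθ R hR, integral_circle, integral_circle]
    have hd : Continuous (deriv φ) := hφ.continuous_deriv (by simp)
    rw [intervalIntegral.integral_mul_deriv_eq_deriv_mul (fun x _ => h.hasDerivAt_θ hR x)
      (fun x _ => (hφ.differentiable (by simp) x).hasDerivAt)
      ((hθ1 R hR).intervalIntegrable _ _) (hd.intervalIntegrable _ _)]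
    have e1 := h.2 R hR 0
    have e2 := hper 0
    rw [zero_add] at e1 e2
    rw [e1, e2]
    ring
  · intro R hR
    apply tendsto_eLpNorm_zero_of_forall
    intro ε hε
    have h1 := eventually_forall_abs_sub_le h.continuousOn_R hR hε
    obtain ⟨δ, hδ, h2⟩ := Metric.mem_nhdsWithin_iff.1 h1
    have h3 : Metric.ball R δ ∩ (Ici R₀ \ {R}) ∈ 𝓝[Ici R₀ \ {R}] R :=
      inter_mem (nhdsWithin_le_nhds (Metric.ball_mem_nhds R hδ)) self_mem_nhdsWithin
    filter_upwards [h3] with r hr θ hθ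
    obtain ⟨hr1, hr2, hr3⟩ := hr
    rw [hcR R hR]
    have hne : r - R ≠ 0 := sub_ne_zero.2 hr3
    -- mean value inequality for `f - (∂_R f)(R, θ) r` between `R` and `r`
    have hsub : uIcc R r ⊆ Metric.ball R δ ∩ Ici R₀ := by
      intro x hx
      constructor
      · rw [Metric.mem_ball, Real.dist_eq] at hr1 ⊢
        exact (abs_sub_left_of_mem_uIcc hx).trans_lt hr1
      · exact (le_inf hR hr2).trans hx.1
    have hmv := (convex_uIcc R r).norm_image_sub_le_of_norm_hasDerivWithin_le
      (f := fun r' => f r' θ - (classicalPartials R₀ f).R R θ * r')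
      (f' := fun r' => (classicalPartials R₀ f).R r' θ - (classicalPartials R₀ f).R R θ) (C := ε)
      (fun x hx => by
        have d1 := (h.hasDerivWithinAt_R (hsub hx).2 θ).mono (hsub.trans inter_subset_right)
        have d2 := ((hasDerivWithinAt_id x (uIcc R r)).const_mul
          ((classicalPartials R₀ f).R R θ))
        rw [mul_one] at d2
        exact d1.sub d2)
      (fun x hx => (h2 (hsub hx) θ hθ).le) left_mem_uIcc right_mem_uIcc
    have e : (r - R)⁻¹ * (f r θ - f R θ) - (classicalPartials R₀ f).R R θ =
        (r - R)⁻¹ * (f r θ - (classicalPartials R₀ f).R R θ * r -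
          (f R θ - (classicalPartials R₀ f).R R θ * R)) := by
      field_simp
      ring
    rw [e, abs_mul, abs_inv, inv_mul_le_iff₀ (abs_pos.2 hne), mul_comm |r - R|]
    exact hmv
  · intro R hR
    apply tendsto_eLpNorm_zero_of_forall
    intro ε hε
    filter_upwards [eventually_forall_abs_sub_le h.continuousOn_R hR hε, self_mem_nhdsWithin]
      with r hr hr' θ hθ
    rw [hcR R hR, hcR r hr']
    exact (hr θ hθ).le
  · intro R hR
    apply tendsto_eLpNorm_zero_of_forall
    intro ε hε
    filter_upwards [eventually_forall_abs_sub_le h.continuousOn_θ hR hε, self_mem_nhdsWithin]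
      with r hr hr' θ hθ
    rw [hcθ R hR, hcθ r hr']
    exact (hr θ hθ).le

end IsSmoothField

/-! ### Integration along characteristics -/

/-- `f` has the regularity `C(W^{1,1}) ∩ C¹(L¹)`, with first derivatives `f'`, and solves
`(w f_R)_R - (w f_θ)_θ = H` in the sense of distributions, for a positive weight `w(R)` with
derivative `w'`. -/
structure IsWaveField (R₀ : ℝ) (w w' : ℝ → ℝ) (f : ℝ → ℝ → ℝ) (f' : Partials)
    (H : ℝ → ℝ → ℝ) : Prop where
  field : IsEnergyField 1 R₀ f f'
  hasDerivAt_w : ∀ r, R₀ ≤ r → HasDerivAt w (w' r) r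
  continuousOn_w' : ContinuousOn w' (Ici R₀)
  measurable_w : Measurable w
  measurable_w' : Measurable w'
  w_pos : ∀ r, R₀ ≤ r → 0 < w r
  measurable_H : Measurable (Function.uncurry H)
  periodic_H : ∀ r, R₀ ≤ r → Function.Periodic (H r) (2 * Real.pi)
  integrable_H : ∀ R₁, Integrable (Function.uncurry H) (slab R₀ R₁)
  eq : ∀ φ, IsTestFunction R₀ φ → waveOp R₀ w f' φ = pairing R₀ H φ

/-- The source `k` in the transport equation `(∂_R + σ ∂_θ) (w (f_R - σ f_θ)) = k`, for
`σ = ±1`. -/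
def charSource (w' : ℝ → ℝ) (f' : Partials) (H : ℝ → ℝ → ℝ) (σ r θ : ℝ) : ℝ :=
  H r θ - σ * w' r * f'.θ r θ

/-- The null derivative `f_R - σ f_θ`. -/
def nullDeriv (f' : Partials) (σ r θ : ℝ) : ℝ := f'.R r θ - σ * f'.θ r θ

/-- The solution of the transport equation `(∂_R + σ ∂_θ) (w P) = k` with `P = p₀` at `R = R₀`,
given at every point by integration along the characteristic through that point. -/
def charRep (R₀ : ℝ) (w p₀ : ℝ → ℝ) (k : ℝ → ℝ → ℝ) (σ R θ : ℝ) : ℝ :=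
  (w R)⁻¹ * (w R₀ * p₀ (θ - σ * (R - R₀)) + ∫ r in Ioc R₀ R, k r (θ - σ * (R - r)))

/-- Integrals of `L¹`-convergent functions against boundedly convergent ones converge. -/
theorem tendsto_integral_mul_circle {l : Filter ℝ} [l.IsCountablyGenerated] {V G : ℝ → ℝ → ℝ}
    {v g : ℝ → ℝ} (hV : ∀ᶠ r in l, Integrable (V r) circleMeasure) (hv : Integrable v circleMeasure)
    (hVv : Tendsto (fun r => eLpNorm (fun θ => V r θ - v θ) 1 circleMeasure) l (𝓝 0))
    (hG : ∀ r, Continuous (G r)) {B : ℝ} (hB : ∀ r θ, |G r θ| ≤ B)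
    (hGg : ∀ θ, Tendsto (fun r => G r θ) l (𝓝 (g θ))) :
    Tendsto (fun r => ∫ θ, V r θ * G r θ ∂circleMeasure) l (𝓝 (∫ θ, v θ * g θ ∂circleMeasure)) := by
  have h1 : Tendsto (fun r => ∫ θ, v θ * G r θ ∂circleMeasure) l
      (𝓝 (∫ θ, v θ * g θ ∂circleMeasure)) := by
    refine tendsto_integral_filter_of_dominated_convergence (fun θ => |v θ| * B) ?_ ?_ ?_ ?_
    · exact Eventually.of_forall fun r => hv.1.mul (hG r).aestronglyMeasurable
    · refine Eventually.of_forall fun r => Eventually.of_forall fun θ => ?_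
      rw [Real.norm_eq_abs, abs_mul]
      exact mul_le_mul_of_nonneg_left (hB r θ) (abs_nonneg _)
    · exact hv.abs.mul_const B
    · exact Eventually.of_forall fun θ => (hGg θ).const_mul _
  have hbd : ∀ (u : ℝ → ℝ) (r : ℝ), Integrable u circleMeasure →
      Integrable (fun θ => u θ * G r θ) circleMeasure := fun u r hu =>
    hu.mul_bdd (c := B) (hG r).aestronglyMeasurable (Eventually.of_forall fun θ => hB r θ)
  have h2 : Tendsto (fun r => ∫ θ, (V r θ - v θ) * G r θ ∂circleMeasure) l (𝓝 0) := by
    rw [tendsto_zero_iff_enorm_tendsto_zero]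
    have h3 : Tendsto (fun r => eLpNorm (fun θ => V r θ - v θ) 1 circleMeasure *
        ENNReal.ofReal B) l (𝓝 0) := by
      simpa using ENNReal.Tendsto.mul_const hVv (Or.inr (ENNReal.ofReal_ne_top (r := B)))
    refine tendsto_of_tendsto_of_tendsto_of_le_of_le tendsto_const_nhds h3
      (fun _ => zero_le) fun r => ?_
    refine (enorm_integral_le_lintegral_enorm _).trans ?_
    rw [eLpNorm_one_eq_lintegral_enorm, ← lintegral_mul_const' _ _ ENNReal.ofReal_ne_top]
    refine lintegral_mono fun θ => ?_
    rw [enorm_mul]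
    gcongr
    rw [Real.enorm_eq_ofReal_abs]
    exact ENNReal.ofReal_le_ofReal (hB r θ)
  have h3 := h2.add h1
  rw [zero_add] at h3
  refine h3.congr' ?_
  filter_upwards [hV] with r hr
  have i1 : Integrable (fun θ => (V r θ - v θ) * G r θ) circleMeasure := hbd _ r (hr.sub hv)
  rw [← integral_add i1 (hbd _ r hv)]
  congr 1
  ext θ
  ring

theorem exists_bound_of_periodic {g : ℝ → ℝ} (hg : Continuous g)
    (hp : Function.Periodic g (2 * Real.pi)) : ∃ B : ℝ, ∀ x, |g x| ≤ B := by
  obtain ⟨B, hB⟩ := isCompact_Icc.exists_bound_of_continuousOn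
    (hg.continuousOn (s := Icc 0 (2 * Real.pi)))
  refine ⟨B, fun x => ?_⟩
  obtain ⟨y, hy, e⟩ := hp.exists_mem_Ico₀ two_pi_pos' x
  rw [e]
  exact hB y (Ico_subset_Icc_self hy)

theorem periodic_deriv {g : ℝ → ℝ} {T : ℝ} (hp : Function.Periodic g T) :
    Function.Periodic (deriv g) T := by
  intro x
  rw [← deriv_comp_add_const, funext hp]

section Moments

variable {R₀ : ℝ} {f : ℝ → ℝ → ℝ} {f' : Partials} {g : ℝ → ℝ} {σ : ℝ}

theorem tendsto_translate (hg : Continuous g) (R θ : ℝ) (s : Set ℝ) :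
    Tendsto (fun r => g (θ - σ * r)) (𝓝[s] R) (𝓝 (g (θ - σ * R))) := by
  have : Continuous fun r => g (θ - σ * r) := by fun_prop
  exact (this.tendsto R).mono_left nhdsWithin_le_nhds

theorem continuousOn_moment {V : ℝ → ℝ → ℝ} (hg : Continuous g)
    (hp : Function.Periodic g (2 * Real.pi))
    (hV : ∀ R, R₀ ≤ R → Integrable (V R) circleMeasure)
    (hc : ∀ R, R₀ ≤ R → Tendsto (fun r => eLpNorm (fun θ => V r θ - V R θ) 1 circleMeasure)
      (𝓝[Ici R₀] R) (𝓝 0)) :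
    ContinuousOn (fun r => ∫ θ, V r θ * g (θ - σ * r) ∂circleMeasure) (Ici R₀) := by
  intro R hR
  obtain ⟨B, hB⟩ := exists_bound_of_periodic hg hp
  refine tendsto_integral_mul_circle ?_ (hV R hR) (hc R hR) (fun r => by fun_prop)
    (fun r θ => hB _) (fun θ => tendsto_translate hg R θ _)
  filter_upwards [self_mem_nhdsWithin] with r hr using hV r hr

/-- An energy field is differentiable in `R` when tested against a function of `θ` that is
transported along characteristics. -/
theorem IsEnergyField.hasDerivWithinAt_moment (h : IsEnergyField 1 R₀ f f') (hg : ContDiff ℝ ∞ g)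
    (hp : Function.Periodic g (2 * Real.pi)) {R : ℝ} (hR : R₀ ≤ R) :
    HasDerivWithinAt (fun r => ∫ θ, f r θ * g (θ - σ * r) ∂circleMeasure)
      (∫ θ, f'.R R θ * g (θ - σ * R) ∂circleMeasure
        - σ * ∫ θ, f R θ * deriv g (θ - σ * R) ∂circleMeasure) (Ici R₀) R := by
  have hgc := hg.continuous
  have hd : Continuous (deriv g) := hg.continuous_deriv (by simp)
  obtain ⟨B, hB⟩ := exists_bound_of_periodic hgc hp
  obtain ⟨B', hB'⟩ := exists_bound_of_periodic hd (periodic_deriv hp)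
  have hfi : ∀ r, R₀ ≤ r → Integrable (f r) circleMeasure := fun r hr =>
    integrable_circle_of_continuous (h.continuous r hr)
  rw [hasDerivWithinAt_iff_tendsto_slope]
  have h1 : Tendsto (fun r => ∫ θ, ((r - R)⁻¹ * (f r θ - f R θ)) * g (θ - σ * r) ∂circleMeasure)
      (𝓝[Ici R₀ \ {R}] R) (𝓝 (∫ θ, f'.R R θ * g (θ - σ * R) ∂circleMeasure)) := by
    refine tendsto_integral_mul_circle ?_ (h.integrable_R hR) (h.deriv_R R hR)
      (fun r => by fun_prop) (fun r θ => hB _) (fun θ => tendsto_translate hgc R θ _)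
    filter_upwards [self_mem_nhdsWithin] with r hr
    exact ((hfi r hr.1).sub (hfi R hR)).const_mul _
  have hLip : ∀ x y, |g x - g y| ≤ B' * |x - y| := fun x y =>
    convex_univ.norm_image_sub_le_of_norm_deriv_le
      (fun z _ => hg.differentiable (by simp) z) (fun z _ => hB' z) (mem_univ y) (mem_univ x)
  have hder : ∀ θ, HasDerivAt (fun r => g (θ - σ * r)) (-σ * deriv g (θ - σ * R)) R := by
    intro θ
    have d1 : HasDerivAt (fun r => θ - σ * r) (-σ) R := by
      simpa using ((hasDerivAt_id R).const_mul σ).const_sub θ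
    have d2 := (hg.differentiable (by simp) (θ - σ * R)).hasDerivAt.comp R d1
    rw [mul_comm] at d2
    exact d2
  have h2 : Tendsto (fun r => ∫ θ, f R θ * ((r - R)⁻¹ * (g (θ - σ * r) - g (θ - σ * R)))
      ∂circleMeasure) (𝓝[Ici R₀ \ {R}] R)
      (𝓝 (∫ θ, f R θ * (-σ * deriv g (θ - σ * R)) ∂circleMeasure)) := by
    refine tendsto_integral_mul_circle (V := fun _ => f R) (B := B' * |σ|)
      (Eventually.of_forall fun _ => hfi R hR) (hfi R hR)
      (by simp only [sub_self, eLpNorm_zero']; exact tendsto_const_nhds) (fun r => by fun_prop)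
      (fun r θ => ?_) (fun θ => ?_)
    · rw [abs_mul, abs_inv]
      rcases eq_or_ne r R with rfl | hne
      · have := (abs_nonneg _).trans (hB' 0)
        simp only [sub_self, abs_zero, inv_zero, zero_mul]
        positivity
      · rw [inv_mul_le_iff₀ (abs_pos.2 (sub_ne_zero.2 hne))]
        refine (hLip _ _).trans (le_of_eq ?_)
        have : θ - σ * r - (θ - σ * R) = -(σ * (r - R)) := by ring
        rw [this, abs_neg, abs_mul]
        ring
    · have := (hasDerivWithinAt_iff_tendsto_slope.1 ((hder θ).hasDerivWithinAt (s := Ici R₀)))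
      refine this.congr fun r => ?_
      rw [slope_def_field]
      ring
  have e2 : ∫ θ, f R θ * (-σ * deriv g (θ - σ * R)) ∂circleMeasure =
      -(σ * ∫ θ, f R θ * deriv g (θ - σ * R) ∂circleMeasure) := by
    rw [← integral_const_mul, ← integral_neg]
    congr 1
    ext θ
    ring
  rw [e2] at h2
  refine ((h1.add h2).congr' ?_)
  filter_upwards [self_mem_nhdsWithin] with r hr
  have hi : ∀ (u : ℝ → ℝ) (c : ℝ), Continuous u → Integrable (fun θ => u θ * g (θ - σ * c))
      circleMeasure := fun u c hu =>
    integrable_circle_of_continuous (by fun_prop)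
  have c1 := h.continuous r hr.1
  have c2 := h.continuous R hR
  rw [← integral_add (integrable_circle_of_continuous (by fun_prop))
    (integrable_circle_of_continuous (by fun_prop)), slope, vsub_eq_sub, smul_eq_mul,
    ← integral_sub (hi _ _ c1) (hi _ _ c2), ← integral_const_mul]
  congr 1
  ext θ
  ring

theorem IsEnergyField.moment_θ (h : IsEnergyField 1 R₀ f f') (hg : ContDiff ℝ ∞ g)
    (hp : Function.Periodic g (2 * Real.pi)) {R : ℝ} (hR : R₀ ≤ R) :
    ∫ θ, f'.θ R θ * g (θ - σ * R) ∂circleMeasure =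
      -∫ θ, f R θ * deriv g (θ - σ * R) ∂circleMeasure := by
  have e := h.weakDeriv_θ R hR (fun θ => g (θ - σ * R)) (by fun_prop)
    (fun x => by change g _ = g _; rw [← hp (x - σ * R)]; congr 1; ring)
  simp only [deriv_comp_sub_const] at e
  linarith

end Moments

theorem isTestFunction_char {R₀ R₁ : ℝ} {χ ψ : ℝ → ℝ} (hR : R₀ < R₁) (hχ : ContDiff ℝ ∞ χ)
    (hc : HasCompactSupport χ) (hs : tsupport χ ⊆ Ioo R₀ R₁) (hψ : ContDiff ℝ ∞ ψ)
    (hp : Function.Periodic ψ (2 * Real.pi)) (σ : ℝ) :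
    IsTestFunction R₀ (fun r θ => χ r * ψ (θ - σ * r)) := by
  refine ⟨?_, ?_, ?_⟩
  · have : (Function.uncurry fun r θ => χ r * ψ (θ - σ * r)) =
        fun z : ℝ × ℝ => χ z.1 * ψ (z.2 - σ * z.1) := rfl
    rw [this]
    fun_prop
  · intro r θ
    have : θ + 2 * Real.pi - σ * r = θ - σ * r + 2 * Real.pi := by ring
    simp only [this, hp _]
  · obtain ⟨α, β, h1, -, h2, h3⟩ := exists_Icc_of_isCompact_subset_Ioo hR hc hs
    refine ⟨α, β, h1, fun r θ h => h3 (subset_tsupport _ ?_)⟩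
    exact left_ne_zero_of_mul h

namespace IsWaveField

variable {R₀ : ℝ} {w w' : ℝ → ℝ} {f : ℝ → ℝ → ℝ} {f' : Partials} {H : ℝ → ℝ → ℝ} {σ : ℝ}

theorem continuousOn_w (h : IsWaveField R₀ w w' f f' H) : ContinuousOn w (Ici R₀) :=
  fun r hr => (h.hasDerivAt_w r hr).continuousAt.continuousWithinAt

theorem measurable_charSource (h : IsWaveField R₀ w w' f f' H) :
    Measurable (Function.uncurry (charSource w' f' H σ)) :=
  h.measurable_H.sub (((h.measurable_w'.comp measurable_fst).const_mul σ).mul h.field.measurable_θ)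

theorem integrable_charSource (h : IsWaveField R₀ w w' f f' H) (R₁ : ℝ) :
    Integrable (Function.uncurry (charSource w' f' H σ)) (slab R₀ R₁) := by
  refine (h.integrable_H R₁).sub ?_
  obtain ⟨B, hB⟩ := isCompact_Icc.exists_bound_of_continuousOn
    (h.continuousOn_w'.mono fun r (hr : r ∈ Icc R₀ R₁) => hr.1)
  refine (memLp_one_iff_integrable.1 (h.field.memLp_slab_θ le_rfl (by simp) R₁)).bdd_mul
    (c := |σ| * B) ?_ ?_
  · exact ((h.measurable_w'.comp measurable_fst).const_mul σ).aestronglyMeasurable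
  · filter_upwards [ae_slab] with z hz
    rw [norm_mul, Real.norm_eq_abs]
    exact mul_le_mul_of_nonneg_left (hB _ (Ioc_subset_Icc_self hz)) (abs_nonneg _)

theorem periodic_charSource (h : IsWaveField R₀ w w' f f' H) {r : ℝ} (hr : R₀ ≤ r) :
    Function.Periodic (charSource w' f' H σ r) (2 * Real.pi) := by
  intro θ
  simp only [charSource, h.periodic_H r hr θ, h.field.periodic_θ r hr θ]

theorem integrable_nullDeriv (h : IsEnergyField 1 R₀ f f') {r : ℝ} (hr : R₀ ≤ r) :
    Integrable (nullDeriv f' σ r) circleMeasure :=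
  (h.integrable_R hr).sub ((h.integrable_θ hr).const_mul σ)

theorem periodic_nullDeriv (h : IsEnergyField 1 R₀ f f') {r : ℝ} (hr : R₀ ≤ r) :
    Function.Periodic (nullDeriv f' σ r) (2 * Real.pi) := by
  intro θ
  simp only [nullDeriv, h.periodic_R r hr θ, h.periodic_θ r hr θ]

/-- The transport equation in weak form, integrated in `R`: the wave equation is tested against
functions `χ(R) ψ(θ - σ R)` which are constant along characteristics up to the cut-off `χ`. -/
theorem moment_nullDeriv (h : IsWaveField R₀ w w' f f' H) (hσ : σ * σ = 1) {ψ : ℝ → ℝ}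
    (hψ : ContDiff ℝ ∞ ψ) (hp : Function.Periodic ψ (2 * Real.pi)) {R : ℝ} (hR : R₀ ≤ R) :
    w R * ∫ θ, nullDeriv f' σ R θ * ψ (θ - σ * R) ∂circleMeasure =
      w R₀ * ∫ θ, nullDeriv f' σ R₀ θ * ψ (θ - σ * R₀) ∂circleMeasure +
      ∫ r in R₀..R, ∫ θ, charSource w' f' H σ r θ * ψ (θ - σ * r) ∂circleMeasure := by
  rcases hR.eq_or_lt with rfl | hlt
  · simp
  have hf := h.field
  have hd : ContDiff ℝ ∞ (deriv ψ) := (contDiff_infty_iff_deriv.1 hψ).2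
  have hdp := periodic_deriv hp
  let P (g : ℝ → ℝ) (r : ℝ) : ℝ := ∫ θ, f'.R r θ * g (θ - σ * r) ∂circleMeasure
  let Θ (g : ℝ → ℝ) (r : ℝ) : ℝ := ∫ θ, f'.θ r θ * g (θ - σ * r) ∂circleMeasure
  let F (g : ℝ → ℝ) (r : ℝ) : ℝ := ∫ θ, f r θ * g (θ - σ * r) ∂circleMeasure
  let K (r : ℝ) : ℝ := ∫ θ, H r θ * ψ (θ - σ * r) ∂circleMeasure
  have hPc : ∀ g, ContDiff ℝ ∞ g → Function.Periodic g (2 * Real.pi) →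
      ContinuousOn (P g) (Ici R₀) := fun g h1 h2 =>
    continuousOn_moment h1.continuous h2 (fun R hR => hf.integrable_R hR) hf.continuous_R
  have hΘc : ∀ g, ContDiff ℝ ∞ g → Function.Periodic g (2 * Real.pi) →
      ContinuousOn (Θ g) (Ici R₀) := fun g h1 h2 =>
    continuousOn_moment h1.continuous h2 (fun R hR => hf.integrable_θ hR) hf.continuous_θ
  have hFc : ∀ g, ContDiff ℝ ∞ g → Function.Periodic g (2 * Real.pi) →
      ContinuousOn (F g) (Ici R₀) := fun g h1 h2 =>
    continuousOn_moment h1.continuous h2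
      (fun R hR => integrable_circle_of_continuous (hf.continuous R hR))
      (fun R hR => hf.tendsto_eLpNorm_sub hR)
  have hsub : Icc R₀ R ⊆ Ici R₀ := Icc_subset_Ici_self
  have ii : ∀ u : ℝ → ℝ, ContinuousOn u (Ici R₀) → IntervalIntegrable u volume R₀ R := fun u hu =>
    ContinuousOn.intervalIntegrable (by rw [uIcc_of_le hR]; exact hu.mono hsub)
  obtain ⟨B, hB⟩ := exists_bound_of_periodic hψ.continuous hp
  have hψm : Measurable fun z : ℝ × ℝ => ψ (z.2 - σ * z.1) := by
    have := hψ.continuous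
    exact (by fun_prop : Continuous fun z : ℝ × ℝ => ψ (z.2 - σ * z.1)).measurable
  have hslice : ∀ u : ℝ → ℝ, Integrable u circleMeasure → ∀ g : ℝ → ℝ, ContDiff ℝ ∞ g →
      Function.Periodic g (2 * Real.pi) → ∀ r,
      Integrable (fun θ => u θ * g (θ - σ * r)) circleMeasure := by
    intro u hu g hg hgp r
    obtain ⟨B, hB⟩ := exists_bound_of_periodic hg.continuous hgp
    have := hg.continuous
    exact hu.mul_bdd (c := B) (by fun_prop : Continuous fun θ => g (θ - σ * r)).aestronglyMeasurable
      (Eventually.of_forall fun θ => hB _)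
  have hKint : Integrable (fun z : ℝ × ℝ => H z.1 z.2 * ψ (z.2 - σ * z.1)) (slab R₀ R) :=
    (h.integrable_H R).mul_bdd (c := B) hψm.aestronglyMeasurable
      (Eventually.of_forall fun z => hB _)
  have hK : IntervalIntegrable K volume R₀ R := by
    rw [intervalIntegrable_iff_integrableOn_Ioc_of_le hR]
    exact hKint.integral_prod_left
  have hwP := h.continuousOn_w
  -- the derivative of `w ∫ f_R ψ(θ - σ R) dθ`
  have hL : w R * P ψ R = w R₀ * P ψ R₀ +
      ∫ r in R₀..R, (K r - w r * (σ * P (deriv ψ) r + Θ (deriv ψ) r)) := by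
    have hG2 : ContinuousOn (fun r => w r * (σ * P (deriv ψ) r + Θ (deriv ψ) r)) (Ici R₀) :=
      hwP.mul (((hPc _ hd hdp).const_smul σ).add (hΘc _ hd hdp))
    refine eq_add_integral_of_weakDeriv (L := fun r => w r * P ψ r) hlt
      ((hwP.mul (hPc ψ hψ hp)).mono hsub) (hK.sub (ii _ hG2)) ?_ R (right_mem_Icc.2 hR)
    intro χ c1 c2 c3
    have e := h.eq _ (isTestFunction_char hlt c1 c2 c3 hψ hp σ)
    have hz : ∀ r, r ∉ Ioc R₀ R → χ r = 0 ∧ deriv χ r = 0 := fun r hr =>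
      ⟨image_eq_zero_of_notMem_tsupport fun hh => hr (Ioo_subset_Ioc_self (c3 hh)),
        image_eq_zero_of_notMem_tsupport fun hh =>
          hr (Ioo_subset_Ioc_self (c3 (tsupport_deriv_subset hh)))⟩
    have e1 : waveOp R₀ w f' (fun r θ => χ r * ψ (θ - σ * r)) =
        ∫ r in R₀..R, (-(deriv χ r * (w r * P ψ r)) +
          χ r * (w r * (σ * P (deriv ψ) r + Θ (deriv ψ) r))) := by
      rw [waveOp, intervalIntegral.integral_of_le hR]
      have : ∀ r ∈ Ioi R₀, ∫ θ, (-(w r * f'.R r θ) * deriv (fun r' => χ r' * ψ (θ - σ * r')) r +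
          (w r * f'.θ r θ) * deriv (fun θ => χ r * ψ (θ - σ * r)) θ) ∂circleMeasure =
          -(deriv χ r * (w r * P ψ r)) + χ r * (w r * (σ * P (deriv ψ) r + Θ (deriv ψ) r)) := by
        intro r hr
        have hr' : R₀ ≤ r := le_of_lt hr
        have d1 : ∀ θ, deriv (fun r' => χ r' * ψ (θ - σ * r')) r =
            deriv χ r * ψ (θ - σ * r) - σ * χ r * deriv ψ (θ - σ * r) := by
          intro θ
          have a1 : HasDerivAt (fun r => θ - σ * r) (-σ) r := by
            simpa using ((hasDerivAt_id r).const_mul σ).const_sub θ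
          have a2 := (hψ.differentiable (by simp) (θ - σ * r)).hasDerivAt.comp r a1
          have a3 := (c1.differentiable (by simp) r).hasDerivAt.mul a2
          refine a3.deriv.trans ?_
          simp only [Function.comp_apply]
          ring
        have d2 : ∀ θ, deriv (fun θ => χ r * ψ (θ - σ * r)) θ = χ r * deriv ψ (θ - σ * r) := by
          intro θ
          rw [deriv_const_mul_field, deriv_comp_sub_const]
        simp only [d1, d2]
        have i1 := hslice _ (hf.integrable_R hr') ψ hψ hp r
        have i2 := hslice _ (hf.integrable_R hr') _ hd hdp r
        have i3 := hslice _ (hf.integrable_θ hr') _ hd hdp r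
        have e2 : ∀ θ, -(w r * f'.R r θ) * (deriv χ r * ψ (θ - σ * r) -
            σ * χ r * deriv ψ (θ - σ * r)) + w r * f'.θ r θ * (χ r * deriv ψ (θ - σ * r)) =
            -(deriv χ r * w r) * (f'.R r θ * ψ (θ - σ * r)) +
            ((χ r * w r * σ) * (f'.R r θ * deriv ψ (θ - σ * r)) +
            (χ r * w r) * (f'.θ r θ * deriv ψ (θ - σ * r))) := fun θ => by ring
        simp only [e2]
        have i4 : Integrable (fun θ => (χ r * w r * σ) * (f'.R r θ * deriv ψ (θ - σ * r)) +
            (χ r * w r) * (f'.θ r θ * deriv ψ (θ - σ * r))) circleMeasure :=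
          (i2.const_mul _).add (i3.const_mul _)
        rw [integral_add (i1.const_mul _) i4, integral_add (i2.const_mul _) (i3.const_mul _),
          integral_const_mul, integral_const_mul,
          integral_const_mul]
        simp only [P, Θ]
        ring
      rw [setIntegral_congr_fun measurableSet_Ioi this]
      refine setIntegral_eq_of_subset_of_forall_sdiff_eq_zero measurableSet_Ioi
        Ioc_subset_Ioi_self fun r hr => ?_
      rw [(hz r hr.2).1, (hz r hr.2).2]
      ring
    have e2 : pairing R₀ H (fun r θ => χ r * ψ (θ - σ * r)) = ∫ r in R₀..R, χ r * K r := by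
      rw [pairing, intervalIntegral.integral_of_le hR]
      have : ∀ r, ∫ θ, H r θ * (χ r * ψ (θ - σ * r)) ∂circleMeasure = χ r * K r := by
        intro r
        simp only [K]
        rw [← integral_const_mul]
        congr 1
        ext θ
        ring
      simp only [this]
      refine setIntegral_eq_of_subset_of_forall_sdiff_eq_zero measurableSet_Ioi
        Ioc_subset_Ioi_self fun r hr => ?_
      rw [(hz r hr.2).1]
      ring
    have j1 : IntervalIntegrable (fun r => -(deriv χ r * (w r * P ψ r)) +
          χ r * (w r * (σ * P (deriv ψ) r + Θ (deriv ψ) r))) volume R₀ R :=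
      ii _ (((c1.continuous_deriv (by simp)).continuousOn.mul (hwP.mul (hPc ψ hψ hp))).neg.add
        (c1.continuous.continuousOn.mul hG2))
    have j2 : IntervalIntegrable (fun r => χ r * K r) volume R₀ R :=
      hK.continuousOn_mul c1.continuous.continuousOn
    rw [e1, e2] at e
    have e3 := intervalIntegral.integral_sub j2 j1
    rw [e, sub_self] at e3
    rw [← e3]
    congr 1
    ext r
    ring
  -- the derivative of `w ∫ f ψ'(θ - σ R) dθ`
  have hN : w R * F (deriv ψ) R - w R₀ * F (deriv ψ) R₀ =
      ∫ r in R₀..R, (w' r * F (deriv ψ) r +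
        w r * (P (deriv ψ) r + σ * Θ (deriv ψ) r)) := by
    have hc : ContinuousOn (fun r => w' r * F (deriv ψ) r +
        w r * (P (deriv ψ) r + σ * Θ (deriv ψ) r)) (Ici R₀) :=
      (h.continuousOn_w'.mul (hFc _ hd hdp)).add
        (hwP.mul ((hPc _ hd hdp).add ((hΘc _ hd hdp).const_smul σ)))
    symm
    refine intervalIntegral.integral_eq_sub_of_hasDeriv_right (f := fun r => w r * F (deriv ψ) r)
      ?_ ?_ (ii _ hc)
    · rw [uIcc_of_le hR]
      exact (hwP.mul (hFc _ hd hdp)).mono hsub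
    · intro r hr
      rw [min_eq_left hR, max_eq_right hR] at hr
      have d1 := hf.hasDerivWithinAt_moment (σ := σ) hd hdp hr.1.le
      have d2 := (h.hasDerivAt_w r hr.1.le).hasDerivWithinAt (s := Ici R₀)
      have e := hf.moment_θ (σ := σ) hd hdp hr.1.le
      have d3 := (d2.mul d1).mono (show Ioi r ⊆ Ici R₀ from fun x hx => (hr.1.trans hx).le)
      have e2 : P (deriv ψ) r + σ * Θ (deriv ψ) r = P (deriv ψ) r -
          σ * ∫ θ, f r θ * deriv (deriv ψ) (θ - σ * r) ∂circleMeasure := by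
        simp only [Θ, e]
        ring
      rw [e2]
      exact d3
  have hΘF : ∀ r, R₀ ≤ r → Θ ψ r = -F (deriv ψ) r := fun r hr => hf.moment_θ hψ hp hr
  have hnull : ∀ r, R₀ ≤ r → ∫ θ, nullDeriv f' σ r θ * ψ (θ - σ * r) ∂circleMeasure =
      P ψ r + σ * F (deriv ψ) r := by
    intro r hr
    have e : ∀ θ, nullDeriv f' σ r θ * ψ (θ - σ * r) =
        f'.R r θ * ψ (θ - σ * r) - σ * (f'.θ r θ * ψ (θ - σ * r)) := fun θ => by
      simp only [nullDeriv]; ring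
    simp only [e]
    rw [integral_sub (hslice _ (hf.integrable_R hr) ψ hψ hp r)
      ((hslice _ (hf.integrable_θ hr) ψ hψ hp r).const_mul σ), integral_const_mul]
    change P ψ r - σ * Θ ψ r = _
    rw [hΘF r hr]
    ring
  have hsrc : ∫ r in R₀..R, ∫ θ, charSource w' f' H σ r θ * ψ (θ - σ * r) ∂circleMeasure =
      ∫ r in R₀..R, (K r + σ * (w' r * F (deriv ψ) r)) := by
    rw [intervalIntegral.integral_of_le hR, intervalIntegral.integral_of_le hR]
    refine integral_congr_ae ?_
    have hae : ∀ᵐ r ∂(volume.restrict (Ioc R₀ R)),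
        Integrable (fun θ => H r θ * ψ (θ - σ * r)) circleMeasure := hKint.prod_right_ae
    filter_upwards [hae, ae_restrict_mem measurableSet_Ioc] with r hi hr
    have e : ∀ θ, charSource w' f' H σ r θ * ψ (θ - σ * r) =
        H r θ * ψ (θ - σ * r) - (σ * w' r) * (f'.θ r θ * ψ (θ - σ * r)) := fun θ => by
      simp only [charSource]; ring
    simp only [e]
    rw [integral_sub hi ((hslice _ (hf.integrable_θ hr.1.le) ψ hψ hp r).const_mul _),
      integral_const_mul]
    change K r - σ * w' r * Θ ψ r = _
    rw [hΘF r hr.1.le]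
    ring
  rw [hnull R hR, hnull R₀ le_rfl, hsrc]
  have j1 : IntervalIntegrable (fun r => w r * (σ * P (deriv ψ) r + Θ (deriv ψ) r)) volume R₀ R :=
    ii _ (hwP.mul (((hPc _ hd hdp).const_smul σ).add (hΘc _ hd hdp)))
  have j2 : IntervalIntegrable (fun r => w' r * F (deriv ψ) r) volume R₀ R :=
    ii _ (h.continuousOn_w'.mul (hFc _ hd hdp))
  have j3 : IntervalIntegrable (fun r => w r * (P (deriv ψ) r + σ * Θ (deriv ψ) r)) volume R₀ R :=
    ii _ (hwP.mul ((hPc _ hd hdp).add ((hΘc _ hd hdp).const_smul σ)))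
  rw [intervalIntegral.integral_sub hK j1] at hL
  rw [intervalIntegral.integral_add j2 j3] at hN
  rw [intervalIntegral.integral_add hK (j2.const_mul σ), intervalIntegral.integral_const_mul]
  have e : ∫ r in R₀..R, w r * (σ * P (deriv ψ) r + Θ (deriv ψ) r) =
      σ * ∫ r in R₀..R, w r * (P (deriv ψ) r + σ * Θ (deriv ψ) r) := by
    rw [← intervalIntegral.integral_const_mul]
    congr 1
    ext r
    linear_combination -(w r * Θ (deriv ψ) r) * hσ
  rw [e] at hL
  linear_combination hL + σ * hN

end IsWaveField

/-! ### The pointwise representative of the null derivatives -/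

theorem integrable_slab_shift {R₀ R₁ : ℝ} {k : ℝ → ℝ → ℝ} (hm : Measurable (Function.uncurry k))
    (hp : ∀ r, R₀ ≤ r → Function.Periodic (k r) (2 * Real.pi))
    (hi : Integrable (Function.uncurry k) (slab R₀ R₁)) {s : ℝ → ℝ} (hs : Measurable s) :
    Integrable (fun z : ℝ × ℝ => k z.1 (z.2 + s z.1)) (slab R₀ R₁) := by
  have hm' : Measurable fun z : ℝ × ℝ => k z.1 (z.2 + s z.1) :=
    hm.comp (measurable_fst.prodMk (measurable_snd.add (hs.comp measurable_fst)))
  refine ⟨hm'.aestronglyMeasurable, ?_⟩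
  have h1 := hi.2
  rw [HasFiniteIntegral, lintegral_slab hm.enorm.aemeasurable] at h1
  rw [HasFiniteIntegral, lintegral_slab hm'.enorm.aemeasurable]
  refine lt_of_eq_of_lt (setLIntegral_congr_fun measurableSet_Ioc fun r hr => ?_) h1
  exact lintegral_circle_translate (g := fun θ => ‖k r θ‖ₑ)
    (fun θ => by simp only [hp r hr.1.le θ]) (s r)

/-- A periodic function orthogonal to all smooth periodic functions vanishes. -/
theorem ae_eq_zero_of_forall_periodic {v : ℝ → ℝ} (hv : Integrable v circleMeasure)
    (hp : Function.Periodic v (2 * Real.pi))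
    (h : ∀ ψ : ℝ → ℝ, ContDiff ℝ ∞ ψ → Function.Periodic ψ (2 * Real.pi) →
      ∫ θ, v θ * ψ θ ∂circleMeasure = 0) : ∀ᵐ θ, v θ = 0 := by
  refine ae_of_ae_circle (fun x => by rw [hp x]) ?_
  refine (ae_restrict_iff' measurableSet_Ioo).2 ?_
  refine isOpen_Ioo.ae_eq_zero_of_integral_contDiff_smul_eq_zero
    (IntegrableOn.locallyIntegrableOn hv) ?_
  intro g h1 h2 h3
  obtain ⟨ψ, e1, e2, e3⟩ := exists_periodic_extension two_pi_pos' h1 h2 h3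
  rw [← h ψ e1 e2, circleMeasure, intervalMeasure,
    ← setIntegral_eq_integral_of_forall_compl_eq_zero (s := Ioo 0 (2 * Real.pi))]
  · refine setIntegral_congr_fun measurableSet_Ioo fun x hx => ?_
    simp only [e3 hx, smul_eq_mul, mul_comm]
  · intro x hx
    rw [image_eq_zero_of_notMem_tsupport fun hh => hx (h3 hh), zero_smul]

namespace IsWaveField

variable {R₀ : ℝ} {w w' : ℝ → ℝ} {f : ℝ → ℝ → ℝ} {f' : Partials} {H : ℝ → ℝ → ℝ} {σ : ℝ}

/-- On every slice, the null derivative of a weak solution agrees almost everywhere with the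
representative obtained by integration along characteristics. -/
theorem ae_eq_charRep (h : IsWaveField R₀ w w' f f' H) (hσ : σ * σ = 1) {R : ℝ} (hR : R₀ ≤ R) :
    ∀ᵐ θ, nullDeriv f' σ R θ =
      charRep R₀ w (nullDeriv f' σ R₀) (charSource w' f' H σ) σ R θ := by
  set k := charSource w' f' H σ with hk
  have hshift : ∀ r, R₀ ≤ r → Integrable (fun c => nullDeriv f' σ r (c + σ * r)) circleMeasure := by
    intro r hr
    have hper := periodic_nullDeriv (σ := σ) h.field hr
    have := intervalIntegrable_of_circle hper (integrable_nullDeriv (σ := σ) h.field hr)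
    rw [integrable_circle_iff]
    have h1 := (this (0 + σ * r) (2 * Real.pi + σ * r)).comp_add_right (σ * r)
    simpa using h1
  have hkm : Measurable (Function.uncurry k) := h.measurable_charSource
  have hks := integrable_slab_shift hkm (fun r hr => h.periodic_charSource (σ := σ) hr)
    (h.integrable_charSource R) (measurable_const_mul σ)
  let J (c : ℝ) : ℝ := ∫ r in Ioc R₀ R, k r (c + σ * r)
  have hJ : Integrable J circleMeasure := hks.integral_prod_right
  let v (c : ℝ) : ℝ := w R * nullDeriv f' σ R (c + σ * R) -
    w R₀ * nullDeriv f' σ R₀ (c + σ * R₀) - J c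
  have hv : Integrable v circleMeasure :=
    (((hshift R hR).const_mul _).sub ((hshift R₀ le_rfl).const_mul _)).sub hJ
  have hvp : Function.Periodic v (2 * Real.pi) := by
    intro c
    have e : ∀ r, c + 2 * Real.pi + σ * r = c + σ * r + 2 * Real.pi := fun r => by ring
    have eJ : J (c + 2 * Real.pi) = J c := by
      refine setIntegral_congr_fun measurableSet_Ioc fun r hr => ?_
      simp only [e]
      exact h.periodic_charSource hr.1.le _
    simp only [v, e, eJ, periodic_nullDeriv h.field hR _, periodic_nullDeriv h.field le_rfl _]
  have hv0 : ∀ᵐ c, v c = 0 := by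
    refine ae_eq_zero_of_forall_periodic hv hvp fun ψ h1 h2 => ?_
    have key := h.moment_nullDeriv hσ h1 h2 hR
    obtain ⟨B, hB⟩ := exists_bound_of_periodic h1.continuous h2
    have hmul : ∀ u : ℝ → ℝ, Integrable u circleMeasure →
        Integrable (fun c => u c * ψ c) circleMeasure := fun u hu =>
      hu.mul_bdd (c := B) h1.continuous.aestronglyMeasurable (Eventually.of_forall fun c => hB c)
    have htr : ∀ (u : ℝ → ℝ) (r : ℝ), Function.Periodic u (2 * Real.pi) →
        ∫ θ, u θ * ψ (θ - σ * r) ∂circleMeasure = ∫ c, u (c + σ * r) * ψ c ∂circleMeasure := by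
      intro u r hu
      rw [← integral_circle_translate (f := fun θ => u θ * ψ (θ - σ * r)) ?_ (σ * r)]
      · simp
      · intro θ
        have : θ + 2 * Real.pi - σ * r = θ - σ * r + 2 * Real.pi := by ring
        simp only [hu θ, this, h2 _]
    rw [htr _ R (periodic_nullDeriv h.field hR), htr _ R₀ (periodic_nullDeriv h.field le_rfl),
      intervalIntegral.integral_of_le hR] at key
    have e1 : ∫ r in Ioc R₀ R, ∫ θ, charSource w' f' H σ r θ * ψ (θ - σ * r) ∂circleMeasure =
        ∫ c, J c * ψ c ∂circleMeasure := by
      have hsw : Integrable (fun z : ℝ × ℝ => k z.1 (z.2 + σ * z.1) * ψ z.2) (slab R₀ R) :=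
        hks.mul_bdd (c := B) (h1.continuous.comp continuous_snd).aestronglyMeasurable
          (Eventually.of_forall fun z => hB z.2)
      have e2 : ∫ r in Ioc R₀ R, ∫ c, k r (c + σ * r) * ψ c ∂circleMeasure =
          ∫ c, (∫ r in Ioc R₀ R, k r (c + σ * r) * ψ c) ∂circleMeasure :=
        integral_integral_swap (f := fun r c => k r (c + σ * r) * ψ c) hsw
      calc _ = ∫ r in Ioc R₀ R, ∫ c, k r (c + σ * r) * ψ c ∂circleMeasure := by
            refine setIntegral_congr_fun measurableSet_Ioc fun r hr => ?_
            exact htr _ r (h.periodic_charSource hr.1.le)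
        _ = _ := by
            rw [e2]
            congr 1
            ext c
            exact integral_mul_const (ψ c) _
    rw [e1] at key
    have e3 : ∀ c, v c * ψ c = w R * (nullDeriv f' σ R (c + σ * R) * ψ c) -
        w R₀ * (nullDeriv f' σ R₀ (c + σ * R₀) * ψ c) - J c * ψ c := fun c => by
      simp only [v]; ring
    simp only [e3]
    have i1 : Integrable (fun c => w R * (nullDeriv f' σ R (c + σ * R) * ψ c) -
        w R₀ * (nullDeriv f' σ R₀ (c + σ * R₀) * ψ c)) circleMeasure :=
      ((hmul _ (hshift R hR)).const_mul _).sub ((hmul _ (hshift R₀ le_rfl)).const_mul _)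
    rw [integral_sub i1 (hmul _ hJ),
      integral_sub ((hmul _ (hshift R hR)).const_mul _) ((hmul _ (hshift R₀ le_rfl)).const_mul _),
      integral_const_mul, integral_const_mul]
    linarith
  have h1 := (measurePreserving_sub_right volume (σ * R)).quasiMeasurePreserving.ae hv0
  filter_upwards [h1] with θ hθ
  have hwR := (h.w_pos R hR).ne'
  rw [charRep, eq_inv_mul_iff_mul_eq₀ hwR]
  simp only [v, J] at hθ
  rw [sub_add_cancel] at hθ
  have e1 : θ - σ * R + σ * R₀ = θ - σ * (R - R₀) := by ring
  have e2 : ∀ r, θ - σ * R + σ * r = θ - σ * (R - r) := fun r => by ring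
  simp only [e1, e2] at hθ
  linarith

end IsWaveField

/-! ### Curves transversal to the characteristics -/

/-- A curve `s ↦ (x s, y s)` in the half plane `R ≥ R₀` which is Lipschitz on `[s₀, s₁]` and
uniformly transversal to both families of characteristics `θ ± R = const`. -/
structure IsTransversal (R₀ s₀ s₁ : ℝ) (x y : ℝ → ℝ) : Prop where
  lt : s₀ < s₁
  continuous_x : Continuous x
  continuous_y : Continuous y
  lipschitz : ∃ K, LipschitzOnWith K x (Icc s₀ s₁) ∧ LipschitzOnWith K y (Icc s₀ s₁)
  mem : ∀ s ∈ Icc s₀ s₁, R₀ ≤ x s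
  interior : ∀ s ∈ Ioo s₀ s₁, R₀ < x s
  expand : ∃ κ : ℝ, 0 < κ ∧ ∀ σ : ℝ, σ * σ = 1 → ∀ s ∈ Icc s₀ s₁, ∀ t ∈ Icc s₀ s₁,
    κ * |s - t| ≤ |(y s - σ * x s) - (y t - σ * x t)|

/-- An expanding map pushes Lebesgue measure forward to a measure dominated by Lebesgue measure. -/
theorem map_le_of_expand {c : ℝ → ℝ} (hc : Measurable c) {S : Set ℝ}
    {κ : ℝ} (hκ : 0 < κ) (h : ∀ s ∈ S, ∀ t ∈ S, κ * |s - t| ≤ |c s - c t|) {J : Set ℝ}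
    (hJ : MapsTo c S J) :
    (volume.restrict S).map c ≤ ENNReal.ofReal κ⁻¹ • volume.restrict J := by
  have hinj : InjOn c S := by
    intro s hs t ht e
    have := h s hs t ht
    rw [e, sub_self, abs_zero] at this
    have h2 : |s - t| ≤ 0 := by
      by_contra! hh
      have := mul_pos hκ hh
      linarith
    exact sub_eq_zero.1 (abs_nonpos_iff.1 h2)
  have hlip : LipschitzOnWith (Real.toNNReal κ⁻¹) (Function.invFunOn c S) (c '' S) := by
    apply LipschitzOnWith.of_dist_le_mul
    rintro _ ⟨s, hs, rfl⟩ _ ⟨t, ht, rfl⟩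
    rw [hinj.leftInvOn_invFunOn hs, hinj.leftInvOn_invFunOn ht, Real.dist_eq, Real.dist_eq,
      Real.coe_toNNReal _ (inv_pos.2 hκ).le, le_inv_mul_iff₀ hκ]
    exact h s hs t ht
  refine Measure.le_iff.2 fun N hN => ?_
  rw [Measure.map_apply hc hN, Measure.smul_apply, Measure.restrict_apply (hc hN),
    Measure.restrict_apply hN]
  have e : c ⁻¹' N ∩ S = Function.invFunOn c S '' (c '' (c ⁻¹' N ∩ S)) := by
    rw [hinj.invFunOn_image inter_subset_right]
  have h1 := (hlip.mono (image_mono inter_subset_right)).hausdorffMeasure_image_le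
    (s := c '' (c ⁻¹' N ∩ S)) zero_le_one
  rw [← e, hausdorffMeasure_real, ENNReal.rpow_one] at h1
  refine h1.trans ?_
  rw [smul_eq_mul]
  refine mul_le_mul' le_rfl (measure_mono ?_)
  rintro _ ⟨s, ⟨h2, h3⟩, rfl⟩
  exact ⟨h2, hJ h3⟩

namespace IsTransversal

variable {R₀ s₀ s₁ : ℝ} {x y : ℝ → ℝ}

theorem exists_bound (h : IsTransversal R₀ s₀ s₁ x y) :
    ∃ M : ℝ, 0 < M ∧ ∀ s ∈ Icc s₀ s₁, |x s| ≤ M ∧ |y s| ≤ M := by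
  obtain ⟨M1, h1⟩ := isCompact_Icc.exists_bound_of_continuousOn
    (h.continuous_x.continuousOn (s := Icc s₀ s₁))
  obtain ⟨M2, h2⟩ := isCompact_Icc.exists_bound_of_continuousOn
    (h.continuous_y.continuousOn (s := Icc s₀ s₁))
  refine ⟨max (max M1 M2) 1, by positivity, fun s hs => ⟨?_, ?_⟩⟩
  · exact (h1 s hs).trans ((le_max_left _ _).trans (le_max_left _ _))
  · exact (h2 s hs).trans ((le_max_right _ _).trans (le_max_left _ _))

/-- Integrals along the curve of functions which are constant on characteristics are bounded by
integrals over the circle. -/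
theorem exists_lintegral_le (h : IsTransversal R₀ s₀ s₁ x y) :
    ∃ C : ENNReal, C ≠ ⊤ ∧ ∀ σ : ℝ, σ * σ = 1 → ∀ g : ℝ → ENNReal, Measurable g →
      Function.Periodic g (2 * Real.pi) → ∀ a : ℝ,
      ∫⁻ s in Ioo s₀ s₁, g (y s - σ * x s + a) ≤ C * ∫⁻ θ, g θ ∂circleMeasure := by
  obtain ⟨κ, hκ, hexp⟩ := h.expand
  obtain ⟨M, hM, hb⟩ := h.exists_bound
  obtain ⟨n, hn⟩ := exists_nat_gt (6 * M / (2 * Real.pi))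
  rw [div_lt_iff₀ two_pi_pos'] at hn
  refine ⟨ENNReal.ofReal κ⁻¹ * n, by finiteness, ?_⟩
  intro σ hσ g hg hp a
  have hσ' : |σ| = 1 := by
    have : |σ| * |σ| = 1 := by rw [← abs_mul, hσ, abs_one]
    nlinarith [abs_nonneg σ]
  have hcm : Measurable fun s => y s - σ * x s :=
    (h.continuous_y.sub (continuous_const.mul h.continuous_x)).measurable
  have hgp : Function.Periodic (fun c => g (c + a)) (2 * Real.pi) := by
    intro c
    have : c + 2 * Real.pi + a = c + a + 2 * Real.pi := by ring
    simp only [this, hp _]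
  have hga : Measurable fun c => g (c + a) := hg.comp (measurable_add_const a)
  have hJ : MapsTo (fun s => y s - σ * x s) (Ioo s₀ s₁)
      (Ioc (-(3 * M)) (-(3 * M) + n * (2 * Real.pi))) := by
    intro s hs
    obtain ⟨b1, b2⟩ := hb s (Ioo_subset_Icc_self hs)
    have b3 : |σ * x s| ≤ M := by rw [abs_mul, hσ', one_mul]; exact b1
    rw [abs_le] at b2 b3
    constructor <;> simp only <;> linarith
  calc ∫⁻ s in Ioo s₀ s₁, g (y s - σ * x s + a)
      = ∫⁻ c, g (c + a) ∂((volume.restrict (Ioo s₀ s₁)).map fun s => y s - σ * x s) :=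
        (lintegral_map hga hcm).symm
    _ ≤ ∫⁻ c, g (c + a) ∂(ENNReal.ofReal κ⁻¹ •
          volume.restrict (Ioc (-(3 * M)) (-(3 * M) + n * (2 * Real.pi)))) := by
        refine lintegral_mono' (map_le_of_expand hcm hκ ?_ hJ) le_rfl
        intro s hs t ht
        exact hexp σ hσ s (Ioo_subset_Icc_self hs) t (Ioo_subset_Icc_self ht)
    _ = ENNReal.ofReal κ⁻¹ * ∫⁻ c in Ioc (-(3 * M)) (-(3 * M) + n * (2 * Real.pi)), g (c + a) := by
        rw [lintegral_smul_measure, smul_eq_mul]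
    _ ≤ ENNReal.ofReal κ⁻¹ * (n * ∫⁻ c in Ioc 0 (2 * Real.pi), g (c + a)) := by
        gcongr
        exact lintegral_periodic_le two_pi_pos' hgp _ _
    _ = _ := by
        rw [← circleMeasure_eq, lintegral_circle_translate hp, mul_assoc]

end IsTransversal

theorem measurable_charRep {R₀ : ℝ} {w p₀ : ℝ → ℝ} {k : ℝ → ℝ → ℝ} (hw : Measurable w)
    (hp : Measurable p₀) (hk : Measurable (Function.uncurry k)) (σ : ℝ) :
    Measurable (Function.uncurry (charRep R₀ w p₀ k σ)) := by
  refine (hw.comp measurable_fst).inv.mul (Measurable.add ?_ ?_)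
  · exact (hp.comp (by fun_prop : Measurable fun z : ℝ × ℝ => z.2 - σ * (z.1 - R₀))).const_mul _
  · have e : (fun z : ℝ × ℝ => ∫ r in Ioc R₀ z.1, k r (z.2 - σ * (z.1 - r))) =
        fun z : ℝ × ℝ => ∫ r, {q : (ℝ × ℝ) × ℝ | R₀ < q.2 ∧ q.2 ≤ q.1.1}.indicator
          (fun q => k q.2 (q.1.2 - σ * (q.1.1 - q.2))) (z, r) := by
      ext z
      rw [← integral_indicator measurableSet_Ioc]
      rfl
    change Measurable fun z : ℝ × ℝ => ∫ r in Ioc R₀ z.1, k r (z.2 - σ * (z.1 - r))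
    rw [e]
    have hm : Measurable ({q : (ℝ × ℝ) × ℝ | R₀ < q.2 ∧ q.2 ≤ q.1.1}.indicator
          (fun q => k q.2 (q.1.2 - σ * (q.1.1 - q.2)))) := by
      refine Measurable.indicator ?_ ?_
      · exact hk.comp (by fun_prop : Measurable fun q : (ℝ × ℝ) × ℝ =>
          (q.2, q.1.2 - σ * (q.1.1 - q.2)))
      · exact (measurableSet_lt measurable_const measurable_snd).inter
          (measurableSet_le measurable_snd (measurable_fst.comp measurable_fst))
    exact (hm.stronglyMeasurable.integral_prod_right' (ν := volume)).measurable

theorem charRep_translate (R₀ : ℝ) (w p₀ : ℝ → ℝ) (k : ℝ → ℝ → ℝ) (σ R θ t : ℝ) :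
    charRep R₀ w p₀ k σ R (θ + t) =
      charRep R₀ w (fun θ => p₀ (θ + t)) (fun r θ => k r (θ + t)) σ R θ := by
  have e : ∀ r, θ + t - σ * (R - r) = θ - σ * (R - r) + t := fun r => by ring
  simp only [charRep, e]

/-- Admissible data for the representation `charRep` of the solution of a transport equation. -/
structure IsCharData (R₀ : ℝ) (p : ℝ → ℝ) (k : ℝ → ℝ → ℝ) : Prop where
  measurable_p : Measurable p
  periodic_p : Function.Periodic p (2 * Real.pi)
  integrable_p : Integrable p circleMeasure
  measurable_k : Measurable (Function.uncurry k)
  periodic_k : ∀ r, R₀ ≤ r → Function.Periodic (k r) (2 * Real.pi)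
  integrable_k : ∀ R₁, Integrable (Function.uncurry k) (slab R₀ R₁)

theorem IsCharData.zero (R₀ : ℝ) : IsCharData R₀ (fun _ => 0) (fun _ _ => 0) :=
  ⟨measurable_const, fun _ => rfl, integrable_zero _ _ _, measurable_const, fun _ _ _ => rfl,
    fun _ => integrable_zero _ _ _⟩

theorem IsCharData.translate {R₀ : ℝ} {p : ℝ → ℝ} {k : ℝ → ℝ → ℝ} (h : IsCharData R₀ p k)
    (t : ℝ) : IsCharData R₀ (fun θ => p (θ + t)) (fun r θ => k r (θ + t)) := by
  refine ⟨h.measurable_p.comp (measurable_add_const t), ?_, ?_, ?_, ?_, fun R₁ => ?_⟩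
  · intro θ
    have : θ + 2 * Real.pi + t = θ + t + 2 * Real.pi := by ring
    simp only [this, h.periodic_p _]
  · have := intervalIntegrable_of_circle h.periodic_p h.integrable_p (0 + t) (2 * Real.pi + t)
    rw [integrable_circle_iff]
    simpa using this.comp_add_right t
  · exact h.measurable_k.comp (by fun_prop : Measurable fun z : ℝ × ℝ => (z.1, z.2 + t))
  · intro r hr θ
    have : θ + 2 * Real.pi + t = θ + t + 2 * Real.pi := by ring
    simp only [this, h.periodic_k r hr _]
  · exact integrable_slab_shift h.measurable_k h.periodic_k (h.integrable_k R₁)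
      (measurable_const (a := t))

theorem IsWaveField.isCharData {R₀ : ℝ} {w w' : ℝ → ℝ} {f : ℝ → ℝ → ℝ} {f' : Partials}
    {H : ℝ → ℝ → ℝ} (h : IsWaveField R₀ w w' f f' H) (σ : ℝ) :
    IsCharData R₀ (nullDeriv f' σ R₀) (charSource w' f' H σ) :=
  ⟨(measurable_slice h.field.measurable_R _).sub
    ((measurable_slice h.field.measurable_θ _).const_mul σ),
    IsWaveField.periodic_nullDeriv h.field le_rfl, IsWaveField.integrable_nullDeriv h.field le_rfl,
    h.measurable_charSource, fun _ hr => h.periodic_charSource hr, h.integrable_charSource⟩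

/-- Continuity of translations in `θ` in `L¹` of a slab. -/
theorem tendsto_lintegral_slab_translate {R₀ R₁ : ℝ} {k : ℝ → ℝ → ℝ}
    (hk : Measurable (Function.uncurry k))
    (hp : ∀ r, R₀ < r → Function.Periodic (k r) (2 * Real.pi))
    (hi : Integrable (Function.uncurry k) (slab R₀ R₁)) :
    Tendsto (fun t => ∫⁻ z, ‖k z.1 (z.2 + t) - k z.1 z.2‖ₑ ∂slab R₀ R₁) (𝓝 0) (𝓝 0) := by
  set S : Set (ℝ × ℝ) := Ioc R₀ R₁ ×ˢ
      Ioc (-(2 * Real.pi)) (-(2 * Real.pi) + (3 : ℕ) * (2 * Real.pi))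
    with hS
  have hSm : MeasurableSet S := measurableSet_Ioc.prod measurableSet_Ioc
  have hK : Integrable (S.indicator (Function.uncurry k)) volume := by
    rw [integrable_indicator_iff hSm]
    refine ⟨hk.aestronglyMeasurable, ?_⟩
    have h1 := hi.2
    rw [HasFiniteIntegral, lintegral_slab hk.enorm.aemeasurable] at h1
    rw [HasFiniteIntegral, hS, Measure.volume_eq_prod, ← Measure.prod_restrict,
      lintegral_prod _ hk.enorm.aemeasurable]
    refine lt_of_le_of_lt (setLIntegral_mono' measurableSet_Ioc fun r hr =>
      lintegral_periodic_le (g := fun θ => ‖k r θ‖ₑ) two_pi_pos'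
      (fun θ => by simp only [hp r hr.1 θ]) _ 3) ?_
    rw [lintegral_const_mul' _ _ (by simp), ← circleMeasure_eq]
    exact ENNReal.mul_lt_top (by simp) h1
  have h1 := tendsto_lintegral_translate_sub volume hK
  have h2 : Tendsto (fun t : ℝ => ((0 : ℝ), t)) (𝓝 0) (𝓝 0) := by
    have : Continuous fun t : ℝ => ((0 : ℝ), t) := by fun_prop
    exact this.tendsto 0
  refine tendsto_of_tendsto_of_tendsto_of_le_of_le' tendsto_const_nhds (h1.comp h2)
    (Eventually.of_forall fun _ => zero_le) ?_
  filter_upwards [Metric.ball_mem_nhds (0 : ℝ) zero_lt_one] with t ht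
  rw [Metric.mem_ball, dist_zero_right, Real.norm_eq_abs, abs_lt] at ht
  have hsl : slab R₀ R₁ = volume.restrict (Ioc R₀ R₁ ×ˢ Ioc 0 (2 * Real.pi)) := by
    rw [slab, circleMeasure_eq, Measure.prod_restrict, Measure.volume_eq_prod]
  rw [hsl]
  refine (setLIntegral_mono' (measurableSet_Ioc.prod measurableSet_Ioc) ?_).trans
    (setLIntegral_le_lintegral _ _)
  rintro ⟨r, θ⟩ ⟨hr, hθ⟩
  have hpi := Real.pi_gt_three
  have m1 : (r, θ) ∈ S := ⟨hr, by simp only [mem_Ioc] at hθ ⊢; push_cast; constructor <;> linarith⟩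
  have m2 : ((0 : ℝ), t) + (r, θ) ∈ S := by
    refine ⟨by simpa using hr, ?_⟩
    simp only [mem_Ioc, Prod.snd_add] at hθ ⊢
    push_cast
    constructor <;> linarith
  rw [Set.indicator_of_mem m1, Set.indicator_of_mem m2]
  simp [Function.uncurry, add_comm]

theorem tendsto_lintegral_circle_translate {p : ℝ → ℝ} (hm : Measurable p)
    (hp : Function.Periodic p (2 * Real.pi)) (hi : Integrable p circleMeasure) :
    Tendsto (fun t => ∫⁻ θ, ‖p (θ + t) - p θ‖ₑ ∂circleMeasure) (𝓝 0) (𝓝 0) := by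
  have h0 : volume.restrict (Ioc (0 : ℝ) 1) univ = 1 := by simp
  have hm' : Measurable (Function.uncurry fun _ : ℝ => p) := hm.comp measurable_snd
  have h1 := tendsto_lintegral_slab_translate (R₀ := 0) (R₁ := 1) hm' (fun _ _ => hp) (by
    refine ⟨hm'.aestronglyMeasurable, ?_⟩
    rw [HasFiniteIntegral, lintegral_slab hm'.enorm.aemeasurable]
    simp only [Function.uncurry]
    rw [lintegral_const, h0, mul_one]
    exact hi.2)
  refine h1.congr fun t => ?_
  rw [lintegral_slab]
  · simp only
    rw [lintegral_const, h0, mul_one]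
  · exact (((hm.comp (measurable_add_const t)).comp measurable_snd).sub
      (hm.comp measurable_snd)).enorm.aemeasurable

namespace IsTransversal

variable {R₀ s₀ s₁ : ℝ} {x y : ℝ → ℝ}

/-- Transversality bounds integrals along the curve of functions on a slice, and of functions
on a slab integrated along characteristics, by the integrals over the slice and the slab. -/
theorem exists_lintegral_slab_le (h : IsTransversal R₀ s₀ s₁ x y) :
    ∃ C : ENNReal, C ≠ ⊤ ∧ ∀ σ : ℝ, σ * σ = 1 → ∀ R₁ : ℝ,
      (∀ g : ℝ → ENNReal, Measurable g → Function.Periodic g (2 * Real.pi) →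
        ∫⁻ s in Ioo s₀ s₁, g (y s - σ * (x s - R₀)) ≤ C * ∫⁻ θ, g θ ∂circleMeasure) ∧
      (∀ g : ℝ → ℝ → ENNReal, Measurable (Function.uncurry g) →
        (∀ r, R₀ ≤ r → Function.Periodic (g r) (2 * Real.pi)) →
        ∫⁻ s in Ioo s₀ s₁, ∫⁻ r in Ioc R₀ R₁, g r (y s - σ * (x s - r)) ≤
          C * ∫⁻ z, g z.1 z.2 ∂slab R₀ R₁) := by
  obtain ⟨C, hC, hb⟩ := h.exists_lintegral_le
  have e : ∀ σ s r, y s - σ * (x s - r) = y s - σ * x s + σ * r := fun σ s r => by ring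
  refine ⟨C, hC, fun σ hσ R₁ => ⟨fun g hg hp => ?_, fun g hg hp => ?_⟩⟩
  · simp only [e]
    exact hb σ hσ g hg hp _
  · simp only [e]
    have hcx := h.continuous_x
    have hcy := h.continuous_y
    rw [lintegral_lintegral_swap]
    · rw [lintegral_slab (g := fun z => g z.1 z.2) hg.aemeasurable, ← lintegral_const_mul' _ _ hC]
      refine setLIntegral_mono' measurableSet_Ioc fun r hr => ?_
      exact hb σ hσ (g r) (hg.comp measurable_prodMk_left) (hp r hr.1.le) _
    · have : Measurable fun z : ℝ × ℝ => (z.2, y z.1 - σ * x z.1 + σ * z.2) :=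
        (by fun_prop : Continuous fun z : ℝ × ℝ => (z.2, y z.1 - σ * x z.1 + σ * z.2)).measurable
      exact (hg.comp this).aemeasurable

/-- The trace on a transversal curve of the solution of a transport equation depends continuously,
in `L¹`, on the data of the equation. -/
theorem exists_trace_dist_le (h : IsTransversal R₀ s₀ s₁ x y) {w : ℝ → ℝ}
    (hw : ContinuousOn w (Ici R₀)) (hw0 : ∀ r, R₀ ≤ r → 0 < w r) :
    ∃ C : ENNReal, ∃ R₁ : ℝ, C ≠ ⊤ ∧ R₀ ≤ R₁ ∧ ∀ σ : ℝ, σ * σ = 1 → ∀ p p' k k',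
      IsCharData R₀ p k → IsCharData R₀ p' k' →
      ∫⁻ s in Ioo s₀ s₁, ‖charRep R₀ w p k σ (x s) (y s) - charRep R₀ w p' k' σ (x s) (y s)‖ₑ ≤
        C * (∫⁻ θ, ‖p θ - p' θ‖ₑ ∂circleMeasure +
          ∫⁻ z, ‖k z.1 z.2 - k' z.1 z.2‖ₑ ∂slab R₀ R₁) := by
  obtain ⟨C, hC, hb⟩ := h.exists_lintegral_slab_le
  obtain ⟨M, hM, hxy⟩ := h.exists_bound
  have hR₁ : R₀ ≤ M := (h.mem s₀ (left_mem_Icc.2 h.lt.le)).trans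
    ((le_abs_self _).trans (hxy s₀ (left_mem_Icc.2 h.lt.le)).1)
  have hwc : ContinuousOn (fun r => (w r)⁻¹) (Icc R₀ M) :=
    (hw.mono fun r hr => hr.1).inv₀ fun r hr => (hw0 r hr.1).ne'
  obtain ⟨B, hB⟩ := isCompact_Icc.exists_bound_of_continuousOn hwc
  refine ⟨‖B‖ₑ * ((1 + ‖w R₀‖ₑ) * C), M, by finiteness, hR₁, ?_⟩
  intro σ hσ p p' k k' hd hd'
  obtain ⟨hb1, hb2⟩ := hb σ hσ M
  have hint : ∀ {p k}, IsCharData R₀ p k → ∀ᵐ s ∂(volume.restrict (Ioo s₀ s₁)),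
      IntegrableOn (fun r => k r (y s - σ * (x s - r))) (Ioc R₀ M) := by
    intro p k hd
    have h1 : ∫⁻ s in Ioo s₀ s₁, ∫⁻ r in Ioc R₀ M, ‖k r (y s - σ * (x s - r))‖ₑ ≠ ⊤ := by
      refine ((hb2 (fun r θ => ‖k r θ‖ₑ) hd.measurable_k.enorm
        (fun r hr θ => by simp only [hd.periodic_k r hr θ])).trans_lt ?_).ne
      exact ENNReal.mul_lt_top hC.lt_top (hd.integrable_k M).2
    have hcx := h.continuous_x
    have hcy := h.continuous_y
    have hm : Measurable fun z : ℝ × ℝ => ‖k z.2 (y z.1 - σ * (x z.1 - z.2))‖ₑ :=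
      (hd.measurable_k.comp (by fun_prop : Continuous fun z : ℝ × ℝ =>
        (z.2, y z.1 - σ * (x z.1 - z.2))).measurable).enorm
    have hm2 : Measurable fun s => ∫⁻ r in Ioc R₀ M, ‖k r (y s - σ * (x s - r))‖ₑ :=
      hm.lintegral_prod_right'
    filter_upwards [ae_lt_top hm2 h1] with s hs
    refine ⟨?_, hs⟩
    exact (hd.measurable_k.comp (by fun_prop : Measurable fun r : ℝ =>
      (r, y s - σ * (x s - r)))).aestronglyMeasurable
  have hpt : ∀ᵐ s ∂(volume.restrict (Ioo s₀ s₁)),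
      ‖charRep R₀ w p k σ (x s) (y s) - charRep R₀ w p' k' σ (x s) (y s)‖ₑ ≤
      ‖B‖ₑ * ((1 + ‖w R₀‖ₑ) * (‖p (y s - σ * (x s - R₀)) - p' (y s - σ * (x s - R₀))‖ₑ +
        ∫⁻ r in Ioc R₀ M, ‖k r (y s - σ * (x s - r)) - k' r (y s - σ * (x s - r))‖ₑ)) := by
    filter_upwards [hint hd, hint hd', ae_restrict_mem measurableSet_Ioo] with s i1 i2 hs
    have hs' := Ioo_subset_Icc_self hs
    have hxM : x s ≤ M := (le_abs_self _).trans (hxy s hs').1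
    have hsub : Ioc R₀ (x s) ⊆ Ioc R₀ M := Ioc_subset_Ioc_right hxM
    have e : charRep R₀ w p k σ (x s) (y s) - charRep R₀ w p' k' σ (x s) (y s) =
        (w (x s))⁻¹ * (w R₀ * (p (y s - σ * (x s - R₀)) - p' (y s - σ * (x s - R₀))) +
        ∫ r in Ioc R₀ (x s), (k r (y s - σ * (x s - r)) - k' r (y s - σ * (x s - r)))) := by
      rw [integral_sub (i1.mono_set hsub) (i2.mono_set hsub)]
      simp only [charRep]
      ring
    rw [e, enorm_mul]
    refine mul_le_mul' ?_ ?_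
    · rw [Real.enorm_eq_ofReal_abs, Real.enorm_eq_ofReal_abs]
      exact ENNReal.ofReal_le_ofReal ((hB _ ⟨h.mem s hs', hxM⟩).trans (le_abs_self _))
    · refine (enorm_add_le _ _).trans ?_
      rw [enorm_mul, mul_add]
      refine add_le_add ?_ ?_
      · gcongr
        exact le_add_self
      · refine (enorm_integral_le_lintegral_enorm _).trans ((lintegral_mono_set hsub).trans ?_)
        refine le_mul_of_one_le_left zero_le le_self_add
  refine (lintegral_mono_ae hpt).trans ?_
  rw [lintegral_const_mul' _ _ (by finiteness), lintegral_const_mul' _ _ (by finiteness), mul_assoc,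
    mul_assoc]
  gcongr
  have hm1 : Measurable fun s => ‖p (y s - σ * (x s - R₀)) - p' (y s - σ * (x s - R₀))‖ₑ := by
    have hcx := h.continuous_x
    have hcy := h.continuous_y
    have : Measurable fun s => y s - σ * (x s - R₀) :=
      (by fun_prop : Continuous fun s => y s - σ * (x s - R₀)).measurable
    exact ((hd.measurable_p.sub hd'.measurable_p).comp this).enorm
  rw [lintegral_add_left hm1, mul_add]
  refine add_le_add ?_ ?_
  · exact hb1 (fun θ => ‖p θ - p' θ‖ₑ) (hd.measurable_p.sub hd'.measurable_p).enorm
      (fun θ => by simp only [hd.periodic_p θ, hd'.periodic_p θ])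
  · exact hb2 (fun r θ => ‖k r θ - k' r θ‖ₑ) (hd.measurable_k.sub hd'.measurable_k).enorm
      (fun r hr θ => by simp only [hd.periodic_k r hr θ, hd'.periodic_k r hr θ])

variable {w p : ℝ → ℝ} {k : ℝ → ℝ → ℝ} {σ : ℝ}

theorem integrable_trace (h : IsTransversal R₀ s₀ s₁ x y) (hwm : Measurable w)
    (hw : ContinuousOn w (Ici R₀)) (hw0 : ∀ r, R₀ ≤ r → 0 < w r) (hσ : σ * σ = 1)
    (hd : IsCharData R₀ p k) :
    Integrable (fun s => charRep R₀ w p k σ (x s) (y s)) (volume.restrict (Ioo s₀ s₁)) := by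
  obtain ⟨C, R₁, hC, hR₁, hb⟩ := h.exists_trace_dist_le hw hw0
  have h1 := hb σ hσ p (fun _ => 0) k (fun _ _ => 0) hd (IsCharData.zero R₀)
  have h0 : ∀ R θ, charRep R₀ w (fun _ => 0) (fun _ _ => 0) σ R θ = 0 := fun R θ => by
    simp [charRep]
  simp only [h0, sub_zero] at h1
  refine ⟨?_, h1.trans_lt ?_⟩
  · exact ((measurable_charRep hwm hd.measurable_p hd.measurable_k σ).comp
      (h.continuous_x.prodMk h.continuous_y).measurable).aestronglyMeasurable
  · exact ENNReal.mul_lt_top hC.lt_top (ENNReal.add_lt_top.2 ⟨hd.integrable_p.2,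
      (hd.integrable_k R₁).2⟩)

/-- The trace on a transversal curve depends continuously, in `L¹`, on translations of the curve
in the direction of `θ`. -/
theorem tendsto_trace_translate (h : IsTransversal R₀ s₀ s₁ x y)
    (hw : ContinuousOn w (Ici R₀)) (hw0 : ∀ r, R₀ ≤ r → 0 < w r) (hσ : σ * σ = 1)
    (hd : IsCharData R₀ p k) :
    Tendsto (fun t => ∫⁻ s in Ioo s₀ s₁, ‖charRep R₀ w p k σ (x s) (y s + t) -
      charRep R₀ w p k σ (x s) (y s)‖ₑ) (𝓝 0) (𝓝 0) := by
  obtain ⟨C, R₁, hC, hR₁, hb⟩ := h.exists_trace_dist_le hw hw0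
  have h1 := tendsto_lintegral_circle_translate hd.measurable_p hd.periodic_p hd.integrable_p
  have h2 := tendsto_lintegral_slab_translate hd.measurable_k (fun r hr => hd.periodic_k r hr.le)
    (hd.integrable_k R₁)
  have h3 := ENNReal.Tendsto.const_mul (a := C) (h1.add h2) (Or.inr hC)
  rw [add_zero, mul_zero] at h3
  refine tendsto_of_tendsto_of_tendsto_of_le_of_le tendsto_const_nhds h3 (fun _ => zero_le)
    fun t => ?_
  simp only [charRep_translate]
  exact hb σ hσ _ _ _ _ (hd.translate t) hd

end IsTransversal

/-! ### Traces on transversal curves -/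

/-- `F` is an everywhere defined representative of the functions `g(R, ·)` whose trace on the curve
`(x, y)` is integrable and depends continuously, in `L¹`, on translations in `θ`. -/
structure IsTraceable (R₀ s₀ s₁ : ℝ) (x y : ℝ → ℝ) (g F : ℝ → ℝ → ℝ) : Prop where
  measurable : Measurable (Function.uncurry F)
  ae_eq : ∀ R, R₀ ≤ R → ∀ᵐ θ, g R θ = F R θ
  integrable : Integrable (fun s => F (x s) (y s)) (volume.restrict (Ioo s₀ s₁))
  translate : Tendsto (fun t => ∫⁻ s in Ioo s₀ s₁, ‖F (x s) (y s + t) - F (x s) (y s)‖ₑ)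
    (𝓝 0) (𝓝 0)

namespace IsTraceable

variable {R₀ s₀ s₁ : ℝ} {x y : ℝ → ℝ} {g F g' F' : ℝ → ℝ → ℝ}

theorem measurable_comp (hF : IsTraceable R₀ s₀ s₁ x y g F) (h : IsTransversal R₀ s₀ s₁ x y)
    (t : ℝ) : Measurable fun s => F (x s) (y s + t) :=
  hF.measurable.comp (h.continuous_x.prodMk (h.continuous_y.add continuous_const)).measurable

theorem measurable_comp₂ (hF : IsTraceable R₀ s₀ s₁ x y g F) (h : IsTransversal R₀ s₀ s₁ x y) :
    Measurable fun z : ℝ × ℝ => F (x z.1) (y z.1 + z.2) :=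
  hF.measurable.comp ((h.continuous_x.comp continuous_fst).prodMk
    ((h.continuous_y.comp continuous_fst).add continuous_snd)).measurable

theorem linearCombination (h : IsTransversal R₀ s₀ s₁ x y) (hF : IsTraceable R₀ s₀ s₁ x y g F)
    (hF' : IsTraceable R₀ s₀ s₁ x y g' F') (a b : ℝ) :
    IsTraceable R₀ s₀ s₁ x y (fun R θ => a * g R θ + b * g' R θ)
      (fun R θ => a * F R θ + b * F' R θ) := by
  refine ⟨(hF.measurable.const_mul a).add (hF'.measurable.const_mul b), ?_,
    (hF.integrable.const_mul a).add (hF'.integrable.const_mul b), ?_⟩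
  · intro R hR
    filter_upwards [hF.ae_eq R hR, hF'.ae_eq R hR] with θ h1 h2
    rw [h1, h2]
  · have h1 := (ENNReal.Tendsto.const_mul (a := ‖a‖ₑ) hF.translate (Or.inr (by simp))).add
      (ENNReal.Tendsto.const_mul (a := ‖b‖ₑ) hF'.translate (Or.inr (by simp)))
    simp only [mul_zero, add_zero] at h1
    refine tendsto_of_tendsto_of_tendsto_of_le_of_le tendsto_const_nhds h1 (fun _ => zero_le)
      fun t => ?_
    have hm : Measurable fun s => ‖F (x s) (y s + t) - F (x s) (y s)‖ₑ := by
      have h2 := hF.measurable_comp h 0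
      simp only [add_zero] at h2
      exact ((hF.measurable_comp h t).sub h2).enorm
    rw [← lintegral_const_mul' _ _ (by simp), ← lintegral_const_mul' _ _ (by simp),
      ← lintegral_add_left (hm.const_mul _)]
    refine lintegral_mono fun s => ?_
    rw [← enorm_mul, ← enorm_mul]
    refine le_trans (le_of_eq ?_) (enorm_add_le _ _)
    congr 1
    ring

theorem tendstoInMeasure (h : IsTransversal R₀ s₀ s₁ x y) (hF : IsTraceable R₀ s₀ s₁ x y g F)
    {t : ℕ → ℝ} (ht : Tendsto t atTop (𝓝 0)) :
    TendstoInMeasure (volume.restrict (Ioo s₀ s₁)) (fun j s => F (x s) (y s + t j)) atTop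
      (fun s => F (x s) (y s)) := by
  have h0 := hF.measurable_comp h 0
  simp only [add_zero] at h0
  refine tendstoInMeasure_of_tendsto_eLpNorm (p := 1) one_ne_zero
    (fun j => (hF.measurable_comp h (t j)).aestronglyMeasurable) h0.aestronglyMeasurable ?_
  refine (hF.translate.comp ht).congr fun j => ?_
  rw [eLpNorm_one_eq_lintegral_enorm]
  rfl

/-- A property which holds on almost all points of every slice holds almost everywhere on
suitable small translations of the curve, along which the traces converge almost everywhere. -/
theorem exists_seq_translate (h : IsTransversal R₀ s₀ s₁ x y)
    (hF : IsTraceable R₀ s₀ s₁ x y g F) (hF' : IsTraceable R₀ s₀ s₁ x y g' F') {G : Set (ℝ × ℝ)}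
    (hG : MeasurableSet G) (hae : ∀ R, R₀ ≤ R → ∀ᵐ θ, (R, θ) ∈ G) :
    ∃ t : ℕ → ℝ, Tendsto t atTop (𝓝 0) ∧ ∀ᵐ s ∂(volume.restrict (Ioo s₀ s₁)),
      (∀ j, (x s, y s + t j) ∈ G) ∧
      Tendsto (fun j => F (x s) (y s + t j)) atTop (𝓝 (F (x s) (y s))) ∧
      Tendsto (fun j => F' (x s) (y s + t j)) atTop (𝓝 (F' (x s) (y s))) := by
  have hcx := h.continuous_x
  have hcy := h.continuous_y
  have hmp : MeasurableSet {z : ℝ × ℝ | (x z.1, y z.1 + z.2) ∈ G} := by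
    have : Measurable fun z : ℝ × ℝ => (x z.1, y z.1 + z.2) :=
      (by fun_prop : Continuous fun z : ℝ × ℝ => (x z.1, y z.1 + z.2)).measurable
    exact this hG
  have h1 : ∀ᵐ t : ℝ, ∀ᵐ s ∂(volume.restrict (Ioo s₀ s₁)), (x s, y s + t) ∈ G := by
    rw [← Measure.ae_ae_comm hmp]
    filter_upwards [ae_restrict_mem measurableSet_Ioo] with s hs
    exact (measurePreserving_add_left volume (y s)).quasiMeasurePreserving.ae
      (hae (x s) (h.mem s (Ioo_subset_Icc_self hs)))
  have h2 : ∀ j : ℕ, ∃ t : ℝ, t ∈ Metric.ball (0 : ℝ) (1 / ((j : ℝ) + 1)) ∧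
      ∀ᵐ s ∂(volume.restrict (Ioo s₀ s₁)), (x s, y s + t) ∈ G := fun j =>
    (Measure.dense_of_ae h1).exists_mem_open Metric.isOpen_ball
      ⟨0, Metric.mem_ball_self (by positivity)⟩ |>.imp fun t ht => ht.symm
  choose t ht hts using h2
  have ht0 : Tendsto t atTop (𝓝 0) := by
    rw [tendsto_iff_dist_tendsto_zero]
    exact squeeze_zero (fun _ => dist_nonneg) (fun j => (Metric.mem_ball.1 (ht j)).le)
      tendsto_one_div_add_atTop_nhds_zero_nat
  obtain ⟨n1, hn1, e1⟩ := (tendstoInMeasure h hF ht0).exists_seq_tendsto_ae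
  obtain ⟨n2, hn2, e2⟩ :=
    (tendstoInMeasure h hF' (ht0.comp hn1.tendsto_atTop)).exists_seq_tendsto_ae
  refine ⟨fun j => t (n1 (n2 j)), ht0.comp (hn1.tendsto_atTop.comp hn2.tendsto_atTop), ?_⟩
  filter_upwards [e1, e2, ae_all_iff.2 hts] with s a1 a2 a3
  exact ⟨fun j => a3 _, a1.comp hn2.tendsto_atTop, a2⟩

/-- The trace of a function which is continuous on slices is the composition with the curve. -/
theorem trace_eq (h : IsTransversal R₀ s₀ s₁ x y) (hF : IsTraceable R₀ s₀ s₁ x y g F)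
    (hg : Measurable (Function.uncurry g)) (hc : ∀ R, R₀ ≤ R → Continuous (g R)) :
    ∀ᵐ s ∂(volume.restrict (Ioo s₀ s₁)), F (x s) (y s) = g (x s) (y s) := by
  obtain ⟨t, ht, hs⟩ := exists_seq_translate h hF hF
    (G := {z | Function.uncurry g z = Function.uncurry F z})
    (measurableSet_eq_fun hg hF.measurable) hF.ae_eq
  filter_upwards [hs, ae_restrict_mem measurableSet_Ioo] with s hs hm
  refine tendsto_nhds_unique hs.2.1 ?_
  have h1 : Tendsto (fun j => y s + t j) atTop (𝓝 (y s)) := by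
    simpa using ht.const_add (y s)
  refine (((hc _ (h.mem s (Ioo_subset_Icc_self hm))).tendsto (y s)).comp h1).congr fun j => ?_
  exact hs.1 j

/-- Quadratic inequalities between functions on slices pass to the traces. -/
theorem trace_sq_le (h : IsTransversal R₀ s₀ s₁ x y) (hF : IsTraceable R₀ s₀ s₁ x y g F)
    (hF' : IsTraceable R₀ s₀ s₁ x y g' F') {m R₁ : ℝ} (hx : ∀ s ∈ Icc s₀ s₁, x s ≤ R₁)
    (hle : ∀ R ∈ Icc R₀ R₁, ∀ᵐ θ, m * g R θ ^ 2 ≤ g' R θ) :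
    ∀ᵐ s ∂(volume.restrict (Ioo s₀ s₁)), m * F (x s) (y s) ^ 2 ≤ F' (x s) (y s) := by
  obtain ⟨t, ht, hs⟩ := exists_seq_translate h hF hF'
    (G := {z | z.1 ≤ R₁ → m * Function.uncurry F z ^ 2 ≤ Function.uncurry F' z})
    (by
      have h1 : MeasurableSet {z : ℝ × ℝ | m * Function.uncurry F z ^ 2 ≤ Function.uncurry F' z} :=
        measurableSet_le ((hF.measurable.pow_const 2).const_mul m) hF'.measurable
      have h2 : MeasurableSet {z : ℝ × ℝ | z.1 ≤ R₁} :=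
        measurableSet_le measurable_fst measurable_const
      exact h2.imp h1)
    (by
      intro R hR
      by_cases hR1 : R ≤ R₁
      · filter_upwards [hF.ae_eq R hR, hF'.ae_eq R hR, hle R ⟨hR, hR1⟩] with θ a1 a2 a3 _
        rw [a1, a2] at a3
        exact a3
      · exact Eventually.of_forall fun θ hh => absurd hh hR1)
  filter_upwards [hs, ae_restrict_mem measurableSet_Ioo] with s hs hm
  exact le_of_tendsto_of_tendsto' ((hs.2.1.pow 2).const_mul m) hs.2.2
    fun j => hs.1 j (hx s (Ioo_subset_Icc_self hm))

/-- Averages over small translations converge to the trace. -/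
theorem tendsto_average (h : IsTransversal R₀ s₀ s₁ x y) (hF : IsTraceable R₀ s₀ s₁ x y g F)
    (hg : ∀ R, R₀ ≤ R → ∀ a b, IntervalIntegrable (g R) volume a b) :
    Tendsto (fun ε : ℝ => ∫⁻ s in Ioo s₀ s₁, ‖ε⁻¹ * (∫ t in (0)..ε, g (x s) (y s + t)) -
      F (x s) (y s)‖ₑ) (𝓝[>] 0) (𝓝 0) := by
  rw [ENNReal.tendsto_nhds_zero]
  intro δ hδ
  obtain ⟨η, hη, hb⟩ := Metric.mem_nhds_iff.1 (ENNReal.tendsto_nhds_zero.1 hF.translate δ hδ)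
  filter_upwards [Ioo_mem_nhdsGT hη] with ε hε
  have hε0 : ε ≠ 0 := hε.1.ne'
  have h0 := hF.measurable_comp h 0
  simp only [add_zero] at h0
  have hpt : ∀ s ∈ Ioo s₀ s₁, ‖ε⁻¹ * (∫ t in (0)..ε, g (x s) (y s + t)) - F (x s) (y s)‖ₑ ≤
      ‖ε⁻¹‖ₑ * ∫⁻ t in Ioc 0 ε, ‖F (x s) (y s + t) - F (x s) (y s)‖ₑ := by
    intro s hs
    have hR := h.mem s (Ioo_subset_Icc_self hs)
    have hae : ∀ᵐ t, g (x s) (y s + t) = F (x s) (y s + t) :=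
      (measurePreserving_add_left volume (y s)).quasiMeasurePreserving.ae (hF.ae_eq _ hR)
    have hi : IntervalIntegrable (fun t => g (x s) (y s + t)) volume 0 ε := by
      have := (hg (x s) hR (0 + y s) (ε + y s)).comp_add_right (y s)
      simpa [add_comm] using this
    have e : ε⁻¹ * (∫ t in (0)..ε, g (x s) (y s + t)) - F (x s) (y s) =
        ε⁻¹ * ∫ t in (0)..ε, (g (x s) (y s + t) - F (x s) (y s)) := by
      rw [intervalIntegral.integral_sub hi (intervalIntegrable_const),
          intervalIntegral.integral_const]
      simp only [sub_zero, smul_eq_mul]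
      field_simp
    rw [e, enorm_mul, intervalIntegral.integral_of_le hε.1.le]
    gcongr
    refine (enorm_integral_le_lintegral_enorm _).trans (le_of_eq (lintegral_congr_ae ?_))
    filter_upwards [ae_restrict_of_ae hae] with t ht
    rw [ht]
  have hm : Measurable fun z : ℝ × ℝ => ‖F (x z.1) (y z.1 + z.2) - F (x z.1) (y z.1)‖ₑ :=
    ((hF.measurable_comp₂ h).sub (h0.comp measurable_fst)).enorm
  calc _ ≤ ∫⁻ s in Ioo s₀ s₁, ‖ε⁻¹‖ₑ * ∫⁻ t in Ioc 0 ε, ‖F (x s) (y s + t) - F (x s) (y s)‖ₑ :=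
        setLIntegral_mono' measurableSet_Ioo hpt
    _ = ‖ε⁻¹‖ₑ * ∫⁻ t in Ioc 0 ε, ∫⁻ s in Ioo s₀ s₁, ‖F (x s) (y s + t) - F (x s) (y s)‖ₑ := by
        rw [lintegral_const_mul' _ _ (by simp), lintegral_lintegral_swap hm.aemeasurable]
    _ ≤ ‖ε⁻¹‖ₑ * ∫⁻ t in Ioc 0 ε, δ := by
        refine mul_le_mul' le_rfl (setLIntegral_mono measurable_const fun t ht => ?_)
        refine hb ?_
        rw [Metric.mem_ball, dist_zero_right, Real.norm_eq_abs, abs_of_pos ht.1]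
        exact ht.2.trans_lt hε.2
    _ = δ := by
        rw [setLIntegral_const, Real.volume_Ioc, sub_zero, mul_comm δ, ← mul_assoc,
          Real.enorm_eq_ofReal_abs, abs_of_pos (inv_pos.2 hε.1),
          ← ENNReal.ofReal_mul (inv_pos.2 hε.1).le, inv_mul_cancel₀ hε0, ENNReal.ofReal_one,
              one_mul]

end IsTraceable

/-! ### The chain rule along transversal curves -/

section Steklov

variable {R₀ : ℝ} {f : ℝ → ℝ → ℝ} {f' : Partials}

/-- The Steklov average of `f` in the variable `θ`. -/
def steklov (ε : ℝ) (f : ℝ → ℝ → ℝ) (R θ : ℝ) : ℝ := ε⁻¹ * ∫ t in (0)..ε, f R (θ + t)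

theorem steklov_eq (ε : ℝ) (f : ℝ → ℝ → ℝ) (R θ : ℝ) :
    steklov ε f R θ = ε⁻¹ * ∫ t in θ..(θ + ε), f R t := by
  rw [steklov, intervalIntegral.integral_comp_add_left, add_zero]

theorem enorm_steklov_le {ε : ℝ} (hε : 0 < ε) (hε' : ε ≤ 2 * Real.pi) {g : ℝ → ℝ}
    (hp : Function.Periodic g (2 * Real.pi)) (θ : ℝ) :
    ‖ε⁻¹ * ∫ t in θ..(θ + ε), g t‖ₑ ≤ ‖ε⁻¹‖ₑ * eLpNorm g 1 circleMeasure := by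
  rw [enorm_mul, eLpNorm_one_eq_lintegral_enorm, circleMeasure_eq,
    intervalIntegral.integral_of_le (by linarith)]
  gcongr
  refine (enorm_integral_le_lintegral_enorm _).trans ?_
  have e := lintegral_periodic_Ioc (g := fun t => ‖g t‖ₑ) two_pi_pos'
    (fun t => by simp only [hp t]) θ 0
  rw [zero_add] at e
  rw [← e]
  exact lintegral_mono_set (Ioc_subset_Ioc_right (by linarith))

namespace IsEnergyField

theorem hasDerivAt_steklov_θ (h : IsEnergyField 1 R₀ f f') {R : ℝ} (hR : R₀ ≤ R) (ε θ : ℝ) :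
    HasDerivAt (steklov ε f R) (steklov ε f'.θ R θ) θ := by
  have e : steklov ε f'.θ R θ = ε⁻¹ * (f R (θ + ε) - f R θ) := by
    rw [steklov_eq, h.sub_eq_integral hR]
  have e2 : steklov ε f R =
      fun θ => ε⁻¹ * ((∫ t in (0)..(θ + ε), f R t) - ∫ t in (0)..θ, f R t) := by
    ext θ
    rw [steklov_eq, intervalIntegral.integral_interval_sub_left
      ((h.continuous R hR).intervalIntegrable _ _) ((h.continuous R hR).intervalIntegrable _ _)]
  rw [e, e2]
  have d1 : ∀ z, HasDerivAt (fun z => ∫ t in (0)..z, f R t) (f R z) z := fun z =>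
    ((h.continuous R hR).integral_hasStrictDerivAt 0 z).hasDerivAt
  have d2 : HasDerivAt (fun θ => ∫ t in (0)..(θ + ε), f R t) (f R (θ + ε)) θ :=
    (d1 (θ + ε)).comp_add_const θ ε
  exact (d2.sub (d1 θ)).const_mul _

theorem hasDerivWithinAt_steklov_R (h : IsEnergyField 1 R₀ f f') {R : ℝ} (hR : R₀ ≤ R) {ε : ℝ}
    (hε : 0 < ε) (hε' : ε ≤ 2 * Real.pi) (θ : ℝ) :
    HasDerivWithinAt (fun r => steklov ε f r θ) (steklov ε f'.R R θ) (Ici R₀) R := by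
  rw [hasDerivWithinAt_iff_tendsto_slope, tendsto_iff_edist_tendsto_0]
  have h1 := ENNReal.Tendsto.const_mul (a := ‖ε⁻¹‖ₑ) (h.deriv_R R hR) (Or.inr (by simp))
  rw [mul_zero] at h1
  refine tendsto_of_tendsto_of_tendsto_of_le_of_le' tendsto_const_nhds h1
    (Eventually.of_forall fun _ => zero_le) ?_
  filter_upwards [self_mem_nhdsWithin] with r hr
  have i1 := (h.continuous r hr.1).intervalIntegrable (μ := volume) θ (θ + ε)
  have i2 := (h.continuous R hR).intervalIntegrable (μ := volume) θ (θ + ε)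
  have i3 := intervalIntegrable_of_circle (h.periodic_R R hR) (h.integrable_R hR) θ (θ + ε)
  have e : slope (fun r => steklov ε f r θ) R r - steklov ε f'.R R θ =
      ε⁻¹ * ∫ t in θ..(θ + ε), ((r - R)⁻¹ * (f r t - f R t) - f'.R R t) := by
    rw [intervalIntegral.integral_sub ((i1.sub i2).const_mul _) i3,
      intervalIntegral.integral_const_mul, intervalIntegral.integral_sub i1 i2, slope_def_field,
      steklov_eq, steklov_eq, steklov_eq]
    ring
  rw [edist_eq_enorm_sub, e]
  refine enorm_steklov_le hε hε' (fun t => ?_) θ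
  simp only [h.periodic r hr.1 t, h.periodic R hR t, h.periodic_R R hR t]

theorem continuousOn_steklov {g : ℝ → ℝ → ℝ}
    (hp : ∀ R, R₀ ≤ R → Function.Periodic (g R) (2 * Real.pi))
    (hi : ∀ R, R₀ ≤ R → Integrable (g R) circleMeasure)
    (hc : ∀ R, R₀ ≤ R → Tendsto (fun r => eLpNorm (fun θ => g r θ - g R θ) 1 circleMeasure)
      (𝓝[Ici R₀] R) (𝓝 0)) {ε : ℝ} (hε : 0 < ε) (hε' : ε ≤ 2 * Real.pi) :
    ContinuousOn (Function.uncurry (steklov ε g)) (halfPlane R₀) := by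
  rintro ⟨R, θ⟩ ⟨hR, -⟩
  have hR' : R₀ ≤ R := hR
  have hfst : Tendsto Prod.fst (𝓝[halfPlane R₀] (R, θ)) (𝓝[Ici R₀] R) := by
    rw [halfPlane, nhdsWithin_prod_eq]
    exact tendsto_fst
  have h1 := ENNReal.Tendsto.const_mul (a := ‖ε⁻¹‖ₑ) (hc R hR') (Or.inr (by simp))
  rw [mul_zero] at h1
  have ii := fun R hR => intervalIntegrable_of_circle (hp R hR) (hi R hR)
  have h2 : Tendsto (fun q : ℝ × ℝ => edist (steklov ε g q.1 q.2) (steklov ε g R q.2))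
      (𝓝[halfPlane R₀] (R, θ)) (𝓝 0) := by
    refine tendsto_of_tendsto_of_tendsto_of_le_of_le' tendsto_const_nhds (h1.comp hfst)
      (Eventually.of_forall fun _ => zero_le) ?_
    filter_upwards [self_mem_nhdsWithin] with q hq
    rw [edist_eq_enorm_sub, steklov_eq, steklov_eq, ← mul_sub,
      ← intervalIntegral.integral_sub (ii _ hq.1 _ _) (ii R hR' _ _)]
    exact enorm_steklov_le hε hε' (fun t => by simp only [hp q.1 hq.1 t, hp R hR' t]) _
  have h3 : Tendsto (fun q : ℝ × ℝ => edist (steklov ε g R q.2) (steklov ε g R θ))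
      (𝓝[halfPlane R₀] (R, θ)) (𝓝 0) := by
    have hcs : Continuous (steklov ε g R) := by
      have e2 : steklov ε g R =
          fun θ => ε⁻¹ * ((∫ t in (0)..(θ + ε), g R t) - ∫ t in (0)..θ, g R t) := by
        ext θ
        rw [steklov_eq, intervalIntegral.integral_interval_sub_left (ii R hR' _ _) (ii R hR' _ _)]
      rw [e2]
      have hpc : Continuous fun z => ∫ t in (0)..z, g R t :=
        intervalIntegral.continuous_primitive (ii R hR') 0
      exact continuous_const.mul ((hpc.comp (continuous_id.add continuous_const)).sub hpc)
    have : Continuous fun q : ℝ × ℝ => edist (steklov ε g R q.2) (steklov ε g R θ) :=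
      (hcs.comp continuous_snd).edist continuous_const
    have h4 := this.tendsto (R, θ)
    simp only [edist_self] at h4
    exact h4.mono_left nhdsWithin_le_nhds
  refine (tendsto_iff_edist_tendsto_0 (f := Function.uncurry (steklov ε g))).2 ?_
  refine tendsto_of_tendsto_of_tendsto_of_le_of_le tendsto_const_nhds (by simpa using h2.add h3)
    (fun _ => zero_le) fun q => ?_
  exact edist_triangle _ _ _

theorem hasFDerivAt_steklov (h : IsEnergyField 1 R₀ f f') {R : ℝ} (hR : R₀ < R) {ε : ℝ}
    (hε : 0 < ε) (hε' : ε ≤ 2 * Real.pi) (θ : ℝ) :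
    HasFDerivAt (Function.uncurry (steklov ε f))
      ((ContinuousLinearMap.toSpanSingleton ℝ (steklov ε f'.R R θ)).coprod
        (ContinuousLinearMap.toSpanSingleton ℝ (steklov ε f'.θ R θ))) (R, θ) := by
  have hn : halfPlane R₀ ∈ 𝓝 (R, θ) := prod_mem_nhds (Ici_mem_nhds hR) univ_mem
  have hn' : ∀ᶠ v : ℝ × ℝ in 𝓝 (R, θ), R₀ < v.1 :=
    (continuous_fst.tendsto (R, θ)).eventually (lt_mem_nhds hR)
  have hsp : Continuous fun c : ℝ => ContinuousLinearMap.toSpanSingleton ℝ c :=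
    (ContinuousLinearMap.toSpanSingletonCLE (𝕜 := ℝ) (E := ℝ)).continuous
  have c1 := (continuousOn_steklov h.periodic_R (fun R hR => h.integrable_R hR) h.continuous_R
    hε hε').continuousAt hn
  have c2 := (continuousOn_steklov h.periodic_θ (fun R hR => h.integrable_θ hR) h.continuous_θ
    hε hε').continuousAt hn
  refine (hasStrictFDerivAt_uncurry_coprod (𝕜 := ℝ) (f := steklov ε f) (u := (R, θ))
    (f₁ := fun R θ => ContinuousLinearMap.toSpanSingleton ℝ (steklov ε f'.R R θ))
    (f₂ := fun R θ => ContinuousLinearMap.toSpanSingleton ℝ (steklov ε f'.θ R θ))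
    ?_ ?_ (hsp.continuousAt.comp c1) (hsp.continuousAt.comp c2)).hasFDerivAt
  · filter_upwards [hn'] with v hv
    exact ((h.hasDerivWithinAt_steklov_R hv.le hε hε' v.2).hasDerivAt (Ici_mem_nhds hv)).hasFDerivAt
  · filter_upwards [hn'] with v hv
    exact (h.hasDerivAt_steklov_θ hv.le ε v.2).hasFDerivAt

end IsEnergyField

end Steklov

theorem tendsto_steklov {f : ℝ → ℝ → ℝ} {R : ℝ} (hf : Continuous (f R)) (θ : ℝ) :
    Tendsto (fun ε => steklov ε f R θ) (𝓝[>] 0) (𝓝 (f R θ)) := by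
  have hc : Continuous fun t => f R (θ + t) := by fun_prop
  have h1 := ((hc.integral_hasStrictDerivAt 0 0).hasDerivAt)
  rw [hasDerivAt_iff_tendsto_slope, add_zero] at h1
  refine (h1.mono_left (nhdsWithin_mono 0 fun z hz => (ne_of_gt hz))).congr fun ε => ?_
  rw [slope_def_field, steklov, intervalIntegral.integral_same]
  simp only [sub_zero]
  ring

namespace IsTransversal

variable {R₀ s₀ s₁ : ℝ} {x y : ℝ → ℝ} {f : ℝ → ℝ → ℝ} {f' : Partials}

theorem exists_deriv_bound (h : IsTransversal R₀ s₀ s₁ x y) :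
    ∃ K : ℝ, 0 ≤ K ∧ ∀ s ∈ Ioo s₀ s₁, |deriv x s| ≤ K ∧ |deriv y s| ≤ K := by
  obtain ⟨K, h1, h2⟩ := h.lipschitz
  exact ⟨K, K.2, fun s hs => ⟨norm_deriv_le_of_lipschitzOn (Icc_mem_nhds hs.1 hs.2) h1,
    norm_deriv_le_of_lipschitzOn (Icc_mem_nhds hs.1 hs.2) h2⟩⟩

theorem ae_differentiableAt (h : IsTransversal R₀ s₀ s₁ x y) :
    ∀ᵐ s, s ∈ Ioo s₀ s₁ → DifferentiableAt ℝ x s ∧ DifferentiableAt ℝ y s := by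
  obtain ⟨K, h1, h2⟩ := h.lipschitz
  have a1 : AbsolutelyContinuousOnInterval x s₀ s₁ :=
    LipschitzOnWith.absolutelyContinuousOnInterval (K := K) (by rwa [uIcc_of_le h.lt.le])
  have a2 : AbsolutelyContinuousOnInterval y s₀ s₁ :=
    LipschitzOnWith.absolutelyContinuousOnInterval (K := K) (by rwa [uIcc_of_le h.lt.le])
  filter_upwards [a1.ae_differentiableAt, a2.ae_differentiableAt] with s b1 b2 hs
  rw [uIcc_of_le h.lt.le] at b1 b2
  exact ⟨b1 (Ioo_subset_Icc_self hs), b2 (Ioo_subset_Icc_self hs)⟩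

/-- The Steklov averages of an energy field are `C¹`, hence obey the chain rule. -/
theorem steklov_sub_eq_integral (h : IsTransversal R₀ s₀ s₁ x y) (hf : IsEnergyField 1 R₀ f f')
    {ε : ℝ} (hε : 0 < ε) (hε' : ε ≤ 2 * Real.pi) {s t : ℝ} (hs : s₀ < s) (hst : s ≤ t)
    (ht : t < s₁) :
    ∫ u in s..t, (steklov ε f'.R (x u) (y u) * deriv x u +
      steklov ε f'.θ (x u) (y u) * deriv y u) =
    steklov ε f (x t) (y t) - steklov ε f (x s) (y s) := by
  have hsub : Icc s t ⊆ Ioo s₀ s₁ := fun u hu => ⟨hs.trans_le hu.1, hu.2.trans_lt ht⟩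
  have hsub' : Icc s t ⊆ Icc s₀ s₁ := hsub.trans Ioo_subset_Icc_self
  obtain ⟨u₀, hu₀, hmin⟩ := isCompact_Icc.exists_isMinOn (nonempty_Icc.2 hst)
    (h.continuous_x.continuousOn (s := Icc s t))
  obtain ⟨M, hM, hb⟩ := h.exists_bound
  have hr₀ := h.interior u₀ (hsub hu₀)
  set Q : Set (ℝ × ℝ) := Icc (x u₀) M ×ˢ Icc (-M) M with hQ
  have hQR : ∀ z ∈ Q, R₀ < z.1 := fun z hz => hr₀.trans_le hz.1.1
  have hcurve : ∀ u ∈ Icc s t, (x u, y u) ∈ Q := fun u hu =>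
    ⟨⟨hmin hu, (abs_le.1 (hb u (hsub' hu)).1).2⟩, abs_le.1 (hb u (hsub' hu)).2⟩
  have hQc : IsCompact Q := isCompact_Icc.prod isCompact_Icc
  have hQs : Q ⊆ halfPlane R₀ := fun z hz => ⟨(hQR z hz).le, mem_univ _⟩
  obtain ⟨B1, hB1⟩ := hQc.exists_bound_of_continuousOn ((IsEnergyField.continuousOn_steklov
    hf.periodic_R (fun R hR => hf.integrable_R hR) hf.continuous_R hε hε').mono hQs)
  obtain ⟨B2, hB2⟩ := hQc.exists_bound_of_continuousOn ((IsEnergyField.continuousOn_steklov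
    hf.periodic_θ (fun R hR => hf.integrable_θ hR) hf.continuous_θ hε hε').mono hQs)
  have hBn : 0 ≤ B1 + B2 := add_nonneg
    ((norm_nonneg _).trans (hB1 (x s, y s) (hcurve s (left_mem_Icc.2 hst))))
    ((norm_nonneg _).trans (hB2 (x s, y s) (hcurve s (left_mem_Icc.2 hst))))
  have hlipQ : LipschitzOnWith (Real.toNNReal (B1 + B2)) (Function.uncurry (steklov ε f)) Q := by
    refine Convex.lipschitzOnWith_of_nnnorm_hasFDerivWithin_le (𝕜 := ℝ)
      (fun z hz => (hf.hasFDerivAt_steklov (hQR z hz) hε hε' z.2).hasFDerivWithinAt) ?_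
      ((convex_Icc _ _).prod (convex_Icc _ _))
    intro z hz
    rw [← NNReal.coe_le_coe, coe_nnnorm, Real.coe_toNNReal _ hBn]
    refine ContinuousLinearMap.opNorm_le_bound _ hBn fun v => ?_
    have b1 := hB1 z hz
    have b2 := hB2 z hz
    simp only [ContinuousLinearMap.coprod_apply, ContinuousLinearMap.toSpanSingleton_apply,
      smul_eq_mul]
    refine (norm_add_le _ _).trans ?_
    rw [norm_mul, norm_mul, add_mul, mul_comm B1, mul_comm B2]
    exact add_le_add (mul_le_mul (norm_fst_le v) b1 (norm_nonneg _) (norm_nonneg _))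
      (mul_le_mul (norm_snd_le v) b2 (norm_nonneg _) (norm_nonneg _))
  obtain ⟨K, k1, k2⟩ := h.lipschitz
  have hlip := hlipQ.comp ((k1.prodMk k2).mono hsub') hcurve
  have hac : AbsolutelyContinuousOnInterval
      (Function.uncurry (steklov ε f) ∘ fun u => (x u, y u)) s t :=
    LipschitzOnWith.absolutelyContinuousOnInterval (by rw [uIcc_of_le hst]; exact hlip)
  have e := hac.integral_deriv_eq_sub
  simp only [Function.comp_apply, Function.uncurry_apply_pair] at e
  rw [← e]
  refine intervalIntegral.integral_congr_ae ?_
  filter_upwards [h.ae_differentiableAt] with u hu hum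
  rw [uIoc_of_le hst] at hum
  have hu' := hsub (Ioc_subset_Icc_self hum)
  obtain ⟨d1, d2⟩ := hu hu'
  have d3 := (hf.hasFDerivAt_steklov (h.interior u hu') hε hε' (y u)).comp_hasDerivAt u
    (d1.hasDerivAt.prodMk d2.hasDerivAt)
  rw [d3.deriv]
  simp only [ContinuousLinearMap.coprod_apply, ContinuousLinearMap.toSpanSingleton_apply,
    smul_eq_mul]
  ring

/-- The chain rule for an energy field along a transversal curve, with the traces of its
derivatives. -/
theorem sub_eq_integral_trace (h : IsTransversal R₀ s₀ s₁ x y) (hf : IsEnergyField 1 R₀ f f')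
    {FR Fθ : ℝ → ℝ → ℝ} (hR : IsTraceable R₀ s₀ s₁ x y f'.R FR)
    (hθ : IsTraceable R₀ s₀ s₁ x y f'.θ Fθ) {s t : ℝ} (hs : s₀ < s) (hst : s ≤ t) (ht : t < s₁) :
    f (x t) (y t) - f (x s) (y s) =
      ∫ u in s..t, (FR (x u) (y u) * deriv x u + Fθ (x u) (y u) * deriv y u) := by
  obtain ⟨K, hK, hd⟩ := h.exists_deriv_bound
  have hsub : Ioc s t ⊆ Ioo s₀ s₁ := fun u hu => ⟨hs.trans hu.1, hu.2.trans_lt ht⟩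
  have hsubc : Icc s t ⊆ Icc s₀ s₁ := Icc_subset_Icc hs.le ht.le
  have hmeas_d : ∀ z : ℝ → ℝ, AEStronglyMeasurable (deriv z) (volume.restrict (Ioc s t)) :=
    fun z => (measurable_deriv z).aestronglyMeasurable
  have hdx : ∀ᵐ u ∂(volume.restrict (Ioc s t)), ‖deriv x u‖ ≤ K :=
    (ae_restrict_mem measurableSet_Ioc).mono fun u hu => (hd u (hsub hu)).1
  have hdy : ∀ᵐ u ∂(volume.restrict (Ioc s t)), ‖deriv y u‖ ≤ K :=
    (ae_restrict_mem measurableSet_Ioc).mono fun u hu => (hd u (hsub hu)).2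
  have iR : IntegrableOn (fun u => FR (x u) (y u) * deriv x u) (Ioc s t) :=
    (IntegrableOn.mono_set hR.integrable hsub).mul_bdd (hmeas_d x) hdx
  have iθ : IntegrableOn (fun u => Fθ (x u) (y u) * deriv y u) (Ioc s t) :=
    (IntegrableOn.mono_set hθ.integrable hsub).mul_bdd (hmeas_d y) hdy
  have hst1 : Tendsto (fun ε => steklov ε f (x t) (y t) - steklov ε f (x s) (y s)) (𝓝[>] 0)
      (𝓝 (f (x t) (y t) - f (x s) (y s))) :=
    (tendsto_steklov (hf.continuous _ (h.mem t ⟨hs.le.trans hst, ht.le⟩)) _).sub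
      (tendsto_steklov (hf.continuous _ (h.mem s ⟨hs.le, hst.trans ht.le⟩)) _)
  have hst2 : Tendsto (fun ε => steklov ε f (x t) (y t) - steklov ε f (x s) (y s)) (𝓝[>] 0)
      (𝓝 (∫ u in s..t, (FR (x u) (y u) * deriv x u + Fθ (x u) (y u) * deriv y u))) := by
    rw [tendsto_iff_edist_tendsto_0]
    have a1 := hR.tendsto_average h
      (fun R hR => intervalIntegrable_of_circle (hf.periodic_R R hR) (hf.integrable_R hR))
    have a2 := hθ.tendsto_average h
      (fun R hR => intervalIntegrable_of_circle (hf.periodic_θ R hR) (hf.integrable_θ hR))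
    have a3 := ENNReal.Tendsto.const_mul (a := ENNReal.ofReal K) (a1.add a2) (Or.inr (by simp))
    rw [add_zero, mul_zero] at a3
    refine tendsto_of_tendsto_of_tendsto_of_le_of_le' tendsto_const_nhds a3
      (Eventually.of_forall fun _ => zero_le) ?_
    filter_upwards [Ioc_mem_nhdsGT two_pi_pos'] with ε hε
    rw [← h.steklov_sub_eq_integral hf hε.1 hε.2 hs hst ht, edist_eq_enorm_sub]
    have hcurve : ∀ g : ℝ → ℝ → ℝ, ContinuousOn (Function.uncurry (steklov ε g)) (halfPlane R₀) →
        ContinuousOn (fun u => steklov ε g (x u) (y u)) (Icc s₀ s₁) := fun g hg =>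
      hg.comp (h.continuous_x.prodMk h.continuous_y).continuousOn
        fun u hu => ⟨h.mem u hu, mem_univ _⟩
    have cR := hcurve _ (IsEnergyField.continuousOn_steklov
      hf.periodic_R (fun R hR => hf.integrable_R hR) hf.continuous_R hε.1 hε.2)
    have cθ := hcurve _ (IsEnergyField.continuousOn_steklov
      hf.periodic_θ (fun R hR => hf.integrable_θ hR) hf.continuous_θ hε.1 hε.2)
    have mR : AEMeasurable (fun u => steklov ε f'.R (x u) (y u)) (volume.restrict (Ioo s₀ s₁)) :=
      (cR.mono Ioo_subset_Icc_self).aemeasurable measurableSet_Ioo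
    have jR : IntegrableOn (fun u => steklov ε f'.R (x u) (y u) * deriv x u) (Ioc s t) :=
      (((cR.integrableOn_compact isCompact_Icc).mono_set
        (Ioc_subset_Icc_self.trans hsubc))).mul_bdd (hmeas_d x) hdx
    have jθ : IntegrableOn (fun u => steklov ε f'.θ (x u) (y u) * deriv y u) (Ioc s t) :=
      (((cθ.integrableOn_compact isCompact_Icc).mono_set
        (Ioc_subset_Icc_self.trans hsubc))).mul_bdd (hmeas_d y) hdy
    have j : IntegrableOn (fun u => steklov ε f'.R (x u) (y u) * deriv x u +
        steklov ε f'.θ (x u) (y u) * deriv y u) (Ioc s t) := jR.add jθ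
    have i : IntegrableOn (fun u => FR (x u) (y u) * deriv x u + Fθ (x u) (y u) * deriv y u)
        (Ioc s t) := iR.add iθ
    rw [intervalIntegral.integral_of_le hst, intervalIntegral.integral_of_le hst,
      ← integral_sub j i]
    refine (enorm_integral_le_lintegral_enorm _).trans ?_
    have hFm := hR.measurable_comp h 0
    simp only [add_zero] at hFm
    have hm1 : AEMeasurable (fun u => ‖steklov ε f'.R (x u) (y u) - FR (x u) (y u)‖ₑ)
        (volume.restrict (Ioo s₀ s₁)) := (mR.sub hFm.aemeasurable).enorm
    change _ ≤ ENNReal.ofReal K * ((∫⁻ u in Ioo s₀ s₁, ‖steklov ε f'.R (x u) (y u) -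
      FR (x u) (y u)‖ₑ) + ∫⁻ u in Ioo s₀ s₁, ‖steklov ε f'.θ (x u) (y u) - Fθ (x u) (y u)‖ₑ)
    rw [← lintegral_add_left' hm1, ← lintegral_const_mul' _ _ (by simp)]
    refine (lintegral_mono_set hsub).trans (setLIntegral_mono' measurableSet_Ioo fun u hu => ?_)
    have b : ∀ z, |z| ≤ K → ‖z‖ₑ ≤ ENNReal.ofReal K := fun z hz => by
      rw [Real.enorm_eq_ofReal_abs]
      exact ENNReal.ofReal_le_ofReal hz
    have e : steklov ε f'.R (x u) (y u) * deriv x u + steklov ε f'.θ (x u) (y u) * deriv y u -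
        (FR (x u) (y u) * deriv x u + Fθ (x u) (y u) * deriv y u) =
        deriv x u * (steklov ε f'.R (x u) (y u) - FR (x u) (y u)) +
        deriv y u * (steklov ε f'.θ (x u) (y u) - Fθ (x u) (y u)) := by ring
    rw [e, mul_add]
    refine (enorm_add_le _ _).trans ?_
    rw [enorm_mul, enorm_mul]
    exact add_le_add (mul_le_mul' (b _ (hd u hu).1) le_rfl) (mul_le_mul' (b _ (hd u hu).2) le_rfl)
  exact tendsto_nhds_unique hst1 hst2

/-- An energy field whose derivatives have traces in `L^p` is of class `W^{1,p}` along the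
curve. -/
theorem memW1 (h : IsTransversal R₀ s₀ s₁ x y) (hf : IsEnergyField 1 R₀ f f')
    {FR Fθ : ℝ → ℝ → ℝ} (hR : IsTraceable R₀ s₀ s₁ x y f'.R FR)
    (hθ : IsTraceable R₀ s₀ s₁ x y f'.θ Fθ) {p : ENNReal}
    (hpR : MemLp (fun s => FR (x s) (y s)) p (intervalMeasure s₀ s₁))
    (hpθ : MemLp (fun s => Fθ (x s) (y s)) p (intervalMeasure s₀ s₁)) :
    MemW1 p s₀ s₁ (fun s => f (x s) (y s)) := by
  obtain ⟨K, hK, hd⟩ := h.exists_deriv_bound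
  have hfc : ContinuousOn (fun s => f (x s) (y s)) (Icc s₀ s₁) :=
    hf.continuousOn.comp (h.continuous_x.prodMk h.continuous_y).continuousOn
      fun u hu => ⟨h.mem u hu, mem_univ _⟩
  set g : ℝ → ℝ := fun u => FR (x u) (y u) * deriv x u + Fθ (x u) (y u) * deriv y u with hg
  have hdb : ∀ z : ℝ → ℝ, (∀ s ∈ Ioo s₀ s₁, |deriv z s| ≤ K) →
      MemLp (deriv z) ⊤ (intervalMeasure s₀ s₁) := fun z hz =>
    memLp_top_of_bound (measurable_deriv z).aestronglyMeasurable K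
      ((ae_restrict_mem measurableSet_Ioo).mono fun u hu => hz u hu)
  have hgp : MemLp g p (intervalMeasure s₀ s₁) :=
    ((hdb x fun s hs => (hd s hs).1).mul' hpR (hpqr := ⟨by simp⟩)).add
      ((hdb y fun s hs => (hd s hs).2).mul' hpθ (hpqr := ⟨by simp⟩))
  have hg1 : IntegrableOn g (Ioo s₀ s₁) := by
    have e1 : MemLp g 1 (intervalMeasure s₀ s₁) :=
      ((hdb x fun s hs => (hd s hs).1).mul' (memLp_one_iff_integrable.2 hR.integrable)
        (hpqr := ⟨by simp⟩)).add
      ((hdb y fun s hs => (hd s hs).2).mul' (memLp_one_iff_integrable.2 hθ.integrable)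
        (hpqr := ⟨by simp⟩))
    exact memLp_one_iff_integrable.1 e1
  refine ⟨?_, g, hgp, ?_⟩
  · obtain ⟨B, hB⟩ := isCompact_Icc.exists_bound_of_continuousOn hfc
    have : IsFiniteMeasure (intervalMeasure s₀ s₁) := by
      unfold intervalMeasure
      infer_instance
    refine MemLp.of_bound ((hfc.mono Ioo_subset_Icc_self).aestronglyMeasurable measurableSet_Ioo)
      B ?_
    exact (ae_restrict_mem measurableSet_Ioo).mono fun u hu => hB u (Ioo_subset_Icc_self hu)
  · intro φ h1 h2 h3
    obtain ⟨α, β, ha, hab, hb, hK⟩ := exists_Icc_of_isCompact_subset_Ioo h.lt h2 h3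
    -- an interval whose end points lie outside of the support of `φ`
    obtain ⟨a, ha1, ha2⟩ := exists_between ha
    obtain ⟨b, hb1, hb2⟩ := exists_between hb
    have hab' : a ≤ b := by linarith
    have hz : ∀ u, u ∉ Ioc a b → φ u = 0 ∧ deriv φ u = 0 := by
      intro u hu
      have hn : u ∉ tsupport φ := fun hh => hu ⟨ha2.trans_le (hK hh).1, (hK hh).2.trans hb1.le⟩
      exact ⟨image_eq_zero_of_notMem_tsupport hn,
        image_eq_zero_of_notMem_tsupport fun hh => hn (tsupport_deriv_subset hh)⟩
    have hφa : φ a = 0 := (hz a fun hh => lt_irrefl _ hh.1).1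
    have hφb : φ b = 0 := image_eq_zero_of_notMem_tsupport fun hh => absurd (hK hh).2 (not_le.2 hb1)
    have hsub : Ioc a b ⊆ Ioo s₀ s₁ := fun u hu => ⟨ha1.trans hu.1, hu.2.trans_lt hb2⟩
    have hgi : IntervalIntegrable g volume a b := by
      rw [intervalIntegrable_iff_integrableOn_Ioc_of_le hab']
      exact hg1.mono_set hsub
    have e1 := integral_deriv_mul_primitive hgi h1 hφa hφb
    have hdc : Continuous (deriv φ) := h1.continuous_deriv (by simp)
    have r1 : ∫ s, f (x s) (y s) * deriv φ s ∂(intervalMeasure s₀ s₁) =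
        ∫ s in a..b, f (x s) (y s) * deriv φ s := by
      rw [intervalMeasure, intervalIntegral.integral_of_le hab']
      refine setIntegral_eq_of_subset_of_forall_sdiff_eq_zero measurableSet_Ioo hsub
        fun u hu => ?_
      rw [(hz u hu.2).2, mul_zero]
    have r2 : ∫ s, g s * φ s ∂(intervalMeasure s₀ s₁) = ∫ s in a..b, φ s * g s := by
      rw [intervalMeasure, intervalIntegral.integral_of_le hab',
        setIntegral_eq_of_subset_of_forall_sdiff_eq_zero measurableSet_Ioo hsub
        fun u hu => by rw [(hz u hu.2).1, mul_zero]]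
      simp only [mul_comm]
    have r3 : ∫ s in a..b, f (x s) (y s) * deriv φ s =
        ∫ s in a..b, (f (x a) (y a) * deriv φ s + deriv φ s * ∫ u in a..s, g u) := by
      refine intervalIntegral.integral_congr fun s hs => ?_
      rw [uIcc_of_le hab'] at hs
      have := h.sub_eq_integral_trace hf hR hθ ha1 hs.1 (hs.2.trans_lt hb2)
      simp only [hg, ← this]
      ring
    have hpc : ContinuousOn (fun s => ∫ u in a..s, g u) (uIcc a b) :=
      (hgi.absolutelyContinuousOnInterval_intervalIntegral (c := a) left_mem_uIcc).continuousOn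
    have j1 : IntervalIntegrable (fun s => f (x a) (y a) * deriv φ s) volume a b :=
      (hdc.intervalIntegrable _ _).const_mul _
    have j2 : IntervalIntegrable (fun s => deriv φ s * ∫ u in a..s, g u) volume a b :=
      (hdc.continuousOn.mul hpc).intervalIntegrable
    rw [r1, r2, r3, intervalIntegral.integral_add j1 j2, e1, intervalIntegral.integral_const_mul,
      intervalIntegral.integral_deriv_eq_sub (fun u _ => h1.differentiable (by simp) u)
      (hdc.intervalIntegrable _ _), hφa, hφb]
    ring

end IsTransversal

/-! ### Traces of solutions of wave equations -/

/-- The representative of `f_R` given by integration along the two families of characteristics. -/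
def waveRepR (R₀ : ℝ) (w w' : ℝ → ℝ) (f' : Partials) (H : ℝ → ℝ → ℝ) (R θ : ℝ) : ℝ :=
  1 / 2 * charRep R₀ w (nullDeriv f' 1 R₀) (charSource w' f' H 1) 1 R θ +
    1 / 2 * charRep R₀ w (nullDeriv f' (-1) R₀) (charSource w' f' H (-1)) (-1) R θ

/-- The representative of `f_θ` given by integration along the two families of characteristics. -/
def waveRepθ (R₀ : ℝ) (w w' : ℝ → ℝ) (f' : Partials) (H : ℝ → ℝ → ℝ) (R θ : ℝ) : ℝ :=
  -(1 / 2) * charRep R₀ w (nullDeriv f' 1 R₀) (charSource w' f' H 1) 1 R θ +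
    1 / 2 * charRep R₀ w (nullDeriv f' (-1) R₀) (charSource w' f' H (-1)) (-1) R θ

namespace IsWaveField

variable {R₀ s₀ s₁ : ℝ} {x y : ℝ → ℝ} {w w' : ℝ → ℝ} {f : ℝ → ℝ → ℝ} {f' : Partials}
  {H : ℝ → ℝ → ℝ}

theorem isTraceable_null (hx : IsTransversal R₀ s₀ s₁ x y) (h : IsWaveField R₀ w w' f f' H)
    {σ : ℝ} (hσ : σ * σ = 1) :
    IsTraceable R₀ s₀ s₁ x y (nullDeriv f' σ)
      (charRep R₀ w (nullDeriv f' σ R₀) (charSource w' f' H σ) σ) := by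
  have hd := h.isCharData σ
  exact ⟨measurable_charRep h.measurable_w hd.measurable_p hd.measurable_k σ,
    fun R hR => h.ae_eq_charRep hσ hR,
    hx.integrable_trace h.measurable_w h.continuousOn_w h.w_pos hσ hd,
    hx.tendsto_trace_translate h.continuousOn_w h.w_pos hσ hd⟩

theorem isTraceable_R (hx : IsTransversal R₀ s₀ s₁ x y) (h : IsWaveField R₀ w w' f f' H) :
    IsTraceable R₀ s₀ s₁ x y f'.R (waveRepR R₀ w w' f' H) := by
  have h1 := IsTraceable.linearCombination hx (h.isTraceable_null hx (σ := 1) (by norm_num))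
    (h.isTraceable_null hx (σ := -1) (by norm_num)) (1 / 2) (1 / 2)
  have e : (fun R θ => 1 / 2 * nullDeriv f' 1 R θ + 1 / 2 * nullDeriv f' (-1) R θ) = f'.R := by
    ext R θ
    simp only [nullDeriv]
    ring
  rw [e] at h1
  exact h1

theorem isTraceable_θ (hx : IsTransversal R₀ s₀ s₁ x y) (h : IsWaveField R₀ w w' f f' H) :
    IsTraceable R₀ s₀ s₁ x y f'.θ (waveRepθ R₀ w w' f' H) := by
  have h1 := IsTraceable.linearCombination hx (h.isTraceable_null hx (σ := 1) (by norm_num))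
    (h.isTraceable_null hx (σ := -1) (by norm_num)) (-(1 / 2)) (1 / 2)
  have e : (fun R θ => -(1 / 2) * nullDeriv f' 1 R θ + 1 / 2 * nullDeriv f' (-1) R θ) = f'.θ := by
    ext R θ
    simp only [nullDeriv]
    ring
  rw [e] at h1
  exact h1

end IsWaveField

/-! ### Uniformly timelike curves are transversal to the characteristics -/

/-- A Lipschitz function whose derivative is at least `κ` almost everywhere grows at rate `κ`. -/
theorem mul_sub_le_of_le_deriv {s₀ s₁ κ : ℝ} {z : ℝ → ℝ} {K : NNReal}
    (hz : LipschitzOnWith K z (Icc s₀ s₁)) (h : ∀ᵐ s ∂(intervalMeasure s₀ s₁), κ ≤ deriv z s)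
    {s t : ℝ} (hs : s₀ ≤ s) (hst : s ≤ t) (ht : t ≤ s₁) : κ * (t - s) ≤ z t - z s := by
  have hac : AbsolutelyContinuousOnInterval z s t := by
    refine (hz.mono ?_).absolutelyContinuousOnInterval
    rw [uIcc_of_le hst]
    exact Icc_subset_Icc hs ht
  have h1 : ∀ᵐ u ∂(volume.restrict (Icc s t)), κ ≤ deriv z u := by
    rw [restrict_Ioo_eq_restrict_Icc.symm]
    exact ae_restrict_of_ae_restrict_of_subset (Ioo_subset_Ioo hs ht) h
  have h2 := intervalIntegral.integral_mono_ae_restrict hst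
    (intervalIntegrable_const (c := κ) (μ := volume)) hac.intervalIntegrable_deriv h1
  rw [hac.integral_deriv_eq_sub, intervalIntegral.integral_const, smul_eq_mul] at h2
  linarith [mul_comm κ (t - s)]

/-- A future-directed timelike vector `(p, q)` of controlled size stays away from the light cone:
here `c` bounds `p² - q²` from below. -/
theorem le_sub_of_le_sq_sub_sq {p q c K : ℝ} (hc : 0 < c) (hp : 0 < p) (hpK : |p| ≤ K)
    (hqK : |q| ≤ K) (h : c ≤ p ^ 2 - q ^ 2) : c / (2 * K) ≤ p - q := by
  have hq : |q| < p := abs_lt_of_sq_lt_sq (by linarith) hp.le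
  obtain ⟨h1, h2⟩ := abs_lt.1 hq
  have h3 := abs_le.1 hpK
  have h4 := abs_le.1 hqK
  rw [div_le_iff₀ (by linarith)]
  nlinarith

/-- On a uniformly timelike Lipschitz curve, `R'² - θ'²` is bounded below. -/
theorem exists_le_sq_sub_sq {R₀ s₀ s₁ : ℝ} {U A η : ℝ → ℝ → ℝ} {ξ : ℝ → Fin 4 → ℝ}
    (hU : ContinuousOn (Function.uncurry U) (Ici R₀ ×ˢ univ))
    (hη : ContinuousOn (Function.uncurry η) (Ici R₀ ×ˢ univ))
    (hξ : IsW1InftyCurve R₀ s₀ s₁ ξ) (htl : IsUniformlyTimelike U A η s₀ s₁ ξ) :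
    ∃ c, 0 < c ∧ ∀ᵐ s ∂(intervalMeasure s₀ s₁), c ≤ deriv ξ s 0 ^ 2 - deriv ξ s 1 ^ 2 := by
  obtain ⟨⟨K, hK⟩, hdom⟩ := hξ
  obtain ⟨C, hC, htl⟩ := htl
  have hcξ : ∀ i, ContinuousOn (fun s => ξ s i) (Icc s₀ s₁) := fun i =>
    (continuous_apply i).comp_continuousOn hK.continuousOn
  have hcurve : ∀ f : ℝ → ℝ → ℝ, ContinuousOn (Function.uncurry f) (Ici R₀ ×ˢ univ) →
      ContinuousOn (fun s => f (ξ s 0) (ξ s 1)) (Icc s₀ s₁) := fun f hf =>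
    hf.comp ((hcξ 0).prodMk (hcξ 1)) fun s hs => ⟨hdom s hs, mem_univ _⟩
  obtain ⟨B, hB⟩ := isCompact_Icc.exists_bound_of_continuousOn
    (((hcurve η hη).sub (hcurve U hU)).const_mul 2).rexp
  refine ⟨C / (|B| + 1), by positivity, ?_⟩
  filter_upwards [htl, ae_restrict_mem measurableSet_Ioo] with s hs hm
  have hBs : ‖Real.exp (2 * (η (ξ s 0) (ξ s 1) - U (ξ s 0) (ξ s 1)))‖ ≤ B :=
    hB s (Ioo_subset_Icc_self hm)
  rw [Real.norm_eq_abs, abs_of_pos (Real.exp_pos _)] at hBs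
  set v := deriv ξ s
  set u := U (ξ s 0) (ξ s 1)
  set a := A (ξ s 0) (ξ s 1)
  set n := η (ξ s 0) (ξ s 1)
  have e : v ⬝ᵥ (metric U A η (ξ s)).mulVec v =
      Real.exp (2 * (n - u)) * (v 1 ^ 2 - v 0 ^ 2) + Real.exp (2 * u) * (v 2 + a * v 3) ^ 2 +
        Real.exp (-2 * u) * (ξ s 0 * v 3) ^ 2 := by
    simp only [metric, dotProduct, Matrix.mulVec, Fin.sum_univ_four, Matrix.of_apply,
      Matrix.cons_val', Matrix.cons_val_zero, Matrix.cons_val_one, Matrix.cons_val]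
    ring
  rw [e] at hs
  have h1 : 0 ≤ Real.exp (2 * u) * (v 2 + a * v 3) ^ 2 := by positivity
  have h2 : 0 ≤ Real.exp (-2 * u) * (ξ s 0 * v 3) ^ 2 := by positivity
  have h3 := Real.exp_pos (2 * (n - u))
  have h4 : C < Real.exp (2 * (n - u)) * (v 0 ^ 2 - v 1 ^ 2) := by linarith
  have h5 : 0 < v 0 ^ 2 - v 1 ^ 2 := pos_of_mul_pos_right (hC.trans h4) h3.le
  rw [div_le_iff₀ (by positivity)]
  have h6 : Real.exp (2 * (n - u)) ≤ |B| + 1 := by linarith [le_abs_self B]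
  nlinarith [mul_le_mul_of_nonneg_right h6 h5.le]

/-- The `(R, θ)`-components of a uniformly timelike, time-oriented Lipschitz curve, extended to
continuous functions on `ℝ`. -/
theorem exists_isTransversal {R₀ s₀ s₁ : ℝ} {U A η : ℝ → ℝ → ℝ} {ξ : ℝ → Fin 4 → ℝ}
    (hU : ContinuousOn (Function.uncurry U) (Ici R₀ ×ˢ univ))
    (hη : ContinuousOn (Function.uncurry η) (Ici R₀ ×ˢ univ)) (hs : s₀ < s₁)
    (hξ : IsW1InftyCurve R₀ s₀ s₁ ξ) (htl : IsUniformlyTimelike U A η s₀ s₁ ξ)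
    (hor : IsTimeOriented s₀ s₁ ξ) :
    ∃ x y : ℝ → ℝ, IsTransversal R₀ s₀ s₁ x y ∧ ∀ s ∈ Icc s₀ s₁, ξ s 0 = x s ∧ ξ s 1 = y s := by
  obtain ⟨c, hc, hcs⟩ := exists_le_sq_sub_sq hU hη hξ htl
  obtain ⟨⟨K, hK⟩, hdom⟩ := hξ
  obtain ⟨τ, hτ, hor⟩ : ∃ τ : ℝ, τ * τ = 1 ∧
      ∀ᵐ s ∂(intervalMeasure s₀ s₁), 0 < τ * deriv ξ s 0 := by
    rcases hor with h | h
    · exact ⟨1, by norm_num, h.mono fun s hs => by simpa using hs⟩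
    · exact ⟨-1, by norm_num, h.mono fun s hs => by simpa using hs⟩
  have hKi : ∀ i, LipschitzOnWith K (fun s => ξ s i) (Icc s₀ s₁) := fun i => by
    refine LipschitzOnWith.of_dist_le_mul fun s hs t ht => ?_
    exact (dist_le_pi_dist (ξ s) (ξ t) i).trans (hK.dist_le_mul s hs t ht)
  have hsq : ∀ σ : ℝ, σ * σ = 1 → ∀ z : ℝ, (σ * z) ^ 2 = z ^ 2 ∧ |σ * z| = |z| := by
    intro σ hσ z
    have h1 : |σ| = 1 := by
      have := abs_mul_abs_self σ
      nlinarith [abs_nonneg σ]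
    exact ⟨by rw [mul_pow, sq σ, hσ, one_mul], by rw [abs_mul, h1, one_mul]⟩
  -- the rate at which the curve crosses both families of characteristics
  set κ := c / (2 * (K + 1)) with hκ
  have hκ0 : 0 < κ := by positivity
  have hder : ∀ σ : ℝ, σ * σ = 1 → ∀ᵐ s ∂(intervalMeasure s₀ s₁),
      κ ≤ deriv (fun s => τ * ξ s 0 - σ * τ * ξ s 1) s := by
    intro σ hσ
    filter_upwards [hcs, hor, ae_restrict_mem measurableSet_Ioo] with s h1 h2 hm
    have hd : DifferentiableAt ℝ ξ s := by
      refine differentiableAt_of_deriv_ne_zero fun h0 => ?_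
      simp [h0] at h2
    have hdi := fun i => (hasDerivAt_pi.1 hd.hasDerivAt) i
    have hdK : ∀ i, |deriv ξ s i| ≤ K + 1 := fun i => by
      have := norm_deriv_le_of_lipschitzOn (Icc_mem_nhds hm.1 hm.2) hK
      have h3 := norm_le_pi_norm (deriv ξ s) i
      rw [Real.norm_eq_abs] at h3
      linarith
    have hd' : HasDerivAt (fun s => τ * ξ s 0 - σ * τ * ξ s 1)
        (τ * deriv ξ s 0 - σ * τ * deriv ξ s 1) s :=
      ((hdi 0).const_mul τ).sub ((hdi 1).const_mul (σ * τ))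
    rw [hd'.deriv]
    have hστ : (σ * τ) * (σ * τ) = 1 := by linear_combination τ * τ * hσ + hτ
    refine le_sub_of_le_sq_sub_sq hc h2 ?_ ?_ ?_
    · rw [(hsq τ hτ _).2]
      exact hdK 0
    · rw [(hsq _ hστ _).2]
      exact hdK 1
    · rw [(hsq τ hτ _).1, (hsq _ hστ _).1]
      exact h1
  have hgrow : ∀ σ : ℝ, σ * σ = 1 → ∀ s t, s₀ ≤ s → s ≤ t → t ≤ s₁ → κ * (t - s) ≤
      (τ * ξ t 0 - σ * τ * ξ t 1) - (τ * ξ s 0 - σ * τ * ξ s 1) := by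
    intro σ hσ s t h1 h2 h3
    refine mul_sub_le_of_le_deriv (K := ‖τ‖₊ * K + ‖σ * τ‖₊ * K)
      (z := fun s => τ * ξ s 0 - σ * τ * ξ s 1) ?_ (hder σ hσ) h1 h2 h3
    have hm : ∀ (m : ℝ) (i), LipschitzOnWith (‖m‖₊ * K) (fun s => m * ξ s i) (Icc s₀ s₁) :=
      fun m i => (lipschitzWith_smul m).comp_lipschitzOnWith (hKi i)
    exact (hm τ 0).sub (hm (σ * τ) 1)
  have hx : ∀ s ∈ Icc s₀ s₁, (projIcc s₀ s₁ hs.le s : ℝ) = s := fun s hm => by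
    rw [projIcc_of_mem hs.le hm]
  have hcont : ∀ i, Continuous fun s => ξ (projIcc s₀ s₁ hs.le s) i := fun i =>
    ((hKi i).continuousOn.domRestrict).comp continuous_projIcc
  refine ⟨fun s => ξ (projIcc s₀ s₁ hs.le s) 0, fun s => ξ (projIcc s₀ s₁ hs.le s) 1,
    ⟨hs, hcont 0, hcont 1, ⟨K, ?_, ?_⟩, ?_, ?_, κ, hκ0, ?_⟩, ?_⟩
  · refine LipschitzOnWith.of_dist_le_mul fun s hm t ht => ?_
    simp only [hx s hm, hx t ht]
    exact (hKi 0).dist_le_mul s hm t ht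
  · refine LipschitzOnWith.of_dist_le_mul fun s hm t ht => ?_
    simp only [hx s hm, hx t ht]
    exact (hKi 1).dist_le_mul s hm t ht
  · intro s hm
    exact hdom _ (Subtype.mem _)
  · intro s hm
    simp only [hx s (Ioo_subset_Icc_self hm)]
    -- `τ R` is strictly increasing along the curve
    have h1 : ∀ a b, s₀ ≤ a → a < b → b ≤ s₁ → 0 < τ * (ξ b 0 - ξ a 0) := by
      intro a b ha hab hb
      have g1 := hgrow 1 (by norm_num) a b ha hab.le hb
      have g2 := hgrow (-1) (by norm_num) a b ha hab.le hb
      nlinarith [mul_pos hκ0 (sub_pos.2 hab)]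
    have h2 := h1 s₀ s le_rfl hm.1 hm.2.le
    have h3 := h1 s s₁ hm.1.le hm.2 le_rfl
    have d0 : R₀ ≤ ξ s₀ 0 := hdom s₀ (left_mem_Icc.2 hs.le)
    have d1 : R₀ ≤ ξ s₁ 0 := hdom s₁ (right_mem_Icc.2 hs.le)
    rcases mul_self_eq_one_iff.1 hτ with rfl | rfl
    · linarith
    · linarith
  · intro σ hσ s hs1 t ht1
    simp only [hx s hs1, hx t ht1]
    wlog hst : s ≤ t generalizing s t
    · rw [abs_sub_comm, abs_sub_comm (ξ s 1 - σ * ξ s 0)]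
      exact this t ht1 s hs1 (le_of_not_ge hst)
    have g := hgrow σ hσ s t hs1.1 hst ht1.2
    rw [abs_sub_comm s t, abs_of_nonneg (sub_nonneg.2 hst)]
    have hστ : (σ * τ) * (σ * τ) = 1 := by linear_combination τ * τ * hσ + hτ
    rw [← (hsq _ hστ _).2]
    refine g.trans (le_trans (le_of_eq ?_) (le_abs_self _))
    linear_combination (τ * ξ s 0 - τ * ξ t 0) * hσ
  · intro s hm
    simp only [hx s hm, and_self]

/-! ### Boundedly convergent and `L¹`-convergent sequences -/

/-- The sequence `c n` converges to `c₀` almost everywhere, with a common bound. -/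
structure TendstoBdd {α : Type*} [MeasurableSpace α] (μ : Measure α) (c : ℕ → α → ℝ)
    (c₀ : α → ℝ) : Prop where
  aesm : ∀ n, AEStronglyMeasurable (c n) μ
  aesm_lim : AEStronglyMeasurable c₀ μ
  bound : ∃ B, (∀ᶠ n in atTop, ∀ᵐ z ∂μ, |c n z| ≤ B) ∧ ∀ᵐ z ∂μ, |c₀ z| ≤ B
  tendsto : ∀ᵐ z ∂μ, Tendsto (fun n => c n z) atTop (𝓝 (c₀ z))

/-- The sequence `f n` converges to `f₀` in `L¹`. -/
structure TendstoL1 {α : Type*} [MeasurableSpace α] (μ : Measure α) (f : ℕ → α → ℝ)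
    (f₀ : α → ℝ) : Prop where
  aesm : ∀ n, AEStronglyMeasurable (f n) μ
  integrable : Integrable f₀ μ
  tendsto : Tendsto (fun n => ∫⁻ z, ‖f n z - f₀ z‖ₑ ∂μ) atTop (𝓝 0)

section Algebra

variable {α : Type*} [MeasurableSpace α] {μ : Measure α} {c d : ℕ → α → ℝ} {c₀ d₀ : α → ℝ}
  {f g : ℕ → α → ℝ} {f₀ g₀ : α → ℝ}

namespace TendstoBdd

theorem const {B : ℝ} (hm : AEStronglyMeasurable c₀ μ) (h : ∀ᵐ z ∂μ, |c₀ z| ≤ B) :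
    TendstoBdd μ (fun _ => c₀) c₀ :=
  ⟨fun _ => hm, hm, ⟨B, Eventually.of_forall fun _ => h, h⟩,
    Eventually.of_forall fun _ => tendsto_const_nhds⟩

theorem num (b : ℝ) : TendstoBdd μ (fun _ _ => b) (fun _ => b) :=
  .const (B := |b|) aestronglyMeasurable_const (Eventually.of_forall fun _ => le_rfl)

theorem mul (hc : TendstoBdd μ c c₀) (hd : TendstoBdd μ d d₀) :
    TendstoBdd μ (fun n z => c n z * d n z) (fun z => c₀ z * d₀ z) := by
  obtain ⟨B, h1, h2⟩ := hc.bound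
  obtain ⟨D, h3, h4⟩ := hd.bound
  have key : ∀ a b : ℝ, |a| ≤ B → |b| ≤ D → |a * b| ≤ B * D := fun a b ha hb => by
    rw [abs_mul]
    exact mul_le_mul ha hb (abs_nonneg _) ((abs_nonneg _).trans ha)
  refine ⟨fun n => (hc.aesm n).mul (hd.aesm n), hc.aesm_lim.mul hd.aesm_lim, ⟨B * D, ?_, ?_⟩, ?_⟩
  · filter_upwards [h1, h3] with n a b
    filter_upwards [a, b] with z a b using key _ _ a b
  · filter_upwards [h2, h4] with z a b using key _ _ a b
  · filter_upwards [hc.tendsto, hd.tendsto] with z a b using a.mul b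

theorem comp {F : ℝ → ℝ} (hF : Continuous F) (hc : TendstoBdd μ c c₀) :
    TendstoBdd μ (fun n z => F (c n z)) (fun z => F (c₀ z)) := by
  obtain ⟨B, h1, h2⟩ := hc.bound
  obtain ⟨D, hD⟩ := (isCompact_Icc (a := -B) (b := B)).exists_bound_of_continuousOn hF.continuousOn
  refine ⟨fun n => hF.comp_aestronglyMeasurable (hc.aesm n),
    hF.comp_aestronglyMeasurable hc.aesm_lim, ⟨D, ?_, ?_⟩, ?_⟩
  · filter_upwards [h1] with n a
    filter_upwards [a] with z a using hD _ (abs_le.1 a)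
  · filter_upwards [h2] with z a using hD _ (abs_le.1 a)
  · filter_upwards [hc.tendsto] with z a using (hF.tendsto _).comp a

end TendstoBdd

namespace TendstoL1

theorem const (h : Integrable f₀ μ) : TendstoL1 μ (fun _ => f₀) f₀ :=
  ⟨fun _ => h.1, h, by simp⟩

theorem add (hf : TendstoL1 μ f f₀) (hg : TendstoL1 μ g g₀) :
    TendstoL1 μ (fun n z => f n z + g n z) (fun z => f₀ z + g₀ z) := by
  refine ⟨fun n => (hf.aesm n).add (hg.aesm n), hf.integrable.add hg.integrable, ?_⟩
  have h := hf.tendsto.add hg.tendsto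
  rw [add_zero] at h
  refine tendsto_of_tendsto_of_tendsto_of_le_of_le tendsto_const_nhds h (fun _ => zero_le)
    fun n => ?_
  have m : AEMeasurable (fun z => ‖f n z - f₀ z‖ₑ) μ := ((hf.aesm n).sub hf.integrable.1).enorm
  rw [← lintegral_add_left' m]
  refine lintegral_mono fun z => ?_
  rw [add_sub_add_comm]
  exact enorm_add_le _ _

/-- The product of a boundedly convergent and an `L¹`-convergent sequence converges in `L¹`. -/
theorem bdd_mul (hc : TendstoBdd μ c c₀) (hf : TendstoL1 μ f f₀) :
    TendstoL1 μ (fun n z => c n z * f n z) (fun z => c₀ z * f₀ z) := by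
  obtain ⟨B, h1, h2⟩ := hc.bound
  refine ⟨fun n => (hc.aesm n).mul (hf.aesm n), hf.integrable.bdd_mul hc.aesm_lim h2, ?_⟩
  have t1 : Tendsto (fun n => ENNReal.ofReal B * ∫⁻ z, ‖f n z - f₀ z‖ₑ ∂μ) atTop (𝓝 0) := by
    simpa using ENNReal.Tendsto.const_mul hf.tendsto (Or.inr (ENNReal.ofReal_ne_top (r := B)))
  have t2 : Tendsto (fun n => ∫⁻ z, ‖(c n z - c₀ z) * f₀ z‖ₑ ∂μ) atTop (𝓝 0) := by
    have hfin : ∫⁻ z, ENNReal.ofReal (2 * B) * ‖f₀ z‖ₑ ∂μ ≠ ⊤ := by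
      rw [lintegral_const_mul' _ _ ENNReal.ofReal_ne_top]
      exact ENNReal.mul_ne_top ENNReal.ofReal_ne_top hf.integrable.2.ne
    have := tendsto_lintegral_filter_of_dominated_convergence' (l := atTop)
      (F := fun n z => ‖(c n z - c₀ z) * f₀ z‖ₑ) (f := fun _ => 0)
      (fun z => ENNReal.ofReal (2 * B) * ‖f₀ z‖ₑ)
      (Eventually.of_forall fun n => (((hc.aesm n).sub hc.aesm_lim).mul hf.integrable.1).enorm)
      (by
        filter_upwards [h1] with n a
        filter_upwards [a, h2] with z a b
        rw [enorm_mul]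
        refine mul_le_mul' ?_ le_rfl
        rw [Real.enorm_eq_ofReal_abs]
        exact ENNReal.ofReal_le_ofReal ((abs_sub _ _).trans (by linarith)))
      hfin
      (by
        filter_upwards [hc.tendsto] with z a
        have a1 : Tendsto (fun n => (c n z - c₀ z) * f₀ z) atTop (𝓝 0) := by
          simpa using (a.sub_const (c₀ z)).mul_const (f₀ z)
        exact tendsto_zero_iff_enorm_tendsto_zero.1 a1)
    simpa using this
  have h := t1.add t2
  rw [add_zero] at h
  refine tendsto_of_tendsto_of_tendsto_of_le_of_le' tendsto_const_nhds h
    (Eventually.of_forall fun _ => zero_le) ?_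
  filter_upwards [h1] with n a
  have m : AEMeasurable (fun z => ENNReal.ofReal B * ‖f n z - f₀ z‖ₑ) μ :=
    ((hf.aesm n).sub hf.integrable.1).enorm.const_mul _
  rw [← lintegral_const_mul' _ _ ENNReal.ofReal_ne_top, ← lintegral_add_left' m]
  refine lintegral_mono_ae ?_
  filter_upwards [a] with z a
  rw [show c n z * f n z - c₀ z * f₀ z = c n z * (f n z - f₀ z) + (c n z - c₀ z) * f₀ z by ring]
  refine (enorm_add_le _ _).trans (add_le_add ?_ le_rfl)
  rw [enorm_mul, Real.enorm_eq_ofReal_abs (c n z)]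
  exact mul_le_mul' (ENNReal.ofReal_le_ofReal a) le_rfl

theorem neg (hf : TendstoL1 μ f f₀) : TendstoL1 μ (fun n z => -f n z) (fun z => -f₀ z) := by
  simpa using bdd_mul (TendstoBdd.num (-1)) hf

theorem sub (hf : TendstoL1 μ f f₀) (hg : TendstoL1 μ g g₀) :
    TendstoL1 μ (fun n z => f n z - g n z) (fun z => f₀ z - g₀ z) := by
  simpa only [sub_eq_add_neg] using hf.add hg.neg

theorem sum {ι : Type*} {s : Finset ι} {f : ι → ℕ → α → ℝ} {f₀ : ι → α → ℝ}
    (h : ∀ i ∈ s, TendstoL1 μ (f i) (f₀ i)) :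
    TendstoL1 μ (fun n z => ∑ i ∈ s, f i n z) (fun z => ∑ i ∈ s, f₀ i z) := by
  classical
  induction s using Finset.induction_on with
  | empty =>
    simp only [Finset.sum_empty]
    exact const (integrable_zero α ℝ μ)
  | insert a s ha ih =>
    simp only [Finset.sum_insert ha]
    exact (h a (Finset.mem_insert_self a s)).add
      (ih fun i hi => h i (Finset.mem_insert_of_mem hi))

theorem congr {g : ℕ → α → ℝ} {g₀ : α → ℝ} (hf : TendstoL1 μ f f₀) (h : ∀ n, f n =ᵐ[μ] g n)
    (h₀ : f₀ =ᵐ[μ] g₀) : TendstoL1 μ g g₀ := by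
  refine ⟨fun n => (hf.aesm n).congr (h n), hf.integrable.congr h₀,
    hf.tendsto.congr fun n => lintegral_congr_ae ?_⟩
  filter_upwards [h n, h₀] with z a b
  rw [a, b]

theorem of_eLpNorm (hf : ∀ n, AEStronglyMeasurable (f n) μ) (hf₀ : Integrable f₀ μ)
    (h : Tendsto (fun n => eLpNorm (fun z => f n z - f₀ z) 1 μ) atTop (𝓝 0)) :
    TendstoL1 μ f f₀ :=
  ⟨hf, hf₀, by simpa only [eLpNorm_one_eq_lintegral_enorm] using h⟩

/-- The product of two `L²`-convergent sequences converges in `L¹`. -/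
theorem of_mul (hf : ∀ n, AEStronglyMeasurable (f n) μ) (hg : ∀ n, AEStronglyMeasurable (g n) μ)
    (hf₀ : MemLp f₀ 2 μ) (hg₀ : MemLp g₀ 2 μ)
    (hft : Tendsto (fun n => eLpNorm (fun z => f n z - f₀ z) 2 μ) atTop (𝓝 0))
    (hgt : Tendsto (fun n => eLpNorm (fun z => g n z - g₀ z) 2 μ) atTop (𝓝 0)) :
    TendstoL1 μ (fun n z => f n z * g n z) (fun z => f₀ z * g₀ z) := by
  refine of_eLpNorm (fun n => (hf n).mul (hg n)) (hf₀.integrable_mul hg₀) ?_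
  have hol : ∀ u v : α → ℝ, AEStronglyMeasurable u μ → AEStronglyMeasurable v μ →
      eLpNorm (fun z => u z * v z) 1 μ ≤ eLpNorm u 2 μ * eLpNorm v 2 μ := fun u v hu hv => by
    have := eLpNorm_smul_le_mul_eLpNorm (p := 2) (q := 2) (r := 1) hv hu
    exact this
  have t := ((ENNReal.Tendsto.mul hft (Or.inr (by simp)) hgt (Or.inr (by simp))).add
    (ENNReal.Tendsto.mul_const (b := eLpNorm g₀ 2 μ) hft (Or.inr hg₀.2.ne))).add
    (ENNReal.Tendsto.const_mul (a := eLpNorm f₀ 2 μ) hgt (Or.inr hf₀.2.ne))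
  simp only [mul_zero, zero_mul, add_zero] at t
  refine tendsto_of_tendsto_of_tendsto_of_le_of_le tendsto_const_nhds t (fun _ => zero_le)
    fun n => ?_
  have m1 := (hf n).sub hf₀.1
  have m2 := (hg n).sub hg₀.1
  have e : (fun z => f n z * g n z - f₀ z * g₀ z) =
      (((fun z => (f n z - f₀ z) * (g n z - g₀ z)) + fun z => (f n z - f₀ z) * g₀ z) +
        fun z => f₀ z * (g n z - g₀ z)) := by
    ext z
    simp only [Pi.add_apply]
    ring
  rw [e]
  refine (eLpNorm_add_le ((m1.mul m2).add (m1.mul hg₀.1)) (hf₀.1.mul m2) le_rfl).trans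
    (add_le_add ((eLpNorm_add_le (m1.mul m2) (m1.mul hg₀.1) le_rfl).trans
      (add_le_add (hol _ _ m1 m2) (hol _ _ m1 hg₀.1))) (hol _ _ hf₀.1 m2))

end TendstoL1

end Algebra

/-! ### Convergence of energy fields -/

/-- The function `f` on `[R₀, ∞) × S¹`, extended to `R < R₀` by its values at `R = R₀`.
The extension of a function continuous on the half cylinder is continuous, hence measurable. -/
def clamp (R₀ : ℝ) (f : ℝ → ℝ → ℝ) (r θ : ℝ) : ℝ := f (max r R₀) θ

theorem clamp_of_le {R₀ r : ℝ} (h : R₀ ≤ r) (f : ℝ → ℝ → ℝ) : clamp R₀ f r = f r := by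
  funext θ
  rw [clamp, max_eq_left h]

theorem continuous_clamp {R₀ : ℝ} {f : ℝ → ℝ → ℝ}
    (h : ContinuousOn (Function.uncurry f) (Ici R₀ ×ˢ univ)) :
    Continuous (Function.uncurry (clamp R₀ f)) := by
  have h1 : Continuous fun z : ℝ × ℝ => (max z.1 R₀, z.2) := by fun_prop
  exact continuousOn_univ.1 (h.comp h1.continuousOn fun z _ => ⟨le_max_right z.1 R₀, mem_univ _⟩)

/-- The energy fields `f n`, with partial derivatives `f' n`, converge to `g` in the norms of
`C([R₀, ∞); W^{1,p}(S¹)) ∩ C¹([R₀, ∞); L^p(S¹))`, uniformly on compact intervals of `R`. -/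
structure EnergyTendsto (p : ENNReal) (R₀ : ℝ) (f : ℕ → ℝ → ℝ → ℝ) (f' : ℕ → Partials)
    (g : ℝ → ℝ → ℝ) (g' : Partials) : Prop where
  field : ∀ n, IsEnergyField p R₀ (f n) (f' n)
  field_lim : IsEnergyField p R₀ g g'
  tendsto : ∀ R₁, R₀ ≤ R₁ → Tendsto (fun n => ⨆ R ∈ Icc R₀ R₁,
      (eLpNorm (fun θ => f n R θ - g R θ) p circleMeasure
        + eLpNorm (fun θ => (f' n).R R θ - g'.R R θ) p circleMeasure
        + eLpNorm (fun θ => (f' n).θ R θ - g'.θ R θ) p circleMeasure)) atTop (𝓝 0)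

namespace EnergyTendsto

variable {p : ENNReal} {R₀ : ℝ} {f : ℕ → ℝ → ℝ → ℝ} {f' : ℕ → Partials}
    {g : ℝ → ℝ → ℝ} {g' : Partials}

theorem const (h : IsEnergyField p R₀ g g') :
    EnergyTendsto p R₀ (fun _ => g) (fun _ => g') g g' := by
  refine ⟨fun _ => h, h, fun R₁ _ => ?_⟩
  simp

/-- Convergence of smooth fields, expressed with any partial derivatives of the limit. -/
theorem of_tendstoEnergy (hp : 1 ≤ p) (hf : ∀ n, IsSmoothField R₀ (f n))
    (hg : IsEnergyField p R₀ g g') (h : TendstoEnergy p R₀ f g) :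
    EnergyTendsto p R₀ f (fun n => cutPartials R₀ (f n)) g g' := by
  obtain ⟨g'', hg'', h⟩ := h
  refine ⟨fun n => (hf n).isEnergyField p, hg, fun R₁ hR₁ => (h R₁ hR₁).congr fun n => ?_⟩
  refine iSup_congr fun R => iSup_congr fun hR => ?_
  obtain ⟨e1, e2⟩ := (hg''.toOne hp).partials_unique (hg.toOne hp) hR.1
  refine congrArg₂ (· + ·) (congrArg₂ (· + ·) rfl ?_) ?_
  · refine eLpNorm_congr_ae ?_
    filter_upwards [e1] with θ h1
    simp only [cutPartials, if_pos hR.1, h1]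
  · refine eLpNorm_congr_ae ?_
    filter_upwards [e2] with θ h1
    simp only [cutPartials, if_pos hR.1, h1]

theorem exists_rate (h : EnergyTendsto p R₀ f f' g g') {R₁ : ℝ} (hR₁ : R₀ ≤ R₁) :
    ∃ ε : ℕ → ENNReal, Tendsto ε atTop (𝓝 0) ∧ ∀ n, ∀ R ∈ Icc R₀ R₁,
      eLpNorm (fun θ => f n R θ - g R θ) p circleMeasure ≤ ε n ∧
      eLpNorm (fun θ => (f' n).R R θ - g'.R R θ) p circleMeasure ≤ ε n ∧
      eLpNorm (fun θ => (f' n).θ R θ - g'.θ R θ) p circleMeasure ≤ ε n := by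
  refine ⟨_, h.tendsto R₁ hR₁, fun n R hR => ?_⟩
  have hle := le_iSup₂ (f := fun R (_ : R ∈ Icc R₀ R₁) =>
    (eLpNorm (fun θ => f n R θ - g R θ) p circleMeasure
        + eLpNorm (fun θ => (f' n).R R θ - g'.R R θ) p circleMeasure
        + eLpNorm (fun θ => (f' n).θ R θ - g'.θ R θ) p circleMeasure)) R hR
  exact ⟨(le_self_add.trans le_self_add).trans hle, (le_add_self.trans le_self_add).trans hle,
    le_add_self.trans hle⟩

theorem toOne (hp : 1 ≤ p) (h : EnergyTendsto p R₀ f f' g g') :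
    EnergyTendsto 1 R₀ f f' g g' := by
  refine ⟨fun n => (h.field n).toOne hp, h.field_lim.toOne hp, fun R₁ hR₁ => ?_⟩
  obtain ⟨ε, hε, hb⟩ := h.exists_rate hR₁
  set D := circleMeasure univ ^ (1 / (1 : ENNReal).toReal - 1 / p.toReal) with hD
  have hDt : D ≠ ⊤ := by
    apply ENNReal.rpow_ne_top_of_ne_zero
    · rw [circleMeasure_eq, Measure.restrict_apply_univ, Real.volume_Ioc]
      simpa using two_pi_pos'
    · exact measure_ne_top _ _
  have t : Tendsto (fun n => ε n * D + ε n * D + ε n * D) atTop (𝓝 0) := by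
    have := ENNReal.Tendsto.mul_const (b := D) hε (Or.inr hDt)
    rw [zero_mul] at this
    simpa using (this.add this).add this
  refine tendsto_of_tendsto_of_tendsto_of_le_of_le tendsto_const_nhds t (fun _ => zero_le)
    fun n => iSup₂_le fun R hR => ?_
  obtain ⟨b1, b2, b3⟩ := hb n R hR
  have key : ∀ u : ℝ → ℝ, AEStronglyMeasurable u circleMeasure →
      eLpNorm u p circleMeasure ≤ ε n → eLpNorm u 1 circleMeasure ≤ ε n * D := fun u hu hle =>
    (eLpNorm_le_eLpNorm_mul_rpow_measure_univ hp hu).trans (mul_le_mul' hle le_rfl)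
  refine add_le_add (add_le_add (key _ ?_ b1) (key _ ?_ b2)) (key _ ?_ b3)
  · exact (((h.field n).continuous R hR.1).sub
      (h.field_lim.continuous R hR.1)).aestronglyMeasurable
  · exact ((h.field n).memLp_R R hR.1).1.sub (h.field_lim.memLp_R R hR.1).1
  · exact ((h.field n).memLp_θ R hR.1).1.sub (h.field_lim.memLp_θ R hR.1).1

theorem tendsto_slab (hp : 1 ≤ p) (ht : p ≠ ⊤) (h : EnergyTendsto p R₀ f f' g g') {R₁ : ℝ}
    (hR₁ : R₀ ≤ R₁) :
    Tendsto (fun n => eLpNorm (fun z => (f' n).R z.1 z.2 - g'.R z.1 z.2) p (slab R₀ R₁))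
      atTop (𝓝 0) ∧
    Tendsto (fun n => eLpNorm (fun z => (f' n).θ z.1 z.2 - g'.θ z.1 z.2) p (slab R₀ R₁))
      atTop (𝓝 0) := by
  obtain ⟨ε, hε, hb⟩ := h.exists_rate hR₁
  have hp0 : p ≠ 0 := (zero_lt_one.trans_le hp).ne'
  have t : Tendsto (fun n => ENNReal.ofReal (R₁ - R₀) ^ (1 / p.toReal) * ε n) atTop (𝓝 0) := by
    simpa using ENNReal.Tendsto.const_mul hε (Or.inr
      (ENNReal.rpow_ne_top_of_nonneg (by positivity) (ENNReal.ofReal_ne_top (r := R₁ - R₀))))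
  constructor
  · refine tendsto_of_tendsto_of_tendsto_of_le_of_le tendsto_const_nhds t (fun _ => zero_le)
      fun n => ?_
    exact eLpNorm_slab_le hp0 ht (g := fun r θ => (f' n).R r θ - g'.R r θ)
      ((h.field n).measurable_R.sub h.field_lim.measurable_R)
      fun r hr => (hb n r (Ioc_subset_Icc_self hr)).2.1
  · refine tendsto_of_tendsto_of_tendsto_of_le_of_le tendsto_const_nhds t (fun _ => zero_le)
      fun n => ?_
    exact eLpNorm_slab_le hp0 ht (g := fun r θ => (f' n).θ r θ - g'.θ r θ)
      ((h.field n).measurable_θ.sub h.field_lim.measurable_θ)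
      fun r hr => (hb n r (Ioc_subset_Icc_self hr)).2.2

/-- Convergence in energy implies locally uniform convergence, by the Sobolev embedding on the
circle. -/
theorem exists_rate_sup (h : EnergyTendsto 1 R₀ f f' g g') {R₁ : ℝ} (hR₁ : R₀ ≤ R₁) :
    ∃ ε : ℕ → ENNReal, Tendsto ε atTop (𝓝 0) ∧ ∀ n, ∀ R ∈ Icc R₀ R₁, ∀ θ,
      ‖f n R θ - g R θ‖ₑ ≤ ε n := by
  obtain ⟨ε, hε, hb⟩ := h.exists_rate hR₁
  refine ⟨fun n => ε n + ε n, by simpa using hε.add hε, fun n R hR θ => ?_⟩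
  obtain ⟨b1, -, b3⟩ := hb n R hR
  exact ((h.field n).enorm_sub_le h.field_lim hR.1 hR.1 θ).trans (add_le_add b1 b3)

/-- Composed with maps into a compact part of `[R₀, ∞) × S¹`, energy convergence gives bounded
convergence. -/
theorem tendstoBdd (h : EnergyTendsto 1 R₀ f f' g g') {α : Type*} [MeasurableSpace α]
    {μ : Measure α} {X Y : α → ℝ} (hX : Measurable X) (hY : Measurable Y) {R₁ : ℝ}
    (hR₁ : R₀ ≤ R₁) (hXR : ∀ᵐ z ∂μ, X z ∈ Icc R₀ R₁) :
    TendstoBdd μ (fun n z => clamp R₀ (f n) (X z) (Y z)) (fun z => clamp R₀ g (X z) (Y z)) := by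
  have hm : ∀ {u : ℝ → ℝ → ℝ} {u' : Partials}, IsEnergyField 1 R₀ u u' →
      AEStronglyMeasurable (fun z => clamp R₀ u (X z) (Y z)) μ := fun {u u'} hu =>
    ((continuous_clamp hu.continuousOn).measurable.comp
      (hX.prodMk hY)).aestronglyMeasurable
  obtain ⟨ε, hε, hb⟩ := h.exists_rate_sup hR₁
  obtain ⟨B, hB⟩ := h.field_lim.exists_bound R₁
  have hdist : ∀ᶠ n in atTop, ∀ R ∈ Icc R₀ R₁, ∀ θ, |f n R θ - g R θ| ≤ 1 := by
    filter_upwards [hε.eventually (gt_mem_nhds zero_lt_one)] with n hn R hR θ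
    have := (hb n R hR θ).trans hn.le
    rw [Real.enorm_eq_ofReal_abs] at this
    simpa using this
  refine ⟨fun n => hm (h.field n), hm h.field_lim, ⟨B + 1, ?_, ?_⟩, ?_⟩
  · filter_upwards [hdist] with n hn
    filter_upwards [hXR] with z hz
    rw [clamp_of_le hz.1]
    have h1 := hn _ hz (Y z)
    have h2 := hB _ hz (Y z)
    have h3 := abs_add_le (f n (X z) (Y z) - g (X z) (Y z)) (g (X z) (Y z))
    rw [sub_add_cancel] at h3
    linarith
  · filter_upwards [hXR] with z hz
    rw [clamp_of_le hz.1]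
    linarith [hB _ hz (Y z)]
  · filter_upwards [hXR] with z hz
    simp only [clamp_of_le hz.1]
    rw [tendsto_iff_edist_tendsto_0]
    refine tendsto_of_tendsto_of_tendsto_of_le_of_le tendsto_const_nhds hε (fun _ => zero_le)
      fun n => ?_
    rw [edist_eq_enorm_sub]
    exact hb n _ hz _

end EnergyTendsto

/-! ### The wave equations for the metric coefficients -/

/-- Energy fields `U, A, η`, with partial derivatives `U', A', η'`, solving the three wave
equations. -/
structure IsWaveData (R₀ : ℝ) (U A η : ℝ → ℝ → ℝ) (U' A' η' : Partials) : Prop where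
  field_U : IsEnergyField 2 R₀ U U'
  field_A : IsEnergyField 2 R₀ A A'
  field_η : IsEnergyField 1 R₀ η η'
  wave : SatisfiesWaveEquations R₀ U U' A' η'

/-- The source in the wave equation for `U`. -/
def sourceU (R₀ : ℝ) (U : ℝ → ℝ → ℝ) (A' : Partials) (r θ : ℝ) : ℝ :=
  2 * r * OmegaU (clamp R₀ U) A' r θ

/-- The source in the wave equation for `A`. -/
def sourceA (R₀ : ℝ) (U : ℝ → ℝ → ℝ) (U' A' : Partials) (r θ : ℝ) : ℝ :=
  Real.exp (-2 * clamp R₀ U r θ) * OmegaA (clamp R₀ U) U' A' r θ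

/-- The source in the wave equation for `η`. -/
def sourceEta (R₀ : ℝ) (U : ℝ → ℝ → ℝ) (U' A' : Partials) (r θ : ℝ) : ℝ :=
  OmegaEta (clamp R₀ U) U' A' r θ

theorem pairing_congr {R₀ : ℝ} {h h' : ℝ → ℝ → ℝ} (e : ∀ r, R₀ < r → h r = h' r)
    (φ : ℝ → ℝ → ℝ) : pairing R₀ h φ = pairing R₀ h' φ :=
  setIntegral_congr_fun measurableSet_Ioi fun r hr => by simp only [e r hr]

theorem waveOp_congr {R₀ : ℝ} {w : ℝ → ℝ} {f' f'' : Partials}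
    (e : ∀ r, R₀ < r → f'.R r = f''.R r ∧ f'.θ r = f''.θ r) (φ : ℝ → ℝ → ℝ) :
    waveOp R₀ w f' φ = waveOp R₀ w f'' φ :=
  setIntegral_congr_fun measurableSet_Ioi fun r hr => by simp only [(e r hr).1, (e r hr).2]

theorem cutPartials_of_le {R₀ : ℝ} (f : ℝ → ℝ → ℝ) {r : ℝ} (hr : R₀ ≤ r) :
    (cutPartials R₀ f).R r = (classicalPartials R₀ f).R r ∧
      (cutPartials R₀ f).θ r = (classicalPartials R₀ f).θ r := by
  constructor <;> funext θ <;> simp [cutPartials, hr]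

theorem IsSmoothSolution.isWaveData {R₀ : ℝ} {U A η : ℝ → ℝ → ℝ} (h : IsSmoothSolution R₀ U A η) :
    IsWaveData R₀ U A η (cutPartials R₀ U) (cutPartials R₀ A) (cutPartials R₀ η) := by
  obtain ⟨hU, hA, hη, h⟩ := h
  have c := fun (f : ℝ → ℝ → ℝ) r (hr : R₀ < r) => cutPartials_of_le f hr.le
  refine ⟨hU.isEnergyField 2, hA.isEnergyField 2, hη.isEnergyField 1, ?_, ?_, ?_⟩
  · intro φ hφ
    rw [waveOp_congr (c U), h.eq_U φ hφ]
    refine pairing_congr (fun r hr => ?_) φ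
    funext θ
    simp only [OmegaU, (c A r hr).1, (c A r hr).2]
  · intro φ hφ
    rw [waveOp_congr (c A), h.eq_A φ hφ]
    refine pairing_congr (fun r hr => ?_) φ
    funext θ
    simp only [OmegaA, (c A r hr).1, (c A r hr).2, (c U r hr).1, (c U r hr).2]
  · intro φ hφ
    rw [waveOp_congr (c η), h.eq_η φ hφ]
    refine pairing_congr (fun r hr => ?_) φ
    funext θ
    simp only [OmegaEta, (c A r hr).1, (c A r hr).2, (c U r hr).1, (c U r hr).2]

section Sources

variable {R₀ : ℝ} {Un An : ℕ → ℝ → ℝ → ℝ} {Un' An' : ℕ → Partials} {U A : ℝ → ℝ → ℝ}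
  {U' A' : Partials}

/-- The null form of two `L²`-convergent sequences of derivatives converges in `L¹`. -/
theorem EnergyTendsto.nullForm (hU : EnergyTendsto 2 R₀ Un Un' U U')
    (hA : EnergyTendsto 2 R₀ An An' A A') {R₁ : ℝ} (hR₁ : R₀ ≤ R₁) :
    TendstoL1 (slab R₀ R₁)
      (fun n z => (Un' n).R z.1 z.2 * (An' n).R z.1 z.2 - (Un' n).θ z.1 z.2 * (An' n).θ z.1 z.2)
      (fun z => U'.R z.1 z.2 * A'.R z.1 z.2 - U'.θ z.1 z.2 * A'.θ z.1 z.2) := by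
  obtain ⟨u1, u2⟩ := hU.tendsto_slab one_le_two (by simp) hR₁
  obtain ⟨a1, a2⟩ := hA.tendsto_slab one_le_two (by simp) hR₁
  exact (TendstoL1.of_mul (fun n => (hU.field n).measurable_R.aestronglyMeasurable)
      (fun n => (hA.field n).measurable_R.aestronglyMeasurable)
      (hU.field_lim.memLp_slab_R one_le_two (by simp) R₁)
      (hA.field_lim.memLp_slab_R one_le_two (by simp) R₁) u1 a1).sub
    (TendstoL1.of_mul (fun n => (hU.field n).measurable_θ.aestronglyMeasurable)
      (fun n => (hA.field n).measurable_θ.aestronglyMeasurable)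
      (hU.field_lim.memLp_slab_θ one_le_two (by simp) R₁)
      (hA.field_lim.memLp_slab_θ one_le_two (by simp) R₁) u2 a2)

/-- A continuous coefficient depending on `R` only is bounded on a slab. -/
theorem tendstoBdd_radial {c : ℝ → ℝ} (hc : ContinuousOn c (Ici R₀)) (R₁ : ℝ)
    (hm : Measurable c) :
    TendstoBdd (slab R₀ R₁) (fun _ z => c z.1) (fun z => c z.1) := by
  obtain ⟨B, hB⟩ := isCompact_Icc.exists_bound_of_continuousOn
    (hc.mono fun r (hr : r ∈ Icc R₀ R₁) => hr.1)
  exact .const (B := B) (hm.comp measurable_fst).aestronglyMeasurable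
    (ae_slab.mono fun z hz => hB _ (Ioc_subset_Icc_self hz))

theorem EnergyTendsto.tendstoBdd_slab (hU : EnergyTendsto 2 R₀ Un Un' U U') {R₁ : ℝ}
    (hR₁ : R₀ ≤ R₁) :
    TendstoBdd (slab R₀ R₁) (fun n z => clamp R₀ (Un n) z.1 z.2)
      (fun z => clamp R₀ U z.1 z.2) :=
  (hU.toOne one_le_two).tendstoBdd measurable_fst measurable_snd hR₁
    (ae_slab.mono fun _ hz => Ioc_subset_Icc_self hz)

theorem continuousOn_inv_pow (hR₀ : 0 < R₀) (k : ℕ) :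
    ContinuousOn (fun r : ℝ => (r ^ k)⁻¹) (Ici R₀) :=
  (continuous_pow k).continuousOn.inv₀ fun _ hr => pow_ne_zero _ (hR₀.trans_le hr).ne'

/-- The coefficient `e^{4U} / (4 R²)` converges boundedly. -/
theorem EnergyTendsto.tendstoBdd_coeff (hR₀ : 0 < R₀) (hU : EnergyTendsto 2 R₀ Un Un' U U')
    {R₁ : ℝ} (hR₁ : R₀ ≤ R₁) :
    TendstoBdd (slab R₀ R₁)
      (fun n z => Real.exp (4 * clamp R₀ (Un n) z.1 z.2) * (1 / 4 * (z.1 ^ 2)⁻¹))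
      (fun z => Real.exp (4 * clamp R₀ U z.1 z.2) * (1 / 4 * (z.1 ^ 2)⁻¹)) :=
  ((hU.tendstoBdd_slab hR₁).comp (F := fun u => Real.exp (4 * u)) (by fun_prop)).mul
    ((TendstoBdd.num (1 / 4)).mul
      (tendstoBdd_radial (continuousOn_inv_pow hR₀ 2) R₁ (by fun_prop)))

theorem tendstoL1_sourceU (hR₀ : 0 < R₀) (hU : EnergyTendsto 2 R₀ Un Un' U U')
    (hA : EnergyTendsto 2 R₀ An An' A A') {R₁ : ℝ} (hR₁ : R₀ ≤ R₁) :
    TendstoL1 (slab R₀ R₁) (fun n => Function.uncurry (sourceU R₀ (Un n) (An' n)))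
      (Function.uncurry (sourceU R₀ U A')) := by
  have e : ∀ (U : ℝ → ℝ → ℝ) (A' : Partials) (z : ℝ × ℝ),
      2 * z.1 * (Real.exp (4 * clamp R₀ U z.1 z.2) * (1 / 4 * (z.1 ^ 2)⁻¹)) *
        (A'.R z.1 z.2 * A'.R z.1 z.2 - A'.θ z.1 z.2 * A'.θ z.1 z.2) =
      Function.uncurry (sourceU R₀ U A') z := fun U A' z => by
    simp only [Function.uncurry, sourceU, OmegaU, div_eq_mul_inv, mul_inv]
    ring
  have hr : TendstoBdd (slab R₀ R₁) (fun _ z => 2 * z.1) (fun z => 2 * z.1) :=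
    tendstoBdd_radial (c := fun r => 2 * r) (by fun_prop) R₁ (by fun_prop)
  exact (TendstoL1.bdd_mul (hr.mul (hU.tendstoBdd_coeff hR₀ hR₁)) (hA.nullForm hA hR₁)).congr
    (fun n => Eventually.of_forall fun z => e _ _ z) (Eventually.of_forall fun z => e _ _ z)

theorem tendstoL1_sourceA (hR₀ : 0 < R₀) (hU : EnergyTendsto 2 R₀ Un Un' U U')
    (hA : EnergyTendsto 2 R₀ An An' A A') {R₁ : ℝ} (hR₁ : R₀ ≤ R₁) :
    TendstoL1 (slab R₀ R₁) (fun n => Function.uncurry (sourceA R₀ (Un n) (Un' n) (An' n)))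
      (Function.uncurry (sourceA R₀ U U' A')) := by
  have e : ∀ (U : ℝ → ℝ → ℝ) (U' A' : Partials) (z : ℝ × ℝ),
      -4 * (z.1 ^ 1)⁻¹ * (U'.R z.1 z.2 * A'.R z.1 z.2 - U'.θ z.1 z.2 * A'.θ z.1 z.2) =
      Function.uncurry (sourceA R₀ U U' A') z := fun U U' A' z => by
    simp only [Function.uncurry, sourceA, OmegaA]
    have h : Real.exp (-2 * clamp R₀ U z.1 z.2) * Real.exp (2 * clamp R₀ U z.1 z.2) = 1 := by
      rw [← Real.exp_add, neg_mul, neg_add_cancel, Real.exp_zero]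
    linear_combination (4 * z.1⁻¹ *
      (U'.R z.1 z.2 * A'.R z.1 z.2 - U'.θ z.1 z.2 * A'.θ z.1 z.2)) * h
  have hr : TendstoBdd (slab R₀ R₁) (fun _ z => -4 * (z.1 ^ 1)⁻¹) (fun z => -4 * (z.1 ^ 1)⁻¹) :=
    (TendstoBdd.num (-4)).mul
      (tendstoBdd_radial (continuousOn_inv_pow hR₀ 1) R₁ (by fun_prop))
  exact (TendstoL1.bdd_mul hr (hU.nullForm hA hR₁)).congr
    (fun n => Eventually.of_forall fun z => e (Un n) _ _ z)
    (Eventually.of_forall fun z => e U _ _ z)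

theorem tendstoL1_sourceEta (hR₀ : 0 < R₀) (hU : EnergyTendsto 2 R₀ Un Un' U U')
    (hA : EnergyTendsto 2 R₀ An An' A A') {R₁ : ℝ} (hR₁ : R₀ ≤ R₁) :
    TendstoL1 (slab R₀ R₁) (fun n => Function.uncurry (sourceEta R₀ (Un n) (Un' n) (An' n)))
      (Function.uncurry (sourceEta R₀ U U' A')) := by
  have e : ∀ (U : ℝ → ℝ → ℝ) (U' A' : Partials) (z : ℝ × ℝ),
      -(U'.R z.1 z.2 * U'.R z.1 z.2 - U'.θ z.1 z.2 * U'.θ z.1 z.2) +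
      Real.exp (4 * clamp R₀ U z.1 z.2) * (1 / 4 * (z.1 ^ 2)⁻¹) *
        (A'.R z.1 z.2 * A'.R z.1 z.2 - A'.θ z.1 z.2 * A'.θ z.1 z.2) =
      Function.uncurry (sourceEta R₀ U U' A') z := fun U U' A' z => by
    simp only [Function.uncurry, sourceEta, OmegaEta, div_eq_mul_inv, mul_inv]
    ring
  exact ((hU.nullForm hU hR₁).neg.add
    (TendstoL1.bdd_mul (hU.tendstoBdd_coeff hR₀ hR₁) (hA.nullForm hA hR₁))).congr
    (fun n => Eventually.of_forall fun z => e _ _ _ z) (Eventually.of_forall fun z => e _ _ _ z)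

end Sources

theorem integrable_slab_of_le {R₀ : ℝ} {H : ℝ × ℝ → ℝ}
    (h : ∀ R₁, R₀ ≤ R₁ → Integrable H (slab R₀ R₁)) (R₁ : ℝ) : Integrable H (slab R₀ R₁) := by
  rcases le_total R₀ R₁ with h1 | h1
  · exact h R₁ h1
  · rw [slab, Ioc_eq_empty (not_lt.2 h1), Measure.restrict_empty, Measure.zero_prod]
    exact integrable_zero_measure

namespace IsWaveData

variable {R₀ : ℝ} {U A η : ℝ → ℝ → ℝ} {U' A' η' : Partials}

theorem isWaveField_U (hR₀ : 0 < R₀) (h : IsWaveData R₀ U A η U' A' η') :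
    IsWaveField R₀ (fun r => r) (fun _ => 1) U U' (sourceU R₀ U A') where
  field := h.field_U.toOne one_le_two
  hasDerivAt_w r _ := hasDerivAt_id r
  continuousOn_w' := continuousOn_const
  measurable_w := measurable_id
  measurable_w' := measurable_const
  w_pos _ hr := hR₀.trans_le hr
  measurable_H := by
    have h1 := (continuous_clamp (h.field_U.toOne one_le_two).continuousOn).measurable
    have h2 := h.field_A.measurable_R
    have h3 := h.field_A.measurable_θ
    unfold sourceU OmegaU Function.uncurry at *
    fun_prop
  periodic_H r hr θ := by
    simp only [sourceU, OmegaU, clamp_of_le hr, h.field_U.periodic r hr θ,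
      h.field_A.periodic_R r hr θ, h.field_A.periodic_θ r hr θ]
  integrable_H := integrable_slab_of_le fun _ hR₁ =>
    (tendstoL1_sourceU hR₀ (.const h.field_U) (.const h.field_A) hR₁).integrable
  eq φ hφ := by
    rw [h.wave.eq_U φ hφ]
    refine pairing_congr (fun r hr => ?_) φ
    funext θ
    simp only [sourceU, OmegaU, clamp_of_le hr.le]

theorem isWaveField_A (hR₀ : 0 < R₀) (h : IsWaveData R₀ U A η U' A' η') :
    IsWaveField R₀ (fun r => r⁻¹) (fun r => -(r ^ 2)⁻¹) A A' (sourceA R₀ U U' A') where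
  field := h.field_A.toOne one_le_two
  hasDerivAt_w r hr := hasDerivAt_inv (hR₀.trans_le hr).ne'
  continuousOn_w' := (continuousOn_inv_pow hR₀ 2).neg
  measurable_w := measurable_inv
  measurable_w' := by fun_prop
  w_pos _ hr := inv_pos.2 (hR₀.trans_le hr)
  measurable_H := by
    have h1 := (continuous_clamp (h.field_U.toOne one_le_two).continuousOn).measurable
    have h2 := h.field_A.measurable_R
    have h3 := h.field_A.measurable_θ
    have h4 := h.field_U.measurable_R
    have h5 := h.field_U.measurable_θ
    unfold sourceA OmegaA Function.uncurry at *
    fun_prop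
  periodic_H r hr θ := by
    simp only [sourceA, OmegaA, clamp_of_le hr, h.field_U.periodic r hr θ,
      h.field_A.periodic_R r hr θ, h.field_A.periodic_θ r hr θ,
      h.field_U.periodic_R r hr θ, h.field_U.periodic_θ r hr θ]
  integrable_H := integrable_slab_of_le fun _ hR₁ =>
    (tendstoL1_sourceA hR₀ (.const h.field_U) (.const h.field_A) hR₁).integrable
  eq φ hφ := by
    rw [h.wave.eq_A φ hφ]
    refine pairing_congr (fun r hr => ?_) φ
    funext θ
    simp only [sourceA, OmegaA, clamp_of_le hr.le]

theorem isWaveField_η (hR₀ : 0 < R₀) (h : IsWaveData R₀ U A η U' A' η') :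
    IsWaveField R₀ (fun _ => 1) (fun _ => 0) η η' (sourceEta R₀ U U' A') where
  field := h.field_η
  hasDerivAt_w r _ := hasDerivAt_const r 1
  continuousOn_w' := continuousOn_const
  measurable_w := measurable_const
  measurable_w' := measurable_const
  w_pos _ _ := one_pos
  measurable_H := by
    have h1 := (continuous_clamp (h.field_U.toOne one_le_two).continuousOn).measurable
    have h2 := h.field_A.measurable_R
    have h3 := h.field_A.measurable_θ
    have h4 := h.field_U.measurable_R
    have h5 := h.field_U.measurable_θ
    unfold sourceEta OmegaEta Function.uncurry at *
    fun_prop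
  periodic_H r hr θ := by
    simp only [sourceEta, OmegaEta, clamp_of_le hr, h.field_U.periodic r hr θ,
      h.field_A.periodic_R r hr θ, h.field_A.periodic_θ r hr θ,
      h.field_U.periodic_R r hr θ, h.field_U.periodic_θ r hr θ]
  integrable_H := integrable_slab_of_le fun _ hR₁ =>
    (tendstoL1_sourceEta hR₀ (.const h.field_U) (.const h.field_A) hR₁).integrable
  eq φ hφ := by
    rw [h.wave.eq_η φ hφ]
    refine pairing_congr (fun r hr => ?_) φ
    funext θ
    simp only [sourceEta, OmegaEta, clamp_of_le hr.le]

end IsWaveData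

/-- Traces on the curve depend continuously on the solution of the wave equation. -/
theorem IsWaveField.tendstoL1_trace {R₀ s₀ s₁ : ℝ} {x y : ℝ → ℝ} {w w' : ℝ → ℝ}
    {f : ℕ → ℝ → ℝ → ℝ} {f' : ℕ → Partials} {H : ℕ → ℝ → ℝ → ℝ} {g : ℝ → ℝ → ℝ} {g' : Partials}
    {K : ℝ → ℝ → ℝ} (hx : IsTransversal R₀ s₀ s₁ x y)
    (hf : ∀ n, IsWaveField R₀ w w' (f n) (f' n) (H n)) (hg : IsWaveField R₀ w w' g g' K)
    (h : EnergyTendsto 1 R₀ f f' g g')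
    (hH : ∀ R₁, R₀ ≤ R₁ → TendstoL1 (slab R₀ R₁) (fun n => Function.uncurry (H n))
      (Function.uncurry K)) :
    TendstoL1 (intervalMeasure s₀ s₁) (fun n s => waveRepR R₀ w w' (f' n) (H n) (x s) (y s))
      (fun s => waveRepR R₀ w w' g' K (x s) (y s)) ∧
    TendstoL1 (intervalMeasure s₀ s₁) (fun n s => waveRepθ R₀ w w' (f' n) (H n) (x s) (y s))
      (fun s => waveRepθ R₀ w w' g' K (x s) (y s)) := by
  obtain ⟨C, R₁, hC, hR₁, hb⟩ := hx.exists_trace_dist_le hg.continuousOn_w hg.w_pos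
  -- convergence of the initial data and of the sources of the transport equations
  have hp : ∀ σ : ℝ, TendstoL1 circleMeasure (fun n => nullDeriv (f' n) σ R₀)
      (nullDeriv g' σ R₀) := by
    intro σ
    obtain ⟨ε, hε, hr⟩ := h.exists_rate (le_refl R₀)
    have tR : TendstoL1 circleMeasure (fun n => (f' n).R R₀) (g'.R R₀) :=
      .of_eLpNorm (fun n => ((h.field n).integrable_R le_rfl).1) (h.field_lim.integrable_R le_rfl)
        (tendsto_of_tendsto_of_tendsto_of_le_of_le tendsto_const_nhds hε (fun _ => zero_le)
          fun n => (hr n R₀ ⟨le_rfl, le_rfl⟩).2.1)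
    have tθ : TendstoL1 circleMeasure (fun n => (f' n).θ R₀) (g'.θ R₀) :=
      .of_eLpNorm (fun n => ((h.field n).integrable_θ le_rfl).1) (h.field_lim.integrable_θ le_rfl)
        (tendsto_of_tendsto_of_tendsto_of_le_of_le tendsto_const_nhds hε (fun _ => zero_le)
          fun n => (hr n R₀ ⟨le_rfl, le_rfl⟩).2.2)
    exact tR.sub (TendstoL1.bdd_mul (TendstoBdd.num σ) tθ)
  have hk : ∀ σ : ℝ, TendstoL1 (slab R₀ R₁)
      (fun n z => charSource w' (f' n) (H n) σ z.1 z.2)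
          (fun z => charSource w' g' K σ z.1 z.2) := by
    intro σ
    have tθ : TendstoL1 (slab R₀ R₁) (fun n z => (f' n).θ z.1 z.2) (fun z => g'.θ z.1 z.2) :=
      .of_eLpNorm (fun n => (h.field n).measurable_θ.aestronglyMeasurable)
        (memLp_one_iff_integrable.1 (h.field_lim.memLp_slab_θ le_rfl (by simp) R₁))
        (h.tendsto_slab le_rfl (by simp) hR₁).2
    exact (hH R₁ hR₁).sub (TendstoL1.bdd_mul ((TendstoBdd.num σ).mul
      (tendstoBdd_radial hg.continuousOn_w' R₁ hg.measurable_w')) tθ)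
  have key : ∀ σ : ℝ, σ * σ = 1 → TendstoL1 (intervalMeasure s₀ s₁)
      (fun n s => charRep R₀ w (nullDeriv (f' n) σ R₀) (charSource w' (f' n) (H n) σ) σ (x s) (y s))
      (fun s => charRep R₀ w (nullDeriv g' σ R₀) (charSource w' g' K σ) σ (x s) (y s)) := by
    intro σ hσ
    refine ⟨fun n => ((hf n).isTraceable_null hx hσ).integrable.1,
      (hg.isTraceable_null hx hσ).integrable, ?_⟩
    have t := ENNReal.Tendsto.const_mul (a := C) ((hp σ).tendsto.add (hk σ).tendsto) (Or.inr hC)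
    rw [add_zero, mul_zero] at t
    exact tendsto_of_tendsto_of_tendsto_of_le_of_le tendsto_const_nhds t (fun _ => zero_le)
      fun n => hb σ hσ _ _ _ _ ((hf n).isCharData σ) (hg.isCharData σ)
  have k1 := key 1 (by norm_num)
  have k2 := key (-1) (by norm_num)
  exact ⟨(TendstoL1.bdd_mul (.num (1 / 2)) k1).add (TendstoL1.bdd_mul (.num (1 / 2)) k2),
    (TendstoL1.bdd_mul (.num (-(1 / 2))) k1).add (TendstoL1.bdd_mul (.num (1 / 2)) k2)⟩

/-- The traces of a smooth solution are the classical derivatives. -/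
theorem IsWaveField.trace_eq {R₀ s₀ s₁ : ℝ} {x y : ℝ → ℝ} {w w' : ℝ → ℝ}
    {f : ℝ → ℝ → ℝ} {f' : Partials} {H : ℝ → ℝ → ℝ} (hx : IsTransversal R₀ s₀ s₁ x y)
    (h : IsWaveField R₀ w w' f f' H) (hf : IsSmoothField R₀ f) :
    ∀ᵐ s ∂(intervalMeasure s₀ s₁),
      waveRepR R₀ w w' f' H (x s) (y s) = (classicalPartials R₀ f).R (x s) (y s) ∧
      waveRepθ R₀ w w' f' H (x s) (y s) = (classicalPartials R₀ f).θ (x s) (y s) := by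
  have hc := hf.isEnergyField 1
  have tR := h.isTraceable_R hx
  have tθ := h.isTraceable_θ hx
  have hae := fun R (hR : R₀ ≤ R) => h.field.partials_unique hc hR
  have tR' : IsTraceable R₀ s₀ s₁ x y (cutPartials R₀ f).R (waveRepR R₀ w w' f' H) := by
    refine ⟨tR.measurable, fun R hR => ?_, tR.integrable, tR.translate⟩
    have := ae_of_ae_circle (p := fun θ => f'.R R θ = (cutPartials R₀ f).R R θ)
      (fun θ => by rw [h.field.periodic_R R hR, hc.periodic_R R hR]) (hae R hR).1
    filter_upwards [this, tR.ae_eq R hR] with θ a b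
    rw [← a, b]
  have tθ' : IsTraceable R₀ s₀ s₁ x y (cutPartials R₀ f).θ (waveRepθ R₀ w w' f' H) := by
    refine ⟨tθ.measurable, fun R hR => ?_, tθ.integrable, tθ.translate⟩
    have := ae_of_ae_circle (p := fun θ => f'.θ R θ = (cutPartials R₀ f).θ R θ)
      (fun θ => by rw [h.field.periodic_θ R hR, hc.periodic_θ R hR]) (hae R hR).2
    filter_upwards [this, tθ.ae_eq R hR] with θ a b
    rw [← a, b]
  have e1 := tR'.trace_eq hx hc.measurable_R fun R hR => by
    rw [(cutPartials_of_le f hR).1]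
    exact IsSmoothField.continuous_slice hf.continuousOn_R hR
  have e2 := tθ'.trace_eq hx hc.measurable_θ fun R hR => by
    rw [(cutPartials_of_le f hR).2]
    exact IsSmoothField.continuous_slice hf.continuousOn_θ hR
  have hm : ∀ᵐ s ∂(intervalMeasure s₀ s₁), s ∈ Ioo s₀ s₁ := ae_restrict_mem measurableSet_Ioo
  filter_upwards [e1, e2, hm] with s a b hs
  have hxs := hx.mem s (Ioo_subset_Icc_self hs)
  rw [a, b, (cutPartials_of_le f hxs).1, (cutPartials_of_le f hxs).2]
  exact ⟨rfl, rfl⟩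

/-! ### Square integrability of the traces of `U` and `A` -/

namespace IsWaveData

variable {R₀ s₀ s₁ : ℝ} {x y : ℝ → ℝ} {U A η : ℝ → ℝ → ℝ} {U' A' η' : Partials}

/-- The constraints, combined into a formula for the null derivatives of `η`: these are sums of
squares of the null derivatives of `U` and `A`. -/
theorem nullDeriv_eta (h : IsWaveData R₀ U A η U' A' η')
    (hcR : ∀ R, R₀ ≤ R → ∀ᵐ θ ∂circleMeasure, η'.R R θ = R * energyE U U' A' R θ)
    (hcθ : ∀ R, R₀ ≤ R → ∀ᵐ θ ∂circleMeasure, η'.θ R θ = R * energyF U U' A' R θ)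
    {σ : ℝ} (hσ : σ * σ = 1) {R : ℝ} (hR : R₀ ≤ R) :
    ∀ᵐ θ, nullDeriv η' σ R θ = R * (nullDeriv U' σ R θ ^ 2 +
      Real.exp (4 * U R θ) / (4 * R ^ 2) * nullDeriv A' σ R θ ^ 2) := by
  have h1 := ae_of_ae_circle (p := fun θ => η'.R R θ = R * energyE U U' A' R θ)
    (fun θ => by
      simp only [energyE, h.field_U.periodic R hR θ, h.field_U.periodic_R R hR θ,
        h.field_U.periodic_θ R hR θ, h.field_A.periodic_R R hR θ, h.field_A.periodic_θ R hR θ,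
        h.field_η.periodic_R R hR θ]) (hcR R hR)
  have h2 := ae_of_ae_circle (p := fun θ => η'.θ R θ = R * energyF U U' A' R θ)
    (fun θ => by
      simp only [energyF, h.field_U.periodic R hR θ, h.field_U.periodic_R R hR θ,
        h.field_U.periodic_θ R hR θ, h.field_A.periodic_R R hR θ, h.field_A.periodic_θ R hR θ,
        h.field_η.periodic_θ R hR θ]) (hcθ R hR)
  filter_upwards [h1, h2] with θ e1 e2
  have e3 : Real.exp (4 * U R θ) / (2 * R ^ 2) = 2 * (Real.exp (4 * U R θ) / (4 * R ^ 2)) := by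
    simp only [div_eq_mul_inv, mul_inv]
    ring
  simp only [nullDeriv]
  rw [e1, e2, energyE, energyF, e3]
  linear_combination (-(R * (U'.θ R θ ^ 2 +
    Real.exp (4 * U R θ) / (4 * R ^ 2) * A'.θ R θ ^ 2))) * hσ

/-- A function whose square is dominated by an integrable function is in `L²`. -/
theorem memLp_two_of_sq_le {α : Type*} [MeasurableSpace α] {μ : Measure α} {F G : α → ℝ} {m : ℝ}
    (hm : 0 < m) (hF : AEStronglyMeasurable F μ) (hG : Integrable G μ)
    (h : ∀ᵐ s ∂μ, m * F s ^ 2 ≤ G s) : MemLp F 2 μ := by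
  rw [memLp_two_iff_integrable_sq hF]
  refine (hG.const_mul m⁻¹).mono' (hF.pow 2) ?_
  filter_upwards [h] with s hs
  rw [Real.norm_eq_abs, abs_of_nonneg (sq_nonneg _), le_inv_mul_iff₀ hm]
  exact hs

theorem memLp_two_null (hR₀ : 0 < R₀) (hx : IsTransversal R₀ s₀ s₁ x y)
    (h : IsWaveData R₀ U A η U' A' η')
    (hcR : ∀ R, R₀ ≤ R → ∀ᵐ θ ∂circleMeasure, η'.R R θ = R * energyE U U' A' R θ)
    (hcθ : ∀ R, R₀ ≤ R → ∀ᵐ θ ∂circleMeasure, η'.θ R θ = R * energyF U U' A' R θ)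
    {σ : ℝ} (hσ : σ * σ = 1) :
    MemLp (fun s => charRep R₀ (fun r => r) (nullDeriv U' σ R₀)
      (charSource (fun _ => 1) U' (sourceU R₀ U A') σ) σ (x s) (y s)) 2 (intervalMeasure s₀ s₁) ∧
    MemLp (fun s => charRep R₀ (fun r => r⁻¹) (nullDeriv A' σ R₀)
      (charSource (fun r => -(r ^ 2)⁻¹) A' (sourceA R₀ U U' A') σ) σ (x s) (y s)) 2
      (intervalMeasure s₀ s₁) := by
  have tU := (h.isWaveField_U hR₀).isTraceable_null hx hσ
  have tA := (h.isWaveField_A hR₀).isTraceable_null hx hσ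
  have tη := (h.isWaveField_η hR₀).isTraceable_null hx hσ
  obtain ⟨M, hM, hb⟩ := hx.exists_bound
  have hxM : ∀ s ∈ Icc s₀ s₁, x s ≤ M := fun s hs => (le_abs_self _).trans (hb s hs).1
  -- a bound for `|U|` on the range of `R` met by the curve
  obtain ⟨B, hB⟩ := (h.field_U.toOne one_le_two).exists_bound M
  have hM0 : 0 < M := (hR₀.trans_le (hx.mem s₀ (left_mem_Icc.2 hx.lt.le))).trans_le
    (hxM s₀ (left_mem_Icc.2 hx.lt.le))
  constructor
  · refine memLp_two_of_sq_le hR₀ tU.integrable.1 tη.integrable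
      (tU.trace_sq_le hx tη hxM fun R hR => ?_)
    have hR0 : 0 < R := hR₀.trans_le hR.1
    filter_upwards [h.nullDeriv_eta hcR hcθ hσ hR.1] with θ e
    rw [e]
    refine mul_le_mul hR.1 (le_add_of_nonneg_right (by positivity)) (sq_nonneg _) hR0.le
  · refine memLp_two_of_sq_le (m := Real.exp (-4 * B) / (4 * M)) (by positivity)
      tA.integrable.1 tη.integrable (tA.trace_sq_le hx tη hxM fun R hR => ?_)
    have hR0 : 0 < R := hR₀.trans_le hR.1
    filter_upwards [h.nullDeriv_eta hcR hcθ hσ hR.1] with θ e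
    have e1 : Real.exp (-4 * B) / (4 * M) ≤ Real.exp (4 * U R θ) / (4 * R) := by
      refine div_le_div₀ (Real.exp_pos _).le (Real.exp_le_exp.2 ?_) (by positivity)
        (by linarith [hR.2])
      linarith [(abs_le.1 (hB R hR θ)).1]
    have e2 : nullDeriv η' σ R θ = R * nullDeriv U' σ R θ ^ 2 +
        Real.exp (4 * U R θ) / (4 * R) * nullDeriv A' σ R θ ^ 2 := by
      rw [e]
      field_simp
    rw [e2]
    exact (mul_le_mul_of_nonneg_right e1 (sq_nonneg _)).trans
      (le_add_of_nonneg_left (by positivity))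

/-- The traces of the derivatives of `U` and `A` are square integrable. -/
theorem memLp_two_trace (hR₀ : 0 < R₀) (hx : IsTransversal R₀ s₀ s₁ x y)
    (h : IsWaveData R₀ U A η U' A' η')
    (hcR : ∀ R, R₀ ≤ R → ∀ᵐ θ ∂circleMeasure, η'.R R θ = R * energyE U U' A' R θ)
    (hcθ : ∀ R, R₀ ≤ R → ∀ᵐ θ ∂circleMeasure, η'.θ R θ = R * energyF U U' A' R θ) :
    (MemLp (fun s => waveRepR R₀ (fun r => r) (fun _ => 1) U' (sourceU R₀ U A') (x s) (y s)) 2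
      (intervalMeasure s₀ s₁) ∧
    MemLp (fun s => waveRepθ R₀ (fun r => r) (fun _ => 1) U' (sourceU R₀ U A') (x s) (y s)) 2
      (intervalMeasure s₀ s₁)) ∧
    MemLp (fun s => waveRepR R₀ (fun r => r⁻¹) (fun r => -(r ^ 2)⁻¹) A' (sourceA R₀ U U' A')
      (x s) (y s)) 2 (intervalMeasure s₀ s₁) ∧
    MemLp (fun s => waveRepθ R₀ (fun r => r⁻¹) (fun r => -(r ^ 2)⁻¹) A' (sourceA R₀ U U' A')
      (x s) (y s)) 2 (intervalMeasure s₀ s₁) := by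
  obtain ⟨u1, a1⟩ := h.memLp_two_null hR₀ hx hcR hcθ (σ := 1) (by norm_num)
  obtain ⟨u2, a2⟩ := h.memLp_two_null hR₀ hx hcR hcθ (σ := -1) (by norm_num)
  exact ⟨⟨(u1.const_mul _).add (u2.const_mul _), (u1.const_mul _).add (u2.const_mul _)⟩,
    (a1.const_mul _).add (a2.const_mul _), (a1.const_mul _).add (a2.const_mul _)⟩

end IsWaveData

/-! ### The Christoffel symbols as functions of the metric coefficients and their derivatives -/

/-- The matrix of the Gowdy metric as a function of `R` and of the values of `U, A, η`. -/
def metricMat (r u a n : ℝ) : Matrix (Fin 4) (Fin 4) ℝ :=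
  !![-Real.exp (2 * (n - u)), 0, 0, 0;
     0, Real.exp (2 * (n - u)), 0, 0;
     0, 0, Real.exp (2 * u), Real.exp (2 * u) * a;
     0, 0, Real.exp (2 * u) * a, Real.exp (2 * u) * a ^ 2 + Real.exp (-2 * u) * r ^ 2]

/-- The inverse of the matrix of the metric. -/
def metricInv (r u a n : ℝ) : Matrix (Fin 4) (Fin 4) ℝ :=
  !![-Real.exp (-(2 * (n - u))), 0, 0, 0;
     0, Real.exp (-(2 * (n - u))), 0, 0;
     0, 0, Real.exp (2 * u) * a ^ 2 * r⁻¹ ^ 2 + Real.exp (-2 * u),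
         -(Real.exp (2 * u) * a * r⁻¹ ^ 2);
     0, 0, -(Real.exp (2 * u) * a * r⁻¹ ^ 2), Real.exp (2 * u) * r⁻¹ ^ 2]

/-- The partial derivative of `metricMat` in the variable `r`. -/
def metricDr (r u : ℝ) : Matrix (Fin 4) (Fin 4) ℝ :=
  !![0, 0, 0, 0; 0, 0, 0, 0; 0, 0, 0, 0; 0, 0, 0, Real.exp (-2 * u) * (2 * r)]

/-- The partial derivative of `metricMat` in the variable `u`. -/
def metricDu (r u a n : ℝ) : Matrix (Fin 4) (Fin 4) ℝ :=
  !![2 * Real.exp (2 * (n - u)), 0, 0, 0;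
     0, -(2 * Real.exp (2 * (n - u))), 0, 0;
     0, 0, 2 * Real.exp (2 * u), 2 * Real.exp (2 * u) * a;
     0, 0, 2 * Real.exp (2 * u) * a,
      2 * Real.exp (2 * u) * a ^ 2 - 2 * Real.exp (-2 * u) * r ^ 2]

/-- The partial derivative of `metricMat` in the variable `a`. -/
def metricDa (u a : ℝ) : Matrix (Fin 4) (Fin 4) ℝ :=
  !![0, 0, 0, 0; 0, 0, 0, 0; 0, 0, 0, Real.exp (2 * u);
     0, 0, Real.exp (2 * u), Real.exp (2 * u) * (2 * a)]

/-- The partial derivative of `metricMat` in the variable `n`. -/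
def metricDn (u n : ℝ) : Matrix (Fin 4) (Fin 4) ℝ :=
  !![-(2 * Real.exp (2 * (n - u))), 0, 0, 0; 0, 2 * Real.exp (2 * (n - u)), 0, 0;
     0, 0, 0, 0; 0, 0, 0, 0]

theorem metricMat_inv {r : ℝ} (hr : r ≠ 0) (u a n : ℝ) :
    (metricMat r u a n)⁻¹ = metricInv r u a n := by
  refine Matrix.inv_eq_left_inv ?_
  have h1 : Real.exp (-(2 * (n - u))) * Real.exp (2 * (n - u)) = 1 := by
    rw [← Real.exp_add, neg_add_cancel, Real.exp_zero]
  have h2 : Real.exp (-2 * u) * Real.exp (2 * u) = 1 := by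
    rw [← Real.exp_add, neg_mul, neg_add_cancel, Real.exp_zero]
  have h3 : r⁻¹ ^ 2 * r ^ 2 = 1 := by
    rw [← mul_pow, inv_mul_cancel₀ hr, one_pow]
  ext i j
  fin_cases i <;> fin_cases j <;>
    simp [metricMat, metricInv, Matrix.mul_apply, Fin.sum_univ_four] <;>
    grind

theorem hasFDerivAt_metricMat {E : Type*} [NormedAddCommGroup E] [NormedSpace ℝ E]
    {r u a n : E → ℝ} {r' u' a' n' : E →L[ℝ] ℝ} {p : E} (hr : HasFDerivAt r r' p)
    (hu : HasFDerivAt u u' p) (ha : HasFDerivAt a a' p) (hn : HasFDerivAt n n' p) (i j : Fin 4) :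
    HasFDerivAt (fun q => metricMat (r q) (u q) (a q) (n q) i j)
      (metricDr (r p) (u p) i j • r' + metricDu (r p) (u p) (a p) (n p) i j • u' +
        metricDa (u p) (a p) i j • a' + metricDn (u p) (n p) i j • n') p := by
  have h0 : HasFDerivAt (fun _ : E => (0 : ℝ)) (0 : E →L[ℝ] ℝ) p := hasFDerivAt_const 0 p
  have hE := ((hn.sub hu).const_mul 2).exp
  have h22 := (hu.const_mul 2).exp
  have h23 := h22.mul ha
  have h33 := (h22.mul (ha.pow 2)).add ((hu.const_mul (-2)).exp.mul (hr.pow 2))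
  fin_cases i <;> fin_cases j <;>
    -- The entries are zero, `± exp (2 (n - u))`, or one of the three entries of the torus block.
    first
    | refine h0.congr_fderiv ?_
    | refine hE.congr_fderiv ?_
    | refine hE.neg.congr_fderiv ?_
    | refine h22.congr_fderiv ?_
    | refine h23.congr_fderiv ?_
    | refine h33.congr_fderiv ?_
  all_goals
    ext v
    simp [metricDr, metricDu, metricDa, metricDn]
  all_goals ring

/-! ### Christoffel symbols of smooth metrics -/

/-- The value `R`, the values of `U, A, η` and the values of their first derivatives at a point. -/
structure Jet where
  r : ℝ
  u : ℝ
  a : ℝ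
  n : ℝ
  uR : ℝ
  uθ : ℝ
  aR : ℝ
  aθ : ℝ
  nR : ℝ
  nθ : ℝ

/-- The derivative in the `k`-th coordinate direction of a function of `(R, θ)` with partial
derivatives `fR` and `fθ`. -/
def coordDeriv (fR fθ : ℝ) (k : Fin 4) : ℝ :=
  (Pi.single k 1 : Fin 4 → ℝ) 0 * fR + (Pi.single k 1 : Fin 4 → ℝ) 1 * fθ

namespace Jet

/-- The coordinate derivative `∂_k g_{ij}` of the metric. -/
def metricDeriv (J : Jet) (k i j : Fin 4) : ℝ :=
  metricDr J.r J.u i j * coordDeriv 1 0 k + metricDu J.r J.u J.a J.n i j * coordDeriv J.uR J.uθ k +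
    metricDa J.u J.a i j * coordDeriv J.aR J.aθ k + metricDn J.u J.n i j * coordDeriv J.nR J.nθ k

/-- The Christoffel symbols in coordinates. -/
def coordChristoffel (J : Jet) (a b c : Fin 4) : ℝ :=
  (1 / 2) * ∑ d, metricInv J.r J.u J.a J.n a d *
    (J.metricDeriv b d c + J.metricDeriv c d b - J.metricDeriv d b c)

/-- The Christoffel symbols at the point `p` in an adapted frame. -/
def christoffel (J : Jet) {R₀ : ℝ} (𝓕 : AdaptedFrame R₀) (a b c : Fin 4) (p : Fin 4 → ℝ) : ℝ :=
  ∑ i, (Matrix.of fun i j => 𝓕.e j p i)⁻¹ a i *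
    (fderivWithin ℝ (𝓕.e c) (domain R₀) p (𝓕.e b p) i +
      ∑ j, ∑ k, 𝓕.e b p j * 𝓕.e c p k * J.coordChristoffel i j k)

end Jet

/-- The jet of smooth coefficients at the point `(r, θ)`. -/
def classicalJet (R₀ : ℝ) (U A η : ℝ → ℝ → ℝ) (r θ : ℝ) : Jet where
  r := r
  u := U r θ
  a := A r θ
  n := η r θ
  uR := (classicalPartials R₀ U).R r θ
  uθ := (classicalPartials R₀ U).θ r θ
  aR := (classicalPartials R₀ A).R r θ
  aθ := (classicalPartials R₀ A).θ r θ
  nR := (classicalPartials R₀ η).R r θ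
  nθ := (classicalPartials R₀ η).θ r θ

theorem IsSmoothField.hasFDerivAt_coord {R₀ : ℝ} {f : ℝ → ℝ → ℝ} (h : IsSmoothField R₀ f)
    {p : Fin 4 → ℝ} (hp : R₀ < p 0) :
    HasFDerivAt (fun q : Fin 4 → ℝ => f (q 0) (q 1))
      ((fderivWithin ℝ (Function.uncurry f) (halfPlane R₀) (p 0, p 1)).comp
        ((ContinuousLinearMap.proj (R := ℝ) (φ := fun _ : Fin 4 => ℝ) 0).prod
          (ContinuousLinearMap.proj 1))) p := by
  have hn : halfPlane R₀ ∈ 𝓝 (p 0, p 1) := prod_mem_nhds (Ici_mem_nhds hp) univ_mem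
  have h1 := (h.hasFDerivWithinAt hp.le (p 1)).hasFDerivAt hn
  have h2 : HasFDerivAt (fun q : Fin 4 → ℝ => (q 0, q 1))
      ((ContinuousLinearMap.proj (R := ℝ) (φ := fun _ : Fin 4 => ℝ) 0).prod
          (ContinuousLinearMap.proj 1)) p :=
    ((ContinuousLinearMap.proj (R := ℝ) (φ := fun _ : Fin 4 => ℝ) 0).prod
          (ContinuousLinearMap.proj 1)).hasFDerivAt
  exact h1.comp p h2

theorem domain_mem_nhds {R₀ : ℝ} {p : Fin 4 → ℝ} (hp : R₀ < p 0) : domain R₀ ∈ 𝓝 p :=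
  (continuous_apply 0).continuousAt.preimage_mem_nhds (Ici_mem_nhds hp)

theorem fderivWithin_metric {R₀ : ℝ} {U A η : ℝ → ℝ → ℝ} (hU : IsSmoothField R₀ U)
    (hA : IsSmoothField R₀ A) (hη : IsSmoothField R₀ η) {p : Fin 4 → ℝ} (hp : R₀ < p 0)
    (k i j : Fin 4) :
    fderivWithin ℝ (fun q => metric U A η q i j) (domain R₀) p (Pi.single k 1) =
      (classicalJet R₀ U A η (p 0) (p 1)).metricDeriv k i j := by
  have hr : HasFDerivAt (fun q : Fin 4 → ℝ => q 0)
      (ContinuousLinearMap.proj (R := ℝ) (φ := fun _ : Fin 4 => ℝ) 0) p :=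
    (ContinuousLinearMap.proj (R := ℝ) (φ := fun _ : Fin 4 => ℝ) 0).hasFDerivAt
  have h := hasFDerivAt_metricMat hr (hU.hasFDerivAt_coord hp) (hA.hasFDerivAt_coord hp)
    (hη.hasFDerivAt_coord hp) i j
  rw [fderivWithin_of_mem_nhds (domain_mem_nhds hp)]
  have e : (fun q => metric U A η q i j) = fun q =>
      metricMat (q 0) (U (q 0) (q 1)) (A (q 0) (q 1)) (η (q 0) (q 1)) i j := rfl
  rw [e, h.fderiv]
  simp only [add_apply, smul_apply,
    ContinuousLinearMap.comp_apply, ContinuousLinearMap.prod_apply, ContinuousLinearMap.proj_apply,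
    hU.fderivWithin_apply hp.le, hA.fderivWithin_apply hp.le, hη.fderivWithin_apply hp.le,
    smul_eq_mul, Jet.metricDeriv, coordDeriv, classicalJet, mul_one, mul_zero, add_zero]

theorem coordChristoffel_eq {R₀ : ℝ} (hR₀ : 0 < R₀) {U A η : ℝ → ℝ → ℝ} (hU : IsSmoothField R₀ U)
    (hA : IsSmoothField R₀ A) (hη : IsSmoothField R₀ η) {p : Fin 4 → ℝ} (hp : R₀ < p 0)
    (a b c : Fin 4) :
    coordChristoffel (metric U A η) (domain R₀) a b c p =
      (classicalJet R₀ U A η (p 0) (p 1)).coordChristoffel a b c := by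
  have e : (metric U A η p)⁻¹ =
      metricInv (p 0) (U (p 0) (p 1)) (A (p 0) (p 1)) (η (p 0) (p 1)) :=
    metricMat_inv (hR₀.trans hp).ne' _ _ _
  simp only [coordChristoffel, Jet.coordChristoffel, fderivWithin_metric hU hA hη hp, e]
  rfl

theorem christoffel_eq {R₀ : ℝ} (hR₀ : 0 < R₀) {U A η : ℝ → ℝ → ℝ} (hU : IsSmoothField R₀ U)
    (hA : IsSmoothField R₀ A) (hη : IsSmoothField R₀ η) (𝓕 : AdaptedFrame R₀) {p : Fin 4 → ℝ}
    (hp : R₀ < p 0) (a b c : Fin 4) :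
    christoffel 𝓕 U A η a b c p =
      (classicalJet R₀ U A η (p 0) (p 1)).christoffel 𝓕 a b c p := by
  simp only [christoffel, Jet.christoffel, Matrix.mulVec, dotProduct, covDeriv,
    coordChristoffel_eq hR₀ hU hA hη hp]
  refine Finset.sum_congr rfl fun i _ => ?_
  congr 2
  refine Finset.sum_congr rfl fun j _ => Finset.sum_congr rfl fun k _ => ?_
  ring

/-! ### Convergence of the Christoffel symbols along the curve -/

theorem TendstoBdd.comp_pi {α : Type*} [MeasurableSpace α] {μ : Measure α} {ι : Type*} [Fintype ι]
    {F : (ι → ℝ) → ℝ} (hF : Continuous F) {c : ι → ℕ → α → ℝ} {c₀ : ι → α → ℝ}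
    (h : ∀ i, TendstoBdd μ (c i) (c₀ i)) :
    TendstoBdd μ (fun n z => F fun i => c i n z) (fun z => F fun i => c₀ i z) := by
  choose B h1 h2 using fun i => (h i).bound
  obtain ⟨D, hD⟩ := (isCompact_univ_pi fun i : ι =>
    isCompact_Icc (a := -B i) (b := B i)).exists_bound_of_continuousOn hF.continuousOn
  refine ⟨fun n => (hF.measurable.comp_aemeasurable
      (aemeasurable_pi_lambda _ fun i => ((h i).aesm n).aemeasurable)).aestronglyMeasurable,
    (hF.measurable.comp_aemeasurable
      (aemeasurable_pi_lambda _ fun i => (h i).aesm_lim.aemeasurable)).aestronglyMeasurable,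
    ⟨D, ?_, ?_⟩, ?_⟩
  · filter_upwards [eventually_all.2 h1] with n hn
    filter_upwards [eventually_all.2 hn] with z hz using hD _ fun i _ => abs_le.1 (hz i)
  · filter_upwards [eventually_all.2 h2] with z hz using hD _ fun i _ => abs_le.1 (hz i)
  · filter_upwards [eventually_all.2 fun i => (h i).tendsto] with z hz
    exact (hF.tendsto _).comp (tendsto_pi_nhds.2 hz)

theorem TendstoBdd.congr {α : Type*} [MeasurableSpace α] {μ : Measure α} {c d : ℕ → α → ℝ}
    {c₀ d₀ : α → ℝ} (h : TendstoBdd μ c c₀) (e : ∀ n, c n =ᵐ[μ] d n) (e₀ : c₀ =ᵐ[μ] d₀) :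
    TendstoBdd μ d d₀ := by
  obtain ⟨B, h1, h2⟩ := h.bound
  refine ⟨fun n => (h.aesm n).congr (e n), h.aesm_lim.congr e₀, ⟨B, ?_, ?_⟩, ?_⟩
  · filter_upwards [h1] with n hn
    filter_upwards [hn, e n] with z a b
    rwa [← b]
  · filter_upwards [h2, e₀] with z a b
    rwa [← b]
  · filter_upwards [h.tendsto, e₀, eventually_countable_forall.2 e] with z a b c
    rw [← b]
    exact a.congr c

/-- Continuous functions on `[s₀, s₁]` are bounded coefficients. -/
theorem TendstoBdd.of_continuousOn {s₀ s₁ : ℝ} {c : ℝ → ℝ} (hc : ContinuousOn c (Icc s₀ s₁)) :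
    TendstoBdd (intervalMeasure s₀ s₁) (fun _ => c) c := by
  obtain ⟨B, hB⟩ := isCompact_Icc.exists_bound_of_continuousOn hc
  refine .const (B := B)
    ((hc.mono Ioo_subset_Icc_self).aestronglyMeasurable measurableSet_Ioo) ?_
  exact (ae_restrict_mem measurableSet_Ioo).mono fun s hs => hB s (Ioo_subset_Icc_self hs)

/-- Bounded convergence of the values and `L¹`-convergence of the derivatives in a sequence of
jets. -/
structure JetTendsto {α : Type*} [MeasurableSpace α] (μ : Measure α) (J : ℕ → α → Jet)
    (J₀ : α → Jet) : Prop where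
  r : TendstoBdd μ (fun n z => (J n z).r) (fun z => (J₀ z).r)
  r_inv : TendstoBdd μ (fun n z => (J n z).r⁻¹) (fun z => (J₀ z).r⁻¹)
  u : TendstoBdd μ (fun n z => (J n z).u) (fun z => (J₀ z).u)
  a : TendstoBdd μ (fun n z => (J n z).a) (fun z => (J₀ z).a)
  n : TendstoBdd μ (fun n z => (J n z).n) (fun z => (J₀ z).n)
  uR : TendstoL1 μ (fun n z => (J n z).uR) (fun z => (J₀ z).uR)
  uθ : TendstoL1 μ (fun n z => (J n z).uθ) (fun z => (J₀ z).uθ)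
  aR : TendstoL1 μ (fun n z => (J n z).aR) (fun z => (J₀ z).aR)
  aθ : TendstoL1 μ (fun n z => (J n z).aθ) (fun z => (J₀ z).aθ)
  nR : TendstoL1 μ (fun n z => (J n z).nR) (fun z => (J₀ z).nR)
  nθ : TendstoL1 μ (fun n z => (J n z).nθ) (fun z => (J₀ z).nθ)

namespace JetTendsto

variable {α : Type*} [MeasurableSpace α] {μ : Measure α} {J : ℕ → α → Jet} {J₀ : α → Jet}

theorem comp (h : JetTendsto μ J J₀) {F : (Fin 5 → ℝ) → ℝ} (hF : Continuous F) :
    TendstoBdd μ (fun n z => F ![(J n z).r, (J n z).r⁻¹, (J n z).u, (J n z).a, (J n z).n])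
      (fun z => F ![(J₀ z).r, (J₀ z).r⁻¹, (J₀ z).u, (J₀ z).a, (J₀ z).n]) :=
  (TendstoBdd.comp_pi hF (c := fun i n z =>
      ![(J n z).r, (J n z).r⁻¹, (J n z).u, (J n z).a, (J n z).n] i)
    (c₀ := fun i z => ![(J₀ z).r, (J₀ z).r⁻¹, (J₀ z).u, (J₀ z).a, (J₀ z).n] i) fun i => by
    fin_cases i
    exacts [h.r, h.r_inv, h.u, h.a, h.n])

theorem metricDr (h : JetTendsto μ J J₀) (i j : Fin 4) :
    TendstoBdd μ (fun n z => metricDr (J n z).r (J n z).u i j)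
      (fun z => Gowdy.metricDr (J₀ z).r (J₀ z).u i j) := by
  refine h.comp (F := fun v => Gowdy.metricDr (v 0) (v 2) i j) ?_
  fin_cases i <;> fin_cases j <;> simp [Gowdy.metricDr] <;> fun_prop

theorem metricDu (h : JetTendsto μ J J₀) (i j : Fin 4) :
    TendstoBdd μ (fun n z => metricDu (J n z).r (J n z).u (J n z).a (J n z).n i j)
      (fun z => Gowdy.metricDu (J₀ z).r (J₀ z).u (J₀ z).a (J₀ z).n i j) := by
  refine h.comp (F := fun v => Gowdy.metricDu (v 0) (v 2) (v 3) (v 4) i j) ?_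
  fin_cases i <;> fin_cases j <;> simp [Gowdy.metricDu] <;> fun_prop

theorem metricDa (h : JetTendsto μ J J₀) (i j : Fin 4) :
    TendstoBdd μ (fun n z => metricDa (J n z).u (J n z).a i j)
      (fun z => Gowdy.metricDa (J₀ z).u (J₀ z).a i j) := by
  refine h.comp (F := fun v => Gowdy.metricDa (v 2) (v 3) i j) ?_
  fin_cases i <;> fin_cases j <;> simp [Gowdy.metricDa] <;> fun_prop

theorem metricDn (h : JetTendsto μ J J₀) (i j : Fin 4) :
    TendstoBdd μ (fun n z => metricDn (J n z).u (J n z).n i j)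
      (fun z => Gowdy.metricDn (J₀ z).u (J₀ z).n i j) := by
  refine h.comp (F := fun v => Gowdy.metricDn (v 2) (v 4) i j) ?_
  fin_cases i <;> fin_cases j <;> simp [Gowdy.metricDn] <;> fun_prop

theorem metricInv (h : JetTendsto μ J J₀) (i j : Fin 4) :
    TendstoBdd μ (fun n z => metricInv (J n z).r (J n z).u (J n z).a (J n z).n i j)
      (fun z => Gowdy.metricInv (J₀ z).r (J₀ z).u (J₀ z).a (J₀ z).n i j) := by
  -- `metricInv` depends on `r` through `r⁻¹` only
  have e : ∀ r u a n : ℝ, Gowdy.metricInv r u a n i j = Gowdy.metricInv r⁻¹⁻¹ u a n i j :=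
    fun r u a n => by rw [inv_inv]
  simp only [e (J _ _).r, e (J₀ _).r]
  refine h.comp (F := fun v => Gowdy.metricInv (v 1)⁻¹ (v 2) (v 3) (v 4) i j) ?_
  fin_cases i <;> fin_cases j <;> simp [Gowdy.metricInv] <;> fun_prop

theorem metricDeriv [IsFiniteMeasure μ] (h : JetTendsto μ J J₀) (k i j : Fin 4) :
    TendstoL1 μ (fun n z => (J n z).metricDeriv k i j) (fun z => (J₀ z).metricDeriv k i j) := by
  have hd : ∀ {fR fθ : ℕ → α → ℝ} {gR gθ : α → ℝ}, TendstoL1 μ fR gR → TendstoL1 μ fθ gθ →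
      TendstoL1 μ (fun n z => coordDeriv (fR n z) (fθ n z) k)
          (fun z => coordDeriv (gR z) (gθ z) k) :=
    fun hR hθ => (TendstoL1.bdd_mul (.num _) hR).add (TendstoL1.bdd_mul (.num _) hθ)
  have h1 : TendstoL1 μ (fun _ _ => coordDeriv 1 0 k) (fun _ => coordDeriv 1 0 k) :=
    .const (integrable_const _)
  exact (((TendstoL1.bdd_mul (h.metricDr i j) h1).add
    (TendstoL1.bdd_mul (h.metricDu i j) (hd h.uR h.uθ))).add
    (TendstoL1.bdd_mul (h.metricDa i j) (hd h.aR h.aθ))).add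
    (TendstoL1.bdd_mul (h.metricDn i j) (hd h.nR h.nθ))

theorem coordChristoffel [IsFiniteMeasure μ] (h : JetTendsto μ J J₀) (a b c : Fin 4) :
    TendstoL1 μ (fun n z => (J n z).coordChristoffel a b c)
      (fun z => (J₀ z).coordChristoffel a b c) :=
  TendstoL1.bdd_mul (.num _) (TendstoL1.sum fun d _ => TendstoL1.bdd_mul (h.metricInv a d)
    (((h.metricDeriv b d c).add (h.metricDeriv c d b)).sub (h.metricDeriv d b c)))

end JetTendsto

/-! ### Adapted frames along the curve -/

theorem uniqueDiffOn_domain (R₀ : ℝ) : UniqueDiffOn ℝ (domain R₀) := by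
  refine uniqueDiffOn_convex (convex_halfSpace_ge (IsLinearMap.mk (fun _ _ => rfl) fun _ _ => rfl)
      R₀)
    ⟨fun _ => R₀ + 1, ?_⟩
  exact mem_interior_iff_mem_nhds.2 (domain_mem_nhds (by simp))

namespace AdaptedFrame

variable {R₀ s₀ s₁ : ℝ} (𝓕 : AdaptedFrame R₀) {ξ : ℝ → Fin 4 → ℝ}

theorem continuousOn_curve (hξ : ContinuousOn ξ (Icc s₀ s₁))
    (hd : ∀ s ∈ Icc s₀ s₁, ξ s ∈ domain R₀) (i j : Fin 4) :
    ContinuousOn (fun s => 𝓕.e i (ξ s) j) (Icc s₀ s₁) :=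
  (continuous_apply j).comp_continuousOn ((𝓕.smooth i).continuousOn.comp hξ hd)

theorem continuousOn_inv_curve (hξ : ContinuousOn ξ (Icc s₀ s₁))
    (hd : ∀ s ∈ Icc s₀ s₁, ξ s ∈ domain R₀) (a i : Fin 4) :
    ContinuousOn (fun s => (Matrix.of fun i j => 𝓕.e j (ξ s) i)⁻¹ a i) (Icc s₀ s₁) := by
  have hE : ContinuousOn (fun s => (Matrix.of fun i j => 𝓕.e j (ξ s) i)) (Icc s₀ s₁) :=
    continuousOn_pi.2 fun i => continuousOn_pi.2 fun j => 𝓕.continuousOn_curve hξ hd j i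
  rw [continuousOn_iff_continuous_domRestrict] at hE ⊢
  have hdet := hE.matrix_det.inv₀ fun s => 𝓕.basis _ (hd s s.2)
  have hadj := hE.matrix_adjugate.matrix_elem a i
  refine (hdet.mul hadj).congr fun s => ?_
  simp only [domRestrict_apply, Matrix.inv_def, Matrix.smul_apply, smul_eq_mul,
    Ring.inverse_eq_inv]
  rfl

theorem continuousOn_fderiv_curve (hξ : ContinuousOn ξ (Icc s₀ s₁))
    (hd : ∀ s ∈ Icc s₀ s₁, ξ s ∈ domain R₀) (b c i : Fin 4) :
    ContinuousOn (fun s => fderivWithin ℝ (𝓕.e c) (domain R₀) (ξ s) (𝓕.e b (ξ s)) i)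
      (Icc s₀ s₁) := by
  have h1 := ((𝓕.smooth c).continuousOn_fderivWithin (uniqueDiffOn_domain R₀) (by simp)).comp hξ hd
  have h2 := (𝓕.smooth b).continuousOn.comp hξ hd
  exact (continuous_apply i).comp_continuousOn (h1.clm_apply h2)

/-- The Christoffel symbols in an adapted frame converge in `L¹` along the curve. -/
theorem tendstoL1_christoffel (hξ : ContinuousOn ξ (Icc s₀ s₁))
    (hd : ∀ s ∈ Icc s₀ s₁, ξ s ∈ domain R₀) {J : ℕ → ℝ → Jet} {J₀ : ℝ → Jet}
    (h : JetTendsto (intervalMeasure s₀ s₁) J J₀) (a b c : Fin 4) :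
    TendstoL1 (intervalMeasure s₀ s₁) (fun n s => (J n s).christoffel 𝓕 a b c (ξ s))
      (fun s => (J₀ s).christoffel 𝓕 a b c (ξ s)) := by
  have : IsFiniteMeasure (intervalMeasure s₀ s₁) := by
    unfold intervalMeasure
    infer_instance
  refine TendstoL1.sum fun i _ => TendstoL1.bdd_mul
    (.of_continuousOn (𝓕.continuousOn_inv_curve hξ hd a i)) (TendstoL1.add ?_ ?_)
  · have := TendstoL1.bdd_mul (.of_continuousOn (𝓕.continuousOn_fderiv_curve hξ hd b c i))
      (TendstoL1.const (integrable_const (μ := intervalMeasure s₀ s₁) (1 : ℝ)))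
    simpa only [mul_one] using this
  · exact TendstoL1.sum fun j _ => TendstoL1.sum fun k _ => TendstoL1.bdd_mul
      ((TendstoBdd.of_continuousOn (𝓕.continuousOn_curve hξ hd b j)).mul
        (.of_continuousOn (𝓕.continuousOn_curve hξ hd c k))) (h.coordChristoffel i j k)

/-- In the directions `X, Y` of the Killing fields, the Christoffel symbols in the frame are
obtained from those in coordinates by expressing the upper index in the frame. -/
theorem christoffel_killing (J : Jet) {b c : Fin 4} (hb : b = 2 ∨ b = 3) (hc : c = 2 ∨ c = 3)
    (a : Fin 4) (p : Fin 4 → ℝ) :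
    J.christoffel 𝓕 a b c p =
      ∑ i, (Matrix.of fun i j => 𝓕.e j p i)⁻¹ a i * J.coordChristoffel i b c := by
  have he : ∀ {b : Fin 4}, b = 2 ∨ b = 3 → 𝓕.e b = fun _ => Pi.single b 1 := by
    rintro b (rfl | rfl)
    · exact funext 𝓕.X_eq
    · exact funext 𝓕.Y_eq
  simp only [Jet.christoffel, he hb, he hc]
  refine Finset.sum_congr rfl fun i _ => ?_
  congr 1
  simp [Pi.single_apply, fderivWithin_const_apply]

end AdaptedFrame

/-- A bounded measurable coefficient times an `L^p` function is in `L^p`. -/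
theorem TendstoBdd.memLp_mul {α : Type*} [MeasurableSpace α] {μ : Measure α} {c : ℕ → α → ℝ}
    {c₀ f : α → ℝ} {p : ENNReal} (hc : TendstoBdd μ c c₀) (hf : MemLp f p μ) :
    MemLp (fun z => c₀ z * f z) p μ := by
  obtain ⟨B, -, hB⟩ := hc.bound
  exact hf.mul' (memLp_top_of_bound hc.aesm_lim B hB) (hpqr := ⟨by simp⟩)

/-- The derivatives of the coefficients of the Killing part of the metric involve only the
derivatives of `U` and `A`, which are square integrable. -/
theorem JetTendsto.memLp_coordChristoffel {α : Type*} [MeasurableSpace α] {μ : Measure α}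
    [IsFiniteMeasure μ] {J : ℕ → α → Jet} {J₀ : α → Jet} (h : JetTendsto μ J J₀)
    (huR : MemLp (fun z => (J₀ z).uR) 2 μ) (huθ : MemLp (fun z => (J₀ z).uθ) 2 μ)
    (haR : MemLp (fun z => (J₀ z).aR) 2 μ) (haθ : MemLp (fun z => (J₀ z).aθ) 2 μ)
    {b c : Fin 4} (hb : b = 2 ∨ b = 3) (hc : c = 2 ∨ c = 3) (a : Fin 4) :
    MemLp (fun z => (J₀ z).coordChristoffel a b c) 2 μ := by
  have h0 : ∀ {b : Fin 4}, b = 2 ∨ b = 3 → ∀ fR fθ, coordDeriv fR fθ b = 0 := by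
    rintro b (rfl | rfl) fR fθ <;> simp [coordDeriv]
  have hn : ∀ u n, Gowdy.metricDn u n b c = 0 := by
    rcases hb with rfl | rfl <;> rcases hc with rfl | rfl <;> simp [Gowdy.metricDn]
  have hd : ∀ {gR gθ : α → ℝ}, MemLp gR 2 μ → MemLp gθ 2 μ → ∀ k,
      MemLp (fun z => coordDeriv (gR z) (gθ z) k) 2 μ := fun hR hθ k =>
    (hR.const_mul _).add (hθ.const_mul _)
  have hD : ∀ d, MemLp (fun z => (J₀ z).metricDeriv d b c) 2 μ := by
    intro d
    simp only [Jet.metricDeriv, hn, zero_mul, add_zero]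
    exact (((h.metricDr b c).memLp_mul (memLp_const (coordDeriv 1 0 d))).add
      ((h.metricDu b c).memLp_mul (hd huR huθ d))).add
      ((h.metricDa b c).memLp_mul (hd haR haθ d))
  have e : ∀ z, (J₀ z).coordChristoffel a b c = (1 / 2) * ∑ d,
      Gowdy.metricInv (J₀ z).r (J₀ z).u (J₀ z).a (J₀ z).n a d * -(J₀ z).metricDeriv d b c := by
    intro z
    have h1 : ∀ d c', (J₀ z).metricDeriv b d c' = 0 := fun d c' => by
      simp only [Jet.metricDeriv, h0 hb, mul_zero, add_zero]
    have h2 : ∀ d c', (J₀ z).metricDeriv c d c' = 0 := fun d c' => by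
      simp only [Jet.metricDeriv, h0 hc, mul_zero, add_zero]
    simp only [Jet.coordChristoffel, h1, h2, add_zero, zero_sub]
  simp only [e]
  exact (memLp_finsetSum _ fun d _ => (h.metricInv a d).memLp_mul (hD d).neg).const_mul _

/-! ### The traces of the Christoffel symbols -/

/-- The jet along a curve, with the traces of the derivatives given by integration along
characteristics. -/
def traceJet (R₀ : ℝ) (U A η : ℝ → ℝ → ℝ) (U' A' η' : Partials) (r θ : ℝ) : Jet where
  r := r
  u := U r θ
  a := A r θ
  n := η r θ
  uR := waveRepR R₀ (fun r => r) (fun _ => 1) U' (sourceU R₀ U A') r θ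
  uθ := waveRepθ R₀ (fun r => r) (fun _ => 1) U' (sourceU R₀ U A') r θ
  aR := waveRepR R₀ (fun r => r⁻¹) (fun r => -(r ^ 2)⁻¹) A' (sourceA R₀ U U' A') r θ
  aθ := waveRepθ R₀ (fun r => r⁻¹) (fun r => -(r ^ 2)⁻¹) A' (sourceA R₀ U U' A') r θ
  nR := waveRepR R₀ (fun _ => 1) (fun _ => 0) η' (sourceEta R₀ U U' A') r θ
  nθ := waveRepθ R₀ (fun _ => 1) (fun _ => 0) η' (sourceEta R₀ U U' A') r θ

/-- For a smooth solution, the trace of the jet is the jet. -/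
theorem IsWaveData.traceJet_eq {R₀ s₀ s₁ : ℝ} {x y : ℝ → ℝ} {U A η : ℝ → ℝ → ℝ}
    {U' A' η' : Partials} (hR₀ : 0 < R₀) (hx : IsTransversal R₀ s₀ s₁ x y)
    (h : IsWaveData R₀ U A η U' A' η') (hU : IsSmoothField R₀ U) (hA : IsSmoothField R₀ A)
    (hη : IsSmoothField R₀ η) :
    ∀ᵐ s ∂(intervalMeasure s₀ s₁),
      traceJet R₀ U A η U' A' η' (x s) (y s) = classicalJet R₀ U A η (x s) (y s) := by
  filter_upwards [(h.isWaveField_U hR₀).trace_eq hx hU, (h.isWaveField_A hR₀).trace_eq hx hA,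
    (h.isWaveField_η hR₀).trace_eq hx hη] with s e1 e2 e3
  simp only [traceJet, classicalJet, e1.1, e1.2, e2.1, e2.2, e3.1, e3.2]

/-- Along the curve, the jets of a convergent sequence of solutions converge. -/
theorem jetTendsto_traceJet {R₀ s₀ s₁ : ℝ} {x y : ℝ → ℝ} (hR₀ : 0 < R₀)
    (hx : IsTransversal R₀ s₀ s₁ x y) {Un An ηn : ℕ → ℝ → ℝ → ℝ} {Un' An' ηn' : ℕ → Partials}
    {U A η : ℝ → ℝ → ℝ} {U' A' η' : Partials}
    (hn : ∀ n, IsWaveData R₀ (Un n) (An n) (ηn n) (Un' n) (An' n) (ηn' n))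
    (h : IsWaveData R₀ U A η U' A' η') (hU : EnergyTendsto 2 R₀ Un Un' U U')
    (hA : EnergyTendsto 2 R₀ An An' A A') (hη : EnergyTendsto 1 R₀ ηn ηn' η η') :
    JetTendsto (intervalMeasure s₀ s₁)
      (fun n s => traceJet R₀ (Un n) (An n) (ηn n) (Un' n) (An' n) (ηn' n) (x s) (y s))
      (fun s => traceJet R₀ U A η U' A' η' (x s) (y s)) := by
  obtain ⟨M, hM, hb⟩ := hx.exists_bound
  have hxM : ∀ s ∈ Icc s₀ s₁, x s ∈ Icc R₀ M := fun s hs =>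
    ⟨hx.mem s hs, (le_abs_self _).trans (hb s hs).1⟩
  have hm : ∀ᵐ s ∂(intervalMeasure s₀ s₁), s ∈ Icc s₀ s₁ :=
    (ae_restrict_mem measurableSet_Ioo).mono fun s hs => Ioo_subset_Icc_self hs
  have hR₁ : R₀ ≤ M := nonempty_Icc.1 ⟨_, hxM s₀ (left_mem_Icc.2 hx.lt.le)⟩
  have hv : ∀ {f : ℕ → ℝ → ℝ → ℝ} {f' : ℕ → Partials} {g : ℝ → ℝ → ℝ} {g' : Partials},
      EnergyTendsto 1 R₀ f f' g g' → TendstoBdd (intervalMeasure s₀ s₁)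
        (fun n s => f n (x s) (y s)) (fun s => g (x s) (y s)) := fun hf => by
    refine (hf.tendstoBdd hx.continuous_x.measurable hx.continuous_y.measurable hR₁
      (hm.mono hxM)).congr (fun n => ?_) ?_
    · filter_upwards [hm] with s hs
      rw [clamp_of_le (hx.mem s hs)]
    · filter_upwards [hm] with s hs
      rw [clamp_of_le (hx.mem s hs)]
  have hU1 := hU.toOne one_le_two
  have hA1 := hA.toOne one_le_two
  obtain ⟨u1, u2⟩ := IsWaveField.tendstoL1_trace hx (fun n => (hn n).isWaveField_U hR₀)
    (h.isWaveField_U hR₀) hU1 fun R₁ hR₁ => tendstoL1_sourceU hR₀ hU hA hR₁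
  obtain ⟨a1, a2⟩ := IsWaveField.tendstoL1_trace hx (fun n => (hn n).isWaveField_A hR₀)
    (h.isWaveField_A hR₀) hA1 fun R₁ hR₁ => tendstoL1_sourceA hR₀ hU hA hR₁
  obtain ⟨n1, n2⟩ := IsWaveField.tendstoL1_trace hx (fun n => (hn n).isWaveField_η hR₀)
    (h.isWaveField_η hR₀) hη fun R₁ hR₁ => tendstoL1_sourceEta hR₀ hU hA hR₁
  exact ⟨.of_continuousOn hx.continuous_x.continuousOn,
    .of_continuousOn (hx.continuous_x.continuousOn.inv₀ fun s hs =>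
      (hR₀.trans_le (hx.mem s hs)).ne'),
    hv hU1, hv hA1, hv hη, u1, u2, a1, a2, n1, n2⟩

end Gowdy

end

open Gowdy

theorem mainTheorem5 (R₀ : ℝ) (hR₀ : 0 < R₀) (U A η : ℝ → ℝ → ℝ)
    (hsol : Gowdy.IsWeakSolution R₀ U A η)
    (s₀ s₁ : ℝ) (hs : s₀ < s₁) (ξ : ℝ → Fin 4 → ℝ)
    (hξ : Gowdy.IsW1InftyCurve R₀ s₀ s₁ ξ)
    (htl : Gowdy.IsUniformlyTimelike U A η s₀ s₁ ξ)
    (hor : Gowdy.IsTimeOriented s₀ s₁ ξ) :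
    -- `η ∘ ξ ∈ W^{1,1}` and `U ∘ ξ, A ∘ ξ ∈ H^1`
    Gowdy.MemW1 1 s₀ s₁ (fun s => η (ξ s 0) (ξ s 1)) ∧
    Gowdy.MemW1 2 s₀ s₁ (fun s => U (ξ s 0) (ξ s 1)) ∧
    Gowdy.MemW1 2 s₀ s₁ (fun s => A (ξ s 0) (ξ s 1)) ∧
    -- the Christoffel symbols in any adapted frame have traces `Γξ a b c` on `ξ`
    ∀ 𝓕 : Gowdy.AdaptedFrame R₀, ∃ Γξ : Fin 4 → Fin 4 → Fin 4 → ℝ → ℝ,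
      (∀ a b c, MemLp (Γξ a b c) 1 (Gowdy.intervalMeasure s₀ s₁)) ∧
      -- which are the compositions with `ξ` if the metric is smooth
      (Gowdy.IsSmoothField R₀ U → Gowdy.IsSmoothField R₀ A → Gowdy.IsSmoothField R₀ η →
        ∀ a b c, ∀ᵐ s ∂(Gowdy.intervalMeasure s₀ s₁),
          Γξ a b c s = Gowdy.christoffel 𝓕 U A η a b c (ξ s)) ∧
      -- and the limits of the traces for every approximating sequence of smooth solutions
      (∀ Un An ηn : ℕ → ℝ → ℝ → ℝ,
        (∀ n, Gowdy.IsSmoothSolution R₀ (Un n) (An n) (ηn n)) →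
        Gowdy.TendstoEnergy 2 R₀ Un U → Gowdy.TendstoEnergy 2 R₀ An A →
        Gowdy.TendstoEnergy 1 R₀ ηn η →
        ∀ a b c, Tendsto
          (fun n => eLpNorm
            (fun s => Gowdy.christoffel 𝓕 (Un n) (An n) (ηn n) a b c (ξ s) - Γξ a b c s) 1
            (Gowdy.intervalMeasure s₀ s₁))
          atTop (𝓝 0)) ∧
      -- the components with upper index `R, θ` and lower indices `X, Y` are square integrable
      (∀ a b c : Fin 4, (a = 0 ∨ a = 1) → (b = 2 ∨ b = 3) → (c = 2 ∨ c = 3) →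
        MemLp (Γξ a b c) 2 (Gowdy.intervalMeasure s₀ s₁)) := by
  obtain ⟨U', A', η', hU, hA, hη, hwave, hcR, hcθ⟩ := hsol
  have hdata : IsWaveData R₀ U A η U' A' η' := ⟨hU, hA, hη, hwave⟩
  have hU1 := hU.toOne one_le_two
  have hA1 := hA.toOne one_le_two
  obtain ⟨x, y, hx, hxy⟩ := exists_isTransversal hU1.continuousOn hη.continuousOn hs hξ htl hor
  obtain ⟨⟨K, hK⟩, hdom⟩ := hξ
  have hm : ∀ᵐ s ∂(intervalMeasure s₀ s₁), s ∈ Ioo s₀ s₁ := ae_restrict_mem measurableSet_Ioo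
  have : IsFiniteMeasure (intervalMeasure s₀ s₁) := by
    unfold intervalMeasure
    infer_instance
  have hW : ∀ {p : ENNReal} {f : ℝ → ℝ → ℝ}, MemW1 p s₀ s₁ (fun s => f (x s) (y s)) →
      MemW1 p s₀ s₁ (fun s => f (ξ s 0) (ξ s 1)) := by
    rintro p f ⟨h1, g, h2, h3⟩
    have e : (fun s => f (x s) (y s)) =ᵐ[intervalMeasure s₀ s₁] fun s => f (ξ s 0) (ξ s 1) := by
      filter_upwards [hm] with s hs
      rw [(hxy s (Ioo_subset_Icc_self hs)).1, (hxy s (Ioo_subset_Icc_self hs)).2]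
    refine ⟨h1.ae_eq e, g, h2, fun φ a b c => ?_⟩
    rw [← h3 φ a b c]
    refine integral_congr_ae ?_
    filter_upwards [e] with s hs
    rw [hs]
  have wU := hdata.isWaveField_U hR₀
  have wA := hdata.isWaveField_A hR₀
  have wη := hdata.isWaveField_η hR₀
  obtain ⟨⟨u1, u2⟩, a1, a2⟩ := hdata.memLp_two_trace hR₀ hx hcR hcθ
  have hJ := jetTendsto_traceJet hR₀ hx (fun _ => hdata) hdata (.const hU) (.const hA) (.const hη)
  -- for smooth solutions, the traces of the Christoffel symbols are their restrictions
  have hsmooth : ∀ (𝓕 : AdaptedFrame R₀) {V B ν : ℝ → ℝ → ℝ} {V' B' ν' : Partials},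
      IsWaveData R₀ V B ν V' B' ν' → IsSmoothField R₀ V → IsSmoothField R₀ B →
      IsSmoothField R₀ ν → ∀ a b c, ∀ᵐ s ∂(intervalMeasure s₀ s₁),
        (traceJet R₀ V B ν V' B' ν' (x s) (y s)).christoffel 𝓕 a b c (ξ s) =
          christoffel 𝓕 V B ν a b c (ξ s) := by
    intro 𝓕 V B ν V' B' ν' h hV hB hν a b c
    filter_upwards [h.traceJet_eq hR₀ hx hV hB hν, hm] with s e hs
    obtain ⟨e1, e2⟩ := hxy s (Ioo_subset_Icc_self hs)
    have h0 : R₀ < ξ s 0 := by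
      rw [e1]
      exact hx.interior s hs
    rw [christoffel_eq hR₀ hV hB hν 𝓕 h0, e, e1, e2]
  refine ⟨hW (hx.memW1 hη (wη.isTraceable_R hx) (wη.isTraceable_θ hx)
      (memLp_one_iff_integrable.2 hJ.nR.integrable) (memLp_one_iff_integrable.2 hJ.nθ.integrable)),
    hW (hx.memW1 hU1 (wU.isTraceable_R hx) (wU.isTraceable_θ hx) u1 u2),
    hW (hx.memW1 hA1 (wA.isTraceable_R hx) (wA.isTraceable_θ hx) a1 a2), fun 𝓕 => ?_⟩
  refine ⟨fun a b c s => (traceJet R₀ U A η U' A' η' (x s) (y s)).christoffel 𝓕 a b c (ξ s),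
    ?_, ?_, ?_, ?_⟩
  · intro a b c
    exact memLp_one_iff_integrable.2
      (𝓕.tendstoL1_christoffel hK.continuousOn hdom hJ a b c).integrable
  · exact hsmooth 𝓕 hdata
  · intro Un An ηn hn hUn hAn hηn a b c
    have hd := fun n => (hn n).isWaveData
    have hJn := jetTendsto_traceJet hR₀ hx hd hdata
      (.of_tendstoEnergy one_le_two (fun n => (hn n).1) hU hUn)
      (.of_tendstoEnergy one_le_two (fun n => (hn n).2.1) hA hAn)
      (.of_tendstoEnergy le_rfl (fun n => (hn n).2.2.1) hη hηn)
    refine (𝓕.tendstoL1_christoffel hK.continuousOn hdom hJn a b c).tendsto.congr fun n => ?_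
    rw [eLpNorm_one_eq_lintegral_enorm]
    refine lintegral_congr_ae ?_
    filter_upwards [hsmooth 𝓕 (hd n) (hn n).1 (hn n).2.1 (hn n).2.2.1 a b c] with s e
    rw [e]
  · intro a b c _ hb hc
    simp only [AdaptedFrame.christoffel_killing 𝓕 _ hb hc]
    exact memLp_finsetSum _ fun i _ =>
      (TendstoBdd.of_continuousOn (𝓕.continuousOn_inv_curve hK.continuousOn hdom a i)).memLp_mul
        (hJ.memLp_coordChristoffel u1 u2 a1 a2 hb hc i)
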